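/- Let $M$ be an $m$-dimensional oriented (immersed) submanifold of $\mathbb R^{m+n}$, with the induced metric and its Levi-Civita connection $\nabla$. Let $B$ be its second fundamental form, $A$ its Weingarten operator ($A_\xi X=-(D_X\xi)^{\top}$ for normal $\xi$, so that $\langle A_\xi X,Y\rangle=\langle B(X,Y),\xi\rangle$), $H=\frac1m\,\mathrm{trace}\,B$ its mean curvature vector field, $\nabla^\perp$ its normal connection, $R^\perp(X,Y)=\nabla^\perp_X\nabla^\perp_Y-\nabla^\perp_Y\nabla^\perp_X-\nabla^\perp_{[X,Y]}$ its normal curvature, and $\Delta^\perp=-\mathrm{trace}\,(\nabla^\perp)^2$ the Laplacian in the normal bundle. Let $G(m,n)$ be the Grassmannian of oriented $m$-dimensional subspaces of $\mathbb R^{m+n}$ with its usual Riemannian metric: $T_PG(m,n)=\mathrm{Hom}(P,P^\perp)=P^*\otimes P^\perp$, and the vectors $e_i^*\otimes e_{m+a}$ ($1\le i\le m$, $1\le a\le n$) are orthonormal whenever $(e_i)$ and $(e_{m+a})$ are orthonormal bases of $P$ and $P^\perp$; equivalently, the metric induced by the embedding $P\mapsto e_1\wedge\dots\wedge e_m\in\Lambda^m\mathbb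 R^{m+n}$, where $(e_i)$ is a positively oriented orthonormal basis of $P$. Let $\gamma:M\to G(m,n)$, $\gamma(p)=T_pM$, be the Gauss map. A smooth map $\phi:M\to N$ of Riemannian manifolds is called biharmonic if its bitension field $\tau_2(\phi)=-\Delta\tau(\phi)-\mathrm{trace}\,R^N(d\phi,\tau(\phi))d\phi$ vanishes, where $\tau(\phi)=\mathrm{trace}\,\nabla d\phi$ is the tension field, $\Delta=-\mathrm{trace}\,\nabla^2$ is the rough Laplacian on sections of $\phi^{-1}(TN)$, and $R^N(X,Y)=\nabla_X\nabla_Y-\nabla_Y\nabla_X-\nabla_{[X,Y]}$. Then $\gamma$ is biharmonic if and only if, for every tangent vector $X$ of $M$, $$\nabla^\perp_X\Delta^\perp H-m\nabla^\perp_{A_H(X)}H+\sum_{i=1}^m B\big(2A_{\nabla^\perp_{E_i}H}(X)-A_{\nabla^\perp_XH}(E_i),E_i\big)-2\sum_{i=1}^m R^\perp(E_i,X)\nabla^\perp_{E_i}H-\sum_{i=1}^m(\nabla^\perp_{E_i}R^\perp)(E_i,X)H=0,$$ where $E_1,\dots,E_m$ is an orthonormal basis of the tangent space at the point under consideration. 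-/

import Mathlib

open scoped Manifold ContDiff

noncomputable section

namespace GaussMap

/-! ### The Grassmannian of oriented `m`-planes -/

/-- The space `Λ^m ℝ^N`, in the basis `e_I = e_{i₁} ∧ … ∧ e_{i_m}`, `I = {i₁ < … < i_m}`, which is
declared to be orthonormal. -/
abbrev MultiVector (m N : ℕ) : Type := EuclideanSpace ℝ (Fin m ↪o Fin N)

/-- `v₁ ∧ … ∧ v_m`: its `e_I`-coordinate is the `m × m` minor with columns in `I` of the matrix
with rows `v₁, …, v_m`. -/
def wedge {m N : ℕ} (v : Fin m → EuclideanSpace ℝ (Fin N)) : MultiVector m N :=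
  WithLp.toLp 2 fun I => Matrix.det (Matrix.of fun i j => v i (I j))

/-- `G(m,n)`: its points are the oriented `m`-dimensional subspaces of `ℝ^{m+n}`. -/
structure OrientedGrassmannian (m n : ℕ) where
  plane : Submodule ℝ (EuclideanSpace ℝ (Fin (m + n)))
  finrank_plane : Module.finrank ℝ plane = m
  orientation : Orientation ℝ plane (Fin m)

open Classical in
/-- The embedding `P ↦ e₁ ∧ … ∧ e_m` of `G(m,n)` in `Λ^m ℝ^{m+n}`, where `e₁, …, e_m` is a positively
oriented orthonormal basis of `P`. (An arbitrary orthonormal basis of `P` is taken, and the sign is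
changed if it is negatively oriented.) -/
def OrientedGrassmannian.toMultiVector {m n : ℕ} (P : OrientedGrassmannian m n) :
    MultiVector m (m + n) :=
  let b : OrthonormalBasis (Fin m) ℝ P.plane :=
    (stdOrthonormalBasis ℝ P.plane).reindex (finCongr P.finrank_plane)
  if b.toBasis.orientation = P.orientation then wedge fun i => (b i : EuclideanSpace ℝ _)
  else -wedge fun i => (b i : EuclideanSpace ℝ _)

/-- `G(m,n)` as a submanifold of `Λ^m ℝ^{m+n}`. With the induced metric, the vectors
`e₁ ∧ … ∧ e_{i-1} ∧ e_{m+a} ∧ e_{i+1} ∧ … ∧ e_m` form an orthonormal basis of the tangent space at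
`P = e₁ ∧ … ∧ e_m`, i.e. this is the usual metric of `T_P G(m,n) = Hom(P, P^⊥)`. -/
def grassmannian (m n : ℕ) : Set (MultiVector m (m + n)) :=
  Set.range (OrientedGrassmannian.toMultiVector (m := m) (n := n))

/-! ### Riemannian geometry of a submanifold `S` of a Euclidean space `V`, with the induced metric

Vector fields on `S` are `V`-valued maps with values in the tangent spaces. -/

section Target

variable {V : Type*} [NormedAddCommGroup V] [InnerProductSpace ℝ V] [FiniteDimensional ℝ V]

/-- `T_x S`: spanned by the velocities at `x` of the smooth curves in `S` through `x`. -/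
def tangentSpaceOf (S : Set V) (x : V) : Submodule ℝ V :=
  Submodule.span ℝ {v | ∃ c : ℝ → V, ContDiff ℝ ∞ c ∧ (∀ t, c t ∈ S) ∧ c 0 = x ∧ deriv c 0 = v}

/-- The orthogonal projection of `V` onto `T_x S`. -/
def projTo (S : Set V) (x : V) : V →L[ℝ] V := (tangentSpaceOf S x).starProjection

/-- The Levi-Civita connection `∇_u W` of `S` at `x`, for `u ∈ T_x S` and a vector field `W` on `S`:
the tangential part of the Euclidean derivative. -/
def covDeriv (S : Set V) (x u : V) (W : V → V) : V := projTo S x (fderivWithin ℝ W S x u)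

/-- The extension of a vector `w` to the vector field `y ↦ w^{tangent to S at y}` on `S`. -/
def extendTo (S : Set V) (w : V) : V → V := fun y => projTo S y w

/-- The curvature `R(u,v)w = ∇_u ∇_v w - ∇_v ∇_u w - ∇_{[u,v]} w` of `S` at `x`, for
`u, v, w ∈ T_x S` extended to vector fields on `S`. -/
def riemann (S : Set V) (x u v w : V) : V :=
  covDeriv S x u (fun y => covDeriv S y (extendTo S v y) (extendTo S w))
    - covDeriv S x v (fun y => covDeriv S y (extendTo S u y) (extendTo S w))
    - covDeriv S x (VectorField.lieBracketWithin ℝ (extendTo S u) (extendTo S v) S x)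
        (extendTo S w)

end Target

/-! ### Riemannian geometry of an immersed submanifold `f : M → E` of a Euclidean space `E`, with
the induced metric -/

section Source

variable {m : ℕ} {E : Type*} [NormedAddCommGroup E] [InnerProductSpace ℝ E]
  [FiniteDimensional ℝ E] {V : Type*} [NormedAddCommGroup V] [InnerProductSpace ℝ V]
  [FiniteDimensional ℝ V]
  {M : Type*} [TopologicalSpace M] [ChartedSpace (EuclideanSpace ℝ (Fin m)) M]

/-- A smooth immersion `f : M → E` of an `m`-dimensional manifold; it makes `M` an (immersed)
submanifold of `E`, with the induced metric. An embedded submanifold is given by its inclusion. -/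
structure Immersion (m : ℕ) (M : Type*) [TopologicalSpace M]
    [ChartedSpace (EuclideanSpace ℝ (Fin m)) M] (E : Type*) [NormedAddCommGroup E]
    [InnerProductSpace ℝ E] where
  toFun : M → E
  contMDiff : ContMDiff (𝓡 m) 𝓘(ℝ, E) ∞ toFun
  injective : ∀ p, Function.Injective (mvfderiv (𝓡 m) toFun p)

instance : CoeFun (Immersion m M E) fun _ => M → E := ⟨Immersion.toFun⟩

/-- The plane `df_p(T_p M)` in `E`. -/
def tangentPlane (f : Immersion m M E) (p : M) : Submodule ℝ E :=
  LinearMap.range (mvfderiv (𝓡 m) f p).toLinearMap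

/-- The tangential part of vectors of `E`. -/
def tanProj (f : Immersion m M E) (p : M) : E →L[ℝ] E := (tangentPlane f p).starProjection

/-- The normal part of vectors of `E`. -/
def norProj (f : Immersion m M E) (p : M) : E →L[ℝ] E := (tangentPlane f p)ᗮ.starProjection

/-- The tangential part of vectors of `E`, as an element of `T_p M`: for an immersion `f`, the
vector with `df_p (tanPart f p w) = tanProj f p w`. -/
def tanPart (f : Immersion m M E) (p : M) (w : E) : TangentSpace (𝓡 m) p :=
  (mvfderiv (𝓡 m) f p).toLinearMap.leftInverse (tanProj f p w)

/-- The extension of `v ∈ T_p M` to the vector field on `M` whose value at `q` is the tangential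
part at `q` of the constant vector `df_p v`. -/
def extend (f : Immersion m M E) (p : M) (v : TangentSpace (𝓡 m) p) (q : M) : TangentSpace (𝓡 m) q :=
  tanPart f q (mvfderiv (𝓡 m) f p v)

/-- The extension of `ξ ∈ N_p M` to the normal field `q ↦ ξ^⊥`. -/
def extendNormal (f : Immersion m M E) (ξ : E) (q : M) : E := norProj f q ξ

/-- The Levi-Civita connection `∇_u Y` of the induced metric. -/
def leviCivita (f : Immersion m M E) (p : M) (u : TangentSpace (𝓡 m) p)
    (Y : ∀ q : M, TangentSpace (𝓡 m) q) : TangentSpace (𝓡 m) p :=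
  tanPart f p (mvfderiv (𝓡 m) (fun q => mvfderiv (𝓡 m) f q (Y q)) p u)

/-- The trace `∑ᵢ β(eᵢ, eᵢ)` of a bilinear map on `T_p M`, where the `eᵢ` form an orthonormal basis
for the induced metric. -/
def trace (f : Immersion m M E) (p : M) (β : TangentSpace (𝓡 m) p → TangentSpace (𝓡 m) p → V) : V :=
  let e := stdOrthonormalBasis ℝ (tangentPlane f p)
  ∑ i, β (tanPart f p (e i)) (tanPart f p (e i))

/-- For a subbundle of the trivial bundle `M × V`, given by the orthogonal projections `Q p` onto
its fibres, the projected derivative `∇_u s` of a section `s` of that bundle. -/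
def projDeriv (Q : M → V →L[ℝ] V) (p : M) (u : TangentSpace (𝓡 m) p) (s : M → V) : V :=
  Q p (mvfderiv (𝓡 m) s p u)

/-- The rough Laplacian `Δ s = -trace ∇² s`, where
`∇² s (u,v) = ∇_u ∇_v s - ∇_{∇_u v} s`, for the connection `projDeriv Q`. -/
def roughLaplacian (f : Immersion m M E) (Q : M → V →L[ℝ] V) (s : M → V) (p : M) : V :=
  -trace f p fun u v =>
    projDeriv Q p u (fun q => projDeriv Q q (extend f p v q) s)
      - projDeriv Q p (leviCivita f p u (extend f p v)) s

/-! ### Normal bundle, second fundamental form, mean curvature, normal curvature -/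

/-- The normal connection `∇^⊥_u ξ`. -/
def nablaPerp (f : Immersion m M E) (p : M) (u : TangentSpace (𝓡 m) p) (ξ : M → E) : E :=
  projDeriv (norProj f) p u ξ

/-- The Laplacian `Δ^⊥ = -trace (∇^⊥)²` in the normal bundle. -/
def laplacianPerp (f : Immersion m M E) (ξ : M → E) : M → E := roughLaplacian f (norProj f) ξ

/-- The second fundamental form `B(u,v)`: the normal part of the Euclidean derivative in the
direction `u` of a tangent field that extends `v`. -/
def secondFF (f : Immersion m M E) (p : M) (u v : TangentSpace (𝓡 m) p) : E :=
  norProj f p (mvfderiv (𝓡 m) (fun q => mvfderiv (𝓡 m) f q (extend f p v q)) p u)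

/-- The Weingarten operator `A_ξ(u)`: minus the tangential part of the Euclidean derivative in the
direction `u` of a normal field that extends `ξ`. -/
def weingarten (f : Immersion m M E) (p : M) (ξ : E) (u : TangentSpace (𝓡 m) p) : TangentSpace (𝓡 m) p :=
  -tanPart f p (mvfderiv (𝓡 m) (extendNormal f ξ) p u)

/-- The mean curvature vector field `H = (1/m) trace B`. -/
def meanCurvature (f : Immersion m M E) (p : M) : E := (1 / (m : ℝ)) • trace f p (secondFF f p)

/-- The normal curvature `R^⊥(u,v)ξ = ∇^⊥_u ∇^⊥_v ξ - ∇^⊥_v ∇^⊥_u ξ - ∇^⊥_{[u,v]} ξ`, for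
`u, v ∈ T_p M` and `ξ ∈ N_p M` extended to fields. -/
def curvPerp (f : Immersion m M E) (p : M) (u v : TangentSpace (𝓡 m) p) (ξ : E) : E :=
  nablaPerp f p u (fun q => nablaPerp f q (extend f p v q) (extendNormal f ξ))
    - nablaPerp f p v (fun q => nablaPerp f q (extend f p u q) (extendNormal f ξ))
    - nablaPerp f p (VectorField.mlieBracket (𝓡 m) (extend f p u) (extend f p v) p)
        (extendNormal f ξ)

/-- The covariant derivative of the normal curvature,
`(∇^⊥_u R^⊥)(v,w)ξ = ∇^⊥_u (R^⊥(v,w)ξ) - R^⊥(∇_u v,w)ξ - R^⊥(v,∇_u w)ξ - R^⊥(v,w)∇^⊥_u ξ`, for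
`v, w ∈ T_p M` and `ξ ∈ N_p M` extended to fields. -/
def nablaCurvPerp (f : Immersion m M E) (p : M) (u v w : TangentSpace (𝓡 m) p) (ξ : E) : E :=
  nablaPerp f p u (fun q => curvPerp f q (extend f p v q) (extend f p w q) (extendNormal f ξ q))
    - curvPerp f p (leviCivita f p u (extend f p v)) w ξ
    - curvPerp f p v (leviCivita f p u (extend f p w)) ξ
    - curvPerp f p v w (nablaPerp f p u (extendNormal f ξ))

/-! ### Biharmonic maps from `M`, with the metric induced by `f`, to a submanifold `S` of `V` -/

/-- The pull-back connection `∇^φ` of the Levi-Civita connection of `S`, on vector fields along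
`φ : M → S`. -/
def nablaPullback (S : Set V) (φ : M → V) (p : M) (u : TangentSpace (𝓡 m) p) (W : M → V) : V :=
  projDeriv (fun q => projTo S (φ q)) p u W

/-- The tension field `τ(φ) = trace ∇dφ`, where `∇dφ(u,v) = ∇^φ_u (dφ v) - dφ(∇_u v)`. -/
def tension (f : Immersion m M E) (S : Set V) (φ : M → V) (p : M) : V :=
  trace f p fun u v =>
    nablaPullback S φ p u (fun q => mvfderiv (𝓡 m) φ q (extend f p v q))
      - mvfderiv (𝓡 m) φ p (leviCivita f p u (extend f p v))

/-- The bitension field `τ₂(φ) = -Δτ(φ) - trace R^S(dφ, τ(φ))dφ`. -/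
def bitension (f : Immersion m M E) (S : Set V) (φ : M → V) (p : M) : V :=
  -roughLaplacian f (fun q => projTo S (φ q)) (tension f S φ) p
    - trace f p fun u v =>
        riemann S (φ p) (mvfderiv (𝓡 m) φ p u) (tension f S φ p) (mvfderiv (𝓡 m) φ p v)

/-- `φ : M → S` is biharmonic: it is smooth and satisfies the biharmonic equation `τ₂(φ) = 0`. -/
def IsBiharmonic (f : Immersion m M E) (S : Set V) (φ : M → V) : Prop :=
  ContMDiff (𝓡 m) 𝓘(ℝ, V) ∞ φ ∧ (∀ p, φ p ∈ S) ∧ ∀ p, bitension f S φ p = 0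

end Source

/-! ### Orientations and the Gauss map -/

/-- A pointwise orientation of `M` is an orientation of the manifold `M` if every point has a
neighbourhood with a positively oriented smooth frame. -/
def IsOrientation {m : ℕ} {M : Type*} [TopologicalSpace M]
    [ChartedSpace (EuclideanSpace ℝ (Fin m)) M] [IsManifold (𝓡 m) ∞ M]
    (o : ∀ p : M, Orientation ℝ (TangentSpace (𝓡 m) p) (Fin m)) : Prop :=
  ∀ p : M, ∃ U : Set M, IsOpen U ∧ p ∈ U ∧
    ∃ X : Fin m → ∀ q : M, TangentSpace (𝓡 m) q,
      (∀ i, ContMDiffOn (𝓡 m) (𝓡 m).tangent ∞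
        (fun q => (⟨q, X i q⟩ : TangentBundle (𝓡 m) M)) U) ∧
      ∀ q ∈ U, ∃ b : Module.Basis (Fin m) ℝ (TangentSpace (𝓡 m) q),
        (∀ i, b i = X i q) ∧ b.orientation = o q

/-- The differential of an immersion at `p`, as an isomorphism of `T_p M` with its image. -/
def tangentEquiv {m : ℕ} {M : Type*} [TopologicalSpace M]
    [ChartedSpace (EuclideanSpace ℝ (Fin m)) M] {E : Type*} [NormedAddCommGroup E]
    [InnerProductSpace ℝ E] (f : Immersion m M E) (p : M) :
    TangentSpace (𝓡 m) p ≃ₗ[ℝ] tangentPlane f p :=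
  LinearEquiv.ofInjective (mvfderiv (𝓡 m) f p).toLinearMap (f.injective p)

/-- The Gauss map `γ : M → G(m,n)`, `p ↦ T_p M`, of an oriented immersed submanifold. -/
def gaussMap {m n : ℕ} {M : Type*} [TopologicalSpace M]
    [ChartedSpace (EuclideanSpace ℝ (Fin m)) M]
    (f : Immersion m M (EuclideanSpace ℝ (Fin (m + n))))
    (o : ∀ p : M, Orientation ℝ (TangentSpace (𝓡 m) p) (Fin m)) (p : M) :
    OrientedGrassmannian m n where
  plane := tangentPlane f p
  finrank_plane := by
    rw [← (tangentEquiv f p).finrank_eq]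
    exact finrank_euclideanSpace_fin
  orientation := Orientation.map (Fin m) (tangentEquiv f p) (o p)

end GaussMap

end

/-! Write `P` for the orthogonal projection onto the tangent plane, `Q = 1 - P`, and `D_A` for the
derivation `der A` of `Λ^m ℝ^N` induced by an endomorphism `A` of `ℝ^N`. At a unit volume element
`y` of a plane `T`, the map `u ↦ D_u y` is an isometry from `Hom(T, T^⊥)` with the Hilbert-Schmidt
product onto the tangent space of the Grassmannian (`IsUnitVolume.inner_der_der`,
`mem_tangentSpaceOf_grassmannian`). The moment map of `der` recovers the plane from `y`, `moment y y
= P` (`IsUnitVolume.moment_self`), so the projection onto the tangent spaces of the Grassmannian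
extends to the polynomial `tangentMap`. It is equivariant under rotations, so its derivative along
the orbit of a skew `A` is a commutator with `D_A` (`fderiv_tangentMap_skew`). Since `D_u y = D_{u -
u*} y`, this gives the curvature of a symmetric space, `R(u,v)w = u v* w - v u* w + w v* u - w u* v`
(`IsUnitVolume.riemann_eq`). On `M` everything is expressed by derivatives `∂_a` along the
tangential part of a constant vector `a`. The derivative `∂_a P` exchanges tangent and normal
vectors; on the former it is the second fundamental form `B`, on the latter the Weingarten operator.
From `moment γ γ = P` one gets `dγ(a) = D_{Q (∂_a P) P} γ` (`ambDeriv_gauss`), that is, `dγ = B`.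
The pull-back connection on vector fields `D_A γ` is the connection of `Hom(TM, NM)` acting on `A`
(`tangentMap_ambDeriv_der`). The trace of the Codazzi equation therefore gives the Ruh-Vilms formula
`τ(γ) = m ∇^⊥ H` (`tension_gauss`), and the bitension field becomes `biharmonicOp`: the trace of the
second covariant derivative of `m ∇^⊥ H` minus the curvature sum (`bitension_gauss`). It remains to
commute derivatives. The Ricci identity turns the traced second derivative of `∇^⊥ ξ` into `-∇^⊥ Δ^⊥
ξ` plus terms in `R^⊥`, `∇^⊥ R^⊥` and the Gauss equation (`sum_homDeriv_homDeriv`). One of the Gauss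
terms cancels against the curvature of the Grassmannian, the others form the sum of the `B(A …)`
terms (`biharmonicOp_apply`). By linearity `trace B = m H` may be replaced by `H`. -/

noncomputable section

namespace GaussMap

/-! ### Derivations of the exterior power -/

section Wedge

variable {m N : ℕ}

/-- `wedge` as an alternating map. -/
def wedgeAlt (m N : ℕ) : EuclideanSpace ℝ (Fin N) [⋀^Fin m]→ₗ[ℝ] MultiVector m N :=
  (WithLp.linearEquiv 2 ℝ ((Fin m ↪o Fin N) → ℝ)).symm.toLinearMap.compAlternatingMap
    (AlternatingMap.pi fun I : Fin m ↪o Fin N =>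
      (Matrix.detRowAlternating (R := ℝ) (n := Fin m)).compLinearMap
        (LinearMap.pi fun j => (EuclideanSpace.proj (I j) : EuclideanSpace ℝ (Fin N) →L[ℝ] ℝ).toLinearMap))

theorem wedgeAlt_apply (v : Fin m → EuclideanSpace ℝ (Fin N)) : wedgeAlt m N v = wedge v := rfl

theorem wedge_apply (v : Fin m → EuclideanSpace ℝ (Fin N)) (I : Fin m ↪o Fin N) :
    wedge v I = Matrix.det (Matrix.of fun i j => v i (I j)) := rfl

/-- The standard basis vector `e_k`. -/
abbrev stdVec (k : Fin N) : EuclideanSpace ℝ (Fin N) := EuclideanSpace.single k 1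

/-- Sorting an injective tuple of basis indices changes the value of an alternating map only by a
sign, so increasing tuples suffice. -/
theorem ext_alternating_orderEmb {W : Type*} [AddCommGroup W] [Module ℝ W]
    {g h : EuclideanSpace ℝ (Fin N) [⋀^Fin m]→ₗ[ℝ] W}
    (H : ∀ I : Fin m ↪o Fin N, g (fun k => stdVec (I k)) = h (fun k => stdVec (I k))) : g = h := by
  refine (EuclideanSpace.basisFun (Fin N) ℝ).toBasis.ext_alternating fun v hv => ?_
  have hmono : StrictMono (v ∘ Tuple.sort v) :=
    (Tuple.monotone_sort v).strictMono_of_injective (hv.comp (Tuple.sort v).injective)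
  have h1 := H (OrderEmbedding.ofStrictMono _ hmono)
  have key : ∀ g : EuclideanSpace ℝ (Fin N) [⋀^Fin m]→ₗ[ℝ] W,
      g (fun k => stdVec (OrderEmbedding.ofStrictMono _ hmono k))
        = Equiv.Perm.sign (Tuple.sort v) • g (fun k => stdVec (v k)) := fun g => by
    rw [← AlternatingMap.map_perm]; rfl
  rw [key, key] at h1
  simpa using smul_left_cancel _ h1

theorem wedge_stdVec (I : Fin m ↪o Fin N) :
    wedge (fun k => stdVec (I k)) = EuclideanSpace.single I (1 : ℝ) := by
  ext J
  rw [wedge_apply]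
  by_cases h : J = I
  · subst h
    have : (Matrix.of fun i j => (stdVec (J i) : EuclideanSpace ℝ (Fin N)) (J j))
        = (1 : Matrix (Fin m) (Fin m) ℝ) := by
      ext i j
      simp [Matrix.one_apply, eq_comm]
    rw [this]; simp
  · have hr : ∃ i, I i ∉ Set.range J := by
      by_contra hcon
      push Not at hcon
      apply h
      have hsub : Set.range I ⊆ Set.range J := by rintro _ ⟨i, rfl⟩; exact hcon i
      have hcard : Set.range I = Set.range J := by
        apply Set.eq_of_subset_of_ncard_le hsub
        rw [← Set.image_univ, ← Set.image_univ, Set.ncard_image_of_injective _ I.injective,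
          Set.ncard_image_of_injective _ J.injective]
      exact (OrderEmbedding.range_inj.1 hcard).symm
    obtain ⟨i, hi⟩ := hr
    rw [Matrix.det_eq_zero_of_row_eq_zero i]
    · simp [h]
    · intro j
      simp only [Matrix.of_apply, PiLp.single_apply]
      rw [if_neg]
      intro hj; exact hi ⟨j, hj⟩

/-- The derivation `v ↦ ∑ᵢ g(v₁, …, A vᵢ, …, v_m)` of an alternating map. -/
def alternatingDer {E W : Type*} [AddCommGroup E] [Module ℝ E] [AddCommGroup W] [Module ℝ W]
    (g : E [⋀^Fin m]→ₗ[ℝ] W) (A : E →ₗ[ℝ] E) : E [⋀^Fin m]→ₗ[ℝ] W :=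
  { ∑ i, g.toMultilinearMap.compLinearMap (Function.update (fun _ => LinearMap.id) i A) with
    map_eq_zero_of_eq' := by
      intro v i j hij hne
      have hterm : ∀ k, (g.toMultilinearMap.compLinearMap
          (Function.update (fun _ => LinearMap.id) k A)) v = g (Function.update v k (A (v k))) := by
        intro k
        simp only [MultilinearMap.compLinearMap_apply, AlternatingMap.coe_multilinearMap]
        congr 1
        ext l
        by_cases h : l = k
        · subst h; simp
        · simp [h]
      simp only [MultilinearMap.toFun_eq_coe, sum_apply, hterm]
      -- Terms with `k ≠ i, j` still contain two equal arguments; the terms `k = i` and `k = j`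
      -- differ by a transposition and cancel.
      rw [← Finset.add_sum_erase _ _ (Finset.mem_univ i),
        ← Finset.add_sum_erase _ _ (Finset.mem_erase.2 ⟨hne.symm, Finset.mem_univ j⟩),
        Finset.sum_eq_zero, add_zero]
      · have : Function.update v j (A (v j)) = Function.update v i (A (v i)) ∘ Equiv.swap i j := by
          ext l
          by_cases hl : l = j
          · subst hl; simp [hij]
          · by_cases hl' : l = i
            · subst hl'; simp [hne, hne.symm, hij]
            · simp [Equiv.swap_apply_of_ne_of_ne hl' hl, hl, hl']
        rw [this, g.map_swap _ hne, add_neg_cancel]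
      · intro k hk
        simp only [Finset.mem_erase, Finset.mem_univ, and_true] at hk
        refine g.map_eq_zero_of_eq _ (i := i) (j := j) ?_ hne
        simp [hk.1.symm, hk.2.symm, hij] }

theorem alternatingDer_apply {E W : Type*} [AddCommGroup E] [Module ℝ E] [AddCommGroup W]
    [Module ℝ W] (g : E [⋀^Fin m]→ₗ[ℝ] W) (A : E →ₗ[ℝ] E) (v : Fin m → E) :
    alternatingDer g A v = ∑ i, g (Function.update v i (A (v i))) := by
  have : alternatingDer g A v = (∑ i, g.toMultilinearMap.compLinearMap
      (Function.update (fun _ => LinearMap.id) i A)) v := rfl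
  rw [this, sum_apply]
  refine Finset.sum_congr rfl fun k _ => ?_
  simp only [MultilinearMap.compLinearMap_apply, AlternatingMap.coe_multilinearMap]
  congr 1
  ext l
  by_cases h : l = k
  · subst h; simp
  · simp [h]

/-- The derivation of `Λ^m ℝ^N` induced by an endomorphism of `ℝ^N`. -/
def der : (EuclideanSpace ℝ (Fin N) →L[ℝ] EuclideanSpace ℝ (Fin N)) →ₗ[ℝ]
    (MultiVector m N →L[ℝ] MultiVector m N) where
  toFun A := LinearMap.toContinuousLinearMap
    ((EuclideanSpace.basisFun (Fin m ↪o Fin N) ℝ).toBasis.constr ℝ fun I =>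
      alternatingDer (wedgeAlt m N) A.toLinearMap fun k => stdVec (I k))
  map_add' A B := by
    rw [← map_add]
    congr 1
    refine (EuclideanSpace.basisFun (Fin m ↪o Fin N) ℝ).toBasis.ext fun I => ?_
    simp [-OrthonormalBasis.coe_toBasis, alternatingDer_apply, Finset.sum_add_distrib]
  map_smul' r A := by
    rw [RingHom.id_apply, ← map_smul]
    congr 1
    refine (EuclideanSpace.basisFun (Fin m ↪o Fin N) ℝ).toBasis.ext fun I => ?_
    simp [-OrthonormalBasis.coe_toBasis, alternatingDer_apply, Finset.smul_sum, smul_comm r]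

variable (A B : EuclideanSpace ℝ (Fin N) →L[ℝ] EuclideanSpace ℝ (Fin N))

theorem der_single (I : Fin m ↪o Fin N) : der A (EuclideanSpace.single I (1 : ℝ))
    = alternatingDer (wedgeAlt m N) A.toLinearMap fun k => stdVec (I k) := by
  simp [der]

/-- The formula that defines `der` on basis vectors passes to all decomposable vectors, because both
sides are alternating in `v`. -/
theorem der_wedge (v : Fin m → EuclideanSpace ℝ (Fin N)) :
    der A (wedge v) = ∑ i, wedge (Function.update v i (A (v i))) := by
  have : (der A : MultiVector m N →L[ℝ] MultiVector m N).toLinearMap.compAlternatingMap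
      (wedgeAlt m N) = alternatingDer (wedgeAlt m N) A.toLinearMap := by
    refine ext_alternating_orderEmb fun I => ?_
    rw [LinearMap.compAlternatingMap_apply, wedgeAlt_apply, wedge_stdVec]
    exact der_single A I
  have h2 := congrArg (fun g => g v) this
  simpa only [LinearMap.compAlternatingMap_apply, alternatingDer_apply] using! h2

theorem ext_wedge {W : Type*} [AddCommGroup W] [Module ℝ W] {g h : MultiVector m N →ₗ[ℝ] W}
    (H : ∀ v : Fin m → EuclideanSpace ℝ (Fin N), g (wedge v) = h (wedge v)) : g = h := by
  refine (EuclideanSpace.basisFun (Fin m ↪o Fin N) ℝ).toBasis.ext fun I => ?_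
  simpa [wedge_stdVec] using H fun k => stdVec (I k)

/-- Terms in which `A` and `B` act on different factors are symmetric in `A` and `B` and cancel; the
terms where they act on the same factor leave the commutator. -/
theorem der_comm (x : MultiVector m N) :
    der A (der B x) - der B (der A x) = der (A * B - B * A) x := by
  have : (der A * der B - der B * der A : MultiVector m N →L[ℝ] MultiVector m N).toLinearMap
      = (der (A * B - B * A) : MultiVector m N →L[ℝ] MultiVector m N).toLinearMap := by
    refine ext_wedge fun v => ?_
    simp only [ContinuousLinearMap.coe_coe, sub_apply,
      mul_apply_eq_comp, der_wedge, map_sum]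
    have key : ∀ (A B : EuclideanSpace ℝ (Fin N) →L[ℝ] EuclideanSpace ℝ (Fin N)),
        ∑ i, ∑ j, wedge (Function.update (Function.update v i (B (v i))) j
          (A (Function.update v i (B (v i)) j)))
        = ∑ i, wedge (Function.update v i (A (B (v i)))) + ∑ i, ∑ j ∈ Finset.univ.erase i,
          wedge (Function.update (Function.update v i (B (v i))) j (A (v j))) := by
      intro A B
      rw [← Finset.sum_add_distrib]
      refine Finset.sum_congr rfl fun i _ => ?_
      rw [← Finset.add_sum_erase _ _ (Finset.mem_univ i)]
      congr 1
      · simp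
      · refine Finset.sum_congr rfl fun j hj => ?_
        rw [Function.update_of_ne (Finset.ne_of_mem_erase hj)]
    rw [key A B, key B A]
    have hsym : ∑ i, ∑ j ∈ Finset.univ.erase i,
          wedge (Function.update (Function.update v i (B (v i))) j (A (v j)))
        = ∑ i, ∑ j ∈ Finset.univ.erase i,
          wedge (Function.update (Function.update v i (A (v i))) j (B (v j))) := by
      rw [Finset.sum_comm' (t' := Finset.univ) (s' := fun i => Finset.univ.erase i)]
      · refine Finset.sum_congr rfl fun i _ => Finset.sum_congr rfl fun j hj => ?_
        rw [Function.update_comm (Finset.ne_of_mem_erase hj)]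
      · intro i j; simp [eq_comm]
    rw [hsym, add_sub_add_right_eq_sub, ← Finset.sum_sub_distrib]
    refine Finset.sum_congr rfl fun i _ => ?_
    simp only [← wedgeAlt_apply]
    exact ((wedgeAlt m N).map_update_sub v i _ _).symm
  exact congrArg (fun g => g x) this

/-- By Cramer's rule both sums are the trace of the product of `H` with the adjugate of `G`. -/
theorem sum_det_updateRow_eq (G H : Matrix (Fin m) (Fin m) ℝ) :
    ∑ i, (G.updateRow i (H i)).det = ∑ j, (G.updateCol j (fun i => H i j)).det := by
  have h1 : ∀ j, (G.updateCol j (fun i => H i j)).det = (G.adjugate * H) j j := fun j => by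
    rw [← Matrix.cramer_apply, Matrix.cramer_eq_adjugate_mulVec]; rfl
  have h2 : ∀ i, (G.updateRow i (H i)).det = (H * G.adjugate) i i := fun i => by
    rw [← Matrix.cramer_transpose_apply, Matrix.cramer_eq_adjugate_mulVec,
      ← Matrix.adjugate_transpose]
    simp [Matrix.mulVec, Matrix.mul_apply, dotProduct, mul_comm]
  simp only [h1, h2]
  exact Matrix.trace_mul_comm H G.adjugate

/-- A form of Cauchy-Binet: both sides are alternating in `v`, and on increasing tuples of basis
vectors the Gram determinant is a minor of `w`. -/
theorem inner_wedge (v w : Fin m → EuclideanSpace ℝ (Fin N)) :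
    inner ℝ (wedge v) (wedge w) = Matrix.det (Matrix.of fun i j => inner ℝ (v i) (w j)) := by
  have : (innerSL ℝ (wedge w)).toLinearMap.compAlternatingMap (wedgeAlt m N)
      = (Matrix.detRowAlternating (R := ℝ) (n := Fin m)).compLinearMap
        (LinearMap.pi fun j => (innerSL ℝ (w j)).toLinearMap) := by
    refine ext_alternating_orderEmb fun I => ?_
    rw [LinearMap.compAlternatingMap_apply, wedgeAlt_apply, wedge_stdVec]
    have hl : inner ℝ (wedge w) (EuclideanSpace.single I (1 : ℝ)) = wedge w I := by
      rw [EuclideanSpace.inner_single_right]; simp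
    refine hl.trans ?_
    rw [wedge_apply, ← Matrix.det_transpose]
    change _ = Matrix.det _
    congr 1
    ext i j
    simp [EuclideanSpace.inner_single_right]
  have h2 := congrArg (fun g => g v) this
  rw [real_inner_comm]
  refine Eq.trans h2 ?_
  change Matrix.det _ = _
  congr 1
  ext i j
  exact real_inner_comm (v i) (w j)

/-- On decomposable vectors, applying `A` to `v i` replaces a row of the Gram matrix and applying
the adjoint to `w j` replaces a column; `sum_det_updateRow_eq` compares the two sums. -/
theorem inner_der (x y : MultiVector m N) :
    inner ℝ (der A x) y = inner ℝ x (der (ContinuousLinearMap.adjoint A) y) := by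
  have h1 : ∀ v w : Fin m → EuclideanSpace ℝ (Fin N), inner ℝ (der A (wedge v)) (wedge w)
      = inner ℝ (wedge v) (der (ContinuousLinearMap.adjoint A) (wedge w)) := by
    intro v w
    rw [der_wedge, der_wedge, sum_inner, inner_sum]
    simp only [inner_wedge]
    convert sum_det_updateRow_eq (Matrix.of fun i j => inner ℝ (v i) (w j))
      (Matrix.of fun i j => inner ℝ (A (v i)) (w j)) using 1
    · refine Finset.sum_congr rfl fun i _ => congrArg _ ?_
      ext k l
      by_cases h : k = i
      · subst h; simp
      · simp [h]
    · refine Finset.sum_congr rfl fun j _ => congrArg _ ?_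
      ext k l
      by_cases h : l = j
      · subst h; simp [ContinuousLinearMap.adjoint_inner_right]
      · simp [h]
  have h2 : ∀ v : Fin m → EuclideanSpace ℝ (Fin N), inner ℝ (der A (wedge v)) y
      = inner ℝ (wedge v) (der (ContinuousLinearMap.adjoint A) y) := by
    intro v
    have : (innerSL ℝ (der A (wedge v))).toLinearMap = ((innerSL ℝ (wedge v)).comp
        (der (ContinuousLinearMap.adjoint A) : MultiVector m N →L[ℝ] MultiVector m N)).toLinearMap :=
      ext_wedge fun w => h1 v w
    exact congrArg (fun g => g y) this
  have : ((innerSL ℝ y).comp (der A : MultiVector m N →L[ℝ] MultiVector m N)).toLinearMap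
      = (innerSL ℝ (der (ContinuousLinearMap.adjoint A) y)).toLinearMap :=
    ext_wedge fun v => by
      have := h2 v
      rw [real_inner_comm, real_inner_comm _ (wedge v)] at this
      exact this
  have h3 := congrArg (fun g => g x) this
  rw [real_inner_comm, real_inner_comm _ x]
  exact h3

end Wedge

/-! ### The Hilbert-Schmidt product and the moment map of `der` -/

theorem clm_neg_mul {E : Type*} [NormedAddCommGroup E] [NormedSpace ℝ E] (A B : E →L[ℝ] E) :
    -A * B = -(A * B) := neg_mul A B

theorem clm_mul_neg {E : Type*} [NormedAddCommGroup E] [NormedSpace ℝ E] (A B : E →L[ℝ] E) :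
    A * -B = -(A * B) := mul_neg A B

section HilbertSchmidt

variable {m N : ℕ}

/-- The algebra of endomorphisms of `ℝ^N`. -/
abbrev Op (N : ℕ) : Type := EuclideanSpace ℝ (Fin N) →L[ℝ] EuclideanSpace ℝ (Fin N)

/-- The Hilbert-Schmidt inner product. -/
def hs (A B : Op N) : ℝ := ∑ k, inner ℝ (A (stdVec k)) (B (stdVec k))

theorem sum_inner_stdVec (x y : EuclideanSpace ℝ (Fin N)) :
    ∑ k, inner ℝ x (stdVec k) * inner ℝ (stdVec k) y = inner ℝ x y := by
  simpa using (EuclideanSpace.basisFun (Fin N) ℝ).sum_inner_mul_inner x y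

theorem sum_stdVec_smul (x : EuclideanSpace ℝ (Fin N)) :
    ∑ k, inner ℝ (stdVec k) x • stdVec k = x := by
  simpa using (EuclideanSpace.basisFun (Fin N) ℝ).sum_repr' x

theorem hs_comm (A B : Op N) : hs A B = hs B A :=
  Finset.sum_congr rfl fun _ _ => real_inner_comm _ _

theorem hs_star (A B : Op N) : hs (star A) (star B) = hs A B := by
  have h : ∀ A B : Op N, hs A B
      = ∑ k, ∑ l, inner ℝ (A (stdVec k)) (stdVec l) * inner ℝ (B (stdVec k)) (stdVec l) := by
    intro A B
    refine Finset.sum_congr rfl fun k _ => ?_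
    rw [← sum_inner_stdVec]
    exact Finset.sum_congr rfl fun l _ => by rw [real_inner_comm (B _)]
  rw [h, h, Finset.sum_comm]
  refine Finset.sum_congr rfl fun k _ => Finset.sum_congr rfl fun l _ => ?_
  simp only [ContinuousLinearMap.star_eq_adjoint, ContinuousLinearMap.adjoint_inner_left]
  rw [real_inner_comm (stdVec l), real_inner_comm (stdVec l)]

theorem hs_mul_left (A B C : Op N) : hs A (B * C) = hs (star B * A) C :=
  Finset.sum_congr rfl fun k _ => by
    simp [ContinuousLinearMap.star_eq_adjoint, ContinuousLinearMap.adjoint_inner_left]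

theorem hs_mul_right (A B C : Op N) : hs A (B * C) = hs (A * star C) B := by
  rw [← hs_star, star_mul, hs_mul_left, ← hs_star]
  simp

theorem hs_add_left (A B C : Op N) : hs (A + B) C = hs A C + hs B C := by
  simp [hs, inner_add_left, Finset.sum_add_distrib]

theorem hs_sub_left (A B C : Op N) : hs (A - B) C = hs A C - hs B C := by
  simp [hs, inner_sub_left, Finset.sum_sub_distrib]

theorem hs_neg_left (A B : Op N) : hs (-A) B = -hs A B := by
  simp [hs]

theorem eq_zero_of_hs_self {A : Op N} (h : hs A A = 0) : A = 0 := by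
  have h0 := (Finset.sum_eq_zero_iff_of_nonneg
    (fun k _ => real_inner_self_nonneg (x := A (stdVec k)))).1 h
  ext x : 1
  rw [← sum_stdVec_smul x, map_sum]
  refine Finset.sum_eq_zero fun k hk => ?_
  rw [map_smul, inner_self_eq_zero.1 (h0 k hk), smul_zero]

theorem ext_hs {A B : Op N} (h : ∀ C, hs A C = hs B C) : A = B := by
  rw [← sub_eq_zero]
  apply eq_zero_of_hs_self
  rw [hs_sub_left, h, sub_self]

theorem hs_skew {A P : Op N} (hP : star P = P) (hA : star A = -A) : hs P A = 0 := by
  have := hs_star P A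
  rw [hP, hA, hs_comm, hs_neg_left, hs_comm] at this
  linarith

/-- The operator `μ(x,y)` with `⟨μ(x,y), A⟩ = ⟨x, D_A y⟩` for the Hilbert-Schmidt product. -/
def moment (x y : MultiVector m N) : Op N :=
  ∑ k, ∑ l, inner ℝ x (der (InnerProductSpace.rankOne ℝ (stdVec l) (stdVec k)) y)
    • InnerProductSpace.rankOne ℝ (stdVec l) (stdVec k)

theorem sum_rankOne_stdVec (A : Op N) : ∑ k, ∑ l, inner ℝ (stdVec l) (A (stdVec k))
    • InnerProductSpace.rankOne ℝ (stdVec l) (stdVec k) = A := by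
  ext x : 1
  conv_rhs => rw [← sum_stdVec_smul x, map_sum]
  simp only [FunLike.coe_sum, Finset.sum_apply]
  refine Finset.sum_congr rfl fun k _ => ?_
  rw [map_smul]
  conv_rhs => rw [← sum_stdVec_smul (A (stdVec k)), Finset.smul_sum]
  refine Finset.sum_congr rfl fun l _ => ?_
  simp only [smul_apply, InnerProductSpace.rankOne_apply]
  rw [smul_comm]

theorem hs_moment (x y : MultiVector m N) (A : Op N) : hs (moment x y) A = inner ℝ x (der A y) := by
  have h : ∀ k, moment x y (stdVec k)
      = ∑ l, inner ℝ x (der (InnerProductSpace.rankOne ℝ (stdVec l) (stdVec k)) y) • stdVec l := by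
    intro k
    simp only [moment, FunLike.coe_sum, Finset.sum_apply,
      smul_apply, InnerProductSpace.rankOne_apply]
    rw [Finset.sum_eq_single k]
    · simp
    · intro j _ hj
      rw [EuclideanSpace.inner_single_left]
      simp [hj]
    · simp
  conv_rhs => rw [← sum_rankOne_stdVec A]
  simp only [hs, h, map_sum, map_smul, FunLike.coe_sum, Finset.sum_apply,
      smul_apply, inner_sum, sum_inner, inner_smul_left, inner_smul_right]
  refine Finset.sum_congr rfl fun k _ => Finset.sum_congr rfl fun l _ => ?_
  simp [mul_comm]

theorem moment_add_left (x x' y : MultiVector m N) :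
    moment (x + x') y = moment x y + moment x' y :=
  ext_hs fun C => by rw [hs_add_left]; simp only [hs_moment, inner_add_left]

theorem contDiff_moment {W : Type*} [NormedAddCommGroup W] [NormedSpace ℝ W]
    {a b : W → MultiVector m N} (ha : ContDiff ℝ ∞ a) (hb : ContDiff ℝ ∞ b) :
    ContDiff ℝ ∞ fun z => moment (a z) (b z) := by
  unfold moment
  refine ContDiff.sum fun k _ => ContDiff.sum fun l _ => ?_
  have h : ContDiff ℝ ∞ fun z => inner ℝ (a z)
      (der (InnerProductSpace.rankOne ℝ (stdVec l) (stdVec k)) (b z)) :=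
    ha.inner ℝ ((der _).contDiff.comp hb)
  fun_prop

/-- `moment` as a bilinear map. -/
def momentBilin (m N : ℕ) : MultiVector m N →ₗ[ℝ] MultiVector m N →ₗ[ℝ] Op N :=
  LinearMap.mk₂ ℝ moment (fun x x' y => moment_add_left x x' y)
    (fun c x y => by simp [moment, inner_smul_left, Finset.smul_sum, mul_smul])
    (fun x y y' => by simp [moment, inner_add_right, Finset.sum_add_distrib, add_smul])
    (fun c x y => by simp [moment, inner_smul_right, Finset.smul_sum, mul_smul])

/-- `moment` is equivariant under rotations. -/
theorem moment_skew {A : Op N} (hA : star A = -A) (x y : MultiVector m N) :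
    moment (der A x) y + moment x (der A y) = A * moment x y - moment x y * A := by
  refine ext_hs fun C => ?_
  have h1 : hs (A * moment x y) C = -hs (moment x y) (A * C) := by
    rw [hs_mul_left, hA, clm_neg_mul, hs_neg_left, neg_neg]
  have h2 : hs (moment x y * A) C = -hs (moment x y) (C * A) := by
    rw [hs_mul_right, hA, clm_mul_neg, hs_neg_left, neg_neg]
  rw [hs_add_left, hs_sub_left, h1, h2, hs_moment, hs_moment, hs_moment, hs_moment, inner_der,
    ← ContinuousLinearMap.star_eq_adjoint, hA]
  have h3 := der_comm C A y
  rw [sub_eq_iff_eq_add] at h3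
  rw [h3, map_neg, map_sub]
  simp only [sub_apply, neg_apply, inner_add_right, inner_sub_right,
    inner_neg_right]
  ring

theorem contDiff_der {W : Type*} [NormedAddCommGroup W] [NormedSpace ℝ W]
    {A : W → Op N} {b : W → MultiVector m N} (hA : ContDiff ℝ ∞ A) (hb : ContDiff ℝ ∞ b) :
    ContDiff ℝ ∞ fun z => der (A z) (b z) := by
  have : ContDiff ℝ ∞ fun z => LinearMap.toContinuousLinearMap (der (m := m) (N := N)) (A z) := by
    fun_prop
  exact this.clm_apply hb

end HilbertSchmidt

/-! ### Unit volume elements of planes -/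

section UnitVolume

variable {m N : ℕ} {T : Submodule ℝ (EuclideanSpace ℝ (Fin N))} {y : MultiVector m N}

/-- `y = ± e₁ ∧ … ∧ e_m` for an orthonormal basis of `T`. -/
def IsUnitVolume (T : Submodule ℝ (EuclideanSpace ℝ (Fin N))) (y : MultiVector m N) : Prop :=
  ∃ b : OrthonormalBasis (Fin m) ℝ T, ∃ r : ℝ, r * r = 1 ∧
    y = r • wedge fun i => (b i : EuclideanSpace ℝ (Fin N))

theorem starProjection_star (T : Submodule ℝ (EuclideanSpace ℝ (Fin N))) :
    star T.starProjection = T.starProjection := isSelfAdjoint_starProjection T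

theorem starProjection_mul_self (T : Submodule ℝ (EuclideanSpace ℝ (Fin N))) :
    T.starProjection * T.starProjection = T.starProjection := T.isIdempotentElem_starProjection

theorem IsUnitVolume.inner_self (h : IsUnitVolume T y) : inner ℝ y y = (1 : ℝ) := by
  obtain ⟨b, r, hr, rfl⟩ := h
  rw [inner_smul_left, inner_smul_right, inner_wedge]
  have : (Matrix.of fun i j => inner ℝ (b i : EuclideanSpace ℝ (Fin N)) (b j))
      = (1 : Matrix (Fin m) (Fin m) ℝ) := by
    ext i j
    simpa [Matrix.one_apply] using! orthonormal_iff_ite.1 b.orthonormal i j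
  rw [this]
  simpa using hr

theorem IsUnitVolume.der_eq_zero (h : IsUnitVolume T y) {A : Op N} (hA : A * T.starProjection = 0) :
    der A y = 0 := by
  obtain ⟨b, r, hr, rfl⟩ := h
  rw [map_smul, der_wedge, Finset.sum_eq_zero, smul_zero]
  intro i _
  have : A (b i) = 0 := by
    have h1 := congrArg (fun B : Op N => B (b i)) hA
    simpa [Submodule.starProjection_eq_self_iff.2 (b i).2] using h1
  rw [this]
  exact (wedgeAlt m N).map_update_zero _ i

theorem hs_starProjection (b : OrthonormalBasis (Fin m) ℝ T) (A : Op N) :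
    hs T.starProjection A = ∑ i, inner ℝ (b i : EuclideanSpace ℝ (Fin N)) (A (b i)) := by
  have h1 : ∀ i, A (b i) = ∑ k, inner ℝ (stdVec k) (b i : EuclideanSpace ℝ (Fin N))
      • A (stdVec k) := fun i => by
    conv_lhs => rw [← sum_stdVec_smul (b i : EuclideanSpace ℝ (Fin N)), map_sum]
    simp
  simp_rw [h1, inner_sum, hs]
  rw [Finset.sum_comm]
  refine Finset.sum_congr rfl fun k _ => ?_
  rw [b.starProjection_eq_sum_rankOne]
  simp only [FunLike.coe_sum, Finset.sum_apply, InnerProductSpace.rankOne_apply, sum_inner,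
    inner_smul_left, inner_smul_right]
  exact Finset.sum_congr rfl fun i _ => by rw [real_inner_comm]; rfl

/-- The component of `A (b i)` along `b j` with `j ≠ i` repeats a factor of the wedge, so only the
trace of `A` over `T` survives. -/
theorem IsUnitVolume.der_proj_mul (h : IsUnitVolume T y) (A : Op N) :
    der (T.starProjection * A) y = hs T.starProjection A • y := by
  obtain ⟨b, r, hr, rfl⟩ := h
  rw [map_smul, der_wedge, hs_starProjection b, smul_comm]
  congr 1
  rw [Finset.sum_smul]
  refine Finset.sum_congr rfl fun i _ => ?_
  have h1 : (T.starProjection * A) (b i : EuclideanSpace ℝ (Fin N))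
      = ∑ j, inner ℝ (b j : EuclideanSpace ℝ (Fin N)) (A (b i)) • (b j : EuclideanSpace ℝ (Fin N)) := by
    rw [b.starProjection_eq_sum_rankOne]
    simp
  rw [h1, ← wedgeAlt_apply, AlternatingMap.map_update_sum, Finset.sum_eq_single i]
  · rw [AlternatingMap.map_update_smul]
    congr 1
    rw [Function.update_eq_self (f := fun i => (b i : EuclideanSpace ℝ (Fin N)))]
    rfl
  · intro j _ hj
    rw [AlternatingMap.map_update_smul, (wedgeAlt m N).map_eq_zero_of_eq _ _ hj, smul_zero]
    simp [hj]
  · simp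

/-- In the splitting `A = P A + Q A P + Q A Q` the first block scales `y` and the last annihilates
it; only the block in `Hom(T, T^⊥)` moves the plane. -/
theorem IsUnitVolume.der_eq (h : IsUnitVolume T y) (A : Op N) :
    der A y = hs T.starProjection A • y
      + der ((1 - T.starProjection) * A * T.starProjection) y := by
  have h1 : A = T.starProjection * A + (1 - T.starProjection) * A * T.starProjection
      + (1 - T.starProjection) * A * (1 - T.starProjection) := by
    simp only [mul_sub, sub_mul, one_mul, mul_one]; abel
  have h2 : der ((1 - T.starProjection) * A * (1 - T.starProjection)) y = 0 :=
    h.der_eq_zero (by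
      rw [mul_assoc, sub_mul _ _ T.starProjection, starProjection_mul_self, one_mul, sub_self,
        mul_zero])
  conv_lhs => rw [h1]
  rw [map_add, map_add, add_apply, add_apply, h2,
    h.der_proj_mul, add_zero]

theorem IsUnitVolume.inner_der_self_of_proj_mul (h : IsUnitVolume T y) {A : Op N}
    (hA : T.starProjection * A = 0) : inner ℝ y (der A y) = 0 := by
  rw [← star_star A, ContinuousLinearMap.star_eq_adjoint (star A), ← inner_der, h.der_eq_zero]
  · simp
  · rw [← star_eq_zero, star_mul, star_star, starProjection_star, hA]

/-- By `der_eq`, `⟨y, D_A y⟩` is the pairing of `A` with the projection. Thus the plane is a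
quadratic function of its volume element, which makes the later projections polynomial. -/
theorem IsUnitVolume.moment_self (h : IsUnitVolume T y) : moment y y = T.starProjection := by
  refine ext_hs fun A => ?_
  rw [hs_moment, h.der_eq, inner_add_right, inner_smul_right, h.inner_self,
    h.inner_der_self_of_proj_mul]
  · simp
  · rw [← mul_assoc, ← mul_assoc, mul_sub, starProjection_mul_self]; simp

/-- Both `u*` and `w u*` vanish on `T` and hence annihilate `y`; what remains of the commutator of
derivations is `D_{u* w}`. -/
theorem IsUnitVolume.der_star_der (h : IsUnitVolume T y) {u w : Op N}
    (hu : T.starProjection * u = 0) : der (star u) (der w y) = der (star u * w) y := by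
  have hu' : star u * T.starProjection = 0 := by
    rw [← star_eq_zero, star_mul, star_star, starProjection_star, hu]
  have h1 := der_comm (star u) w y
  rw [h.der_eq_zero hu', map_zero, sub_zero, map_sub, sub_apply,
    h.der_eq_zero (A := w * star u) (by rw [mul_assoc, hu', mul_zero]), sub_zero] at h1
  exact h1

theorem IsUnitVolume.inner_der_der (h : IsUnitVolume T y) {u w : Op N}
    (hu : T.starProjection * u = 0) (hw : w * T.starProjection = w) :
    inner ℝ (der u y) (der w y) = hs u w := by
  rw [inner_der, ← ContinuousLinearMap.star_eq_adjoint, h.der_star_der hu, ← hs_moment,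
    h.moment_self, hs_mul_left, star_star]
  conv_rhs => rw [← hw, hs_mul_right, starProjection_star]

/-- Since `u* v` takes values in `T`, `D_{u*} D_v y` is a multiple of `y`, to which `D_w y` is
orthogonal. Hence second derivatives `D_u D_w y` have no tangential part. -/
theorem IsUnitVolume.inner_der_der_der (h : IsUnitVolume T y) {u v w : Op N}
    (hu : T.starProjection * u = 0) (hu' : u * T.starProjection = u)
    (hw : T.starProjection * w = 0) :
    inner ℝ (der u (der w y)) (der v y) = (0 : ℝ) := by
  have h1 : T.starProjection * (star u * v) = star u * v := by
    rw [← mul_assoc]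
    congr 1
    rw [← star_inj, star_mul, star_star, starProjection_star, hu']
  rw [inner_der, ← ContinuousLinearMap.star_eq_adjoint, h.der_star_der hu, ← h1, h.der_proj_mul,
    inner_smul_right, real_inner_comm, h.inner_der_self_of_proj_mul hw, mul_zero]

end UnitVolume

/-! ### The Grassmannian as a set of unit volume elements -/

section Grassmannian

/-- Alternating `m`-forms on an `m`-dimensional space are multiples of the determinant. -/
theorem wedge_eq_det_smul {m N : ℕ} {T : Submodule ℝ (EuclideanSpace ℝ (Fin N))}
    (e : Module.Basis (Fin m) ℝ T) (v : Fin m → T) :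
    (wedge fun i => (v i : EuclideanSpace ℝ (Fin N)))
      = e.det v • wedge fun i => (e i : EuclideanSpace ℝ (Fin N)) := by
  ext I
  let g : T [⋀^Fin m]→ₗ[ℝ] ℝ :=
    ((EuclideanSpace.proj I : MultiVector m N →L[ℝ] ℝ).toLinearMap.compAlternatingMap
      (wedgeAlt m N)).compLinearMap T.subtype
  have h := congrArg (fun g => g v) (AlternatingMap.eq_smul_basis_det e g)
  refine Eq.trans h ?_
  change g e * e.det v = e.det v * g e
  ring

variable {m n N : ℕ}

/-- The sign in the definition of `toMultiVector` is that of the determinant of the change of basis,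
so the remaining factor is its absolute value. -/
theorem exists_wedge_eq_smul_toMultiVector (P : OrientedGrassmannian m n)
    (v : Module.Basis (Fin m) ℝ P.plane) (hv : v.orientation = P.orientation) :
    ∃ c : ℝ, 0 < c ∧ (wedge fun i => (v i : EuclideanSpace ℝ (Fin (m + n))))
      = c • P.toMultiVector := by
  set b : OrthonormalBasis (Fin m) ℝ P.plane :=
    (stdOrthonormalBasis ℝ P.plane).reindex (finCongr P.finrank_plane) with hb
  have hw := wedge_eq_det_smul b.toBasis v
  have hne : b.toBasis.det v ≠ 0 := (b.toBasis.isUnit_det v).ne_zero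
  have hiff := b.toBasis.orientation_eq_iff_det_pos v
  rw [hv] at hiff
  by_cases h : b.toBasis.orientation = P.orientation
  · refine ⟨b.toBasis.det v, hiff.1 h, ?_⟩
    rw [hw]
    simp only [OrientedGrassmannian.toMultiVector]
    rw [← hb, if_pos h]
    simp
  · refine ⟨-b.toBasis.det v, ?_, ?_⟩
    · rcases lt_trichotomy (b.toBasis.det v) 0 with h1 | h1 | h1
      · linarith
      · exact absurd h1 hne
      · exact absurd (hiff.2 h1) h
    · rw [hw]
      simp only [OrientedGrassmannian.toMultiVector]
      rw [← hb, if_neg h]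
      simp

theorem isUnitVolume_toMultiVector (P : OrientedGrassmannian m n) :
    IsUnitVolume P.plane P.toMultiVector := by
  refine ⟨(stdOrthonormalBasis ℝ P.plane).reindex (finCongr P.finrank_plane), ?_⟩
  simp only [OrientedGrassmannian.toMultiVector]
  split_ifs
  · exact ⟨1, by norm_num, by simp⟩
  · exact ⟨-1, by norm_num, by simp⟩

theorem toMultiVector_neg (T : Submodule ℝ (EuclideanSpace ℝ (Fin (m + n))))
    (hT : Module.finrank ℝ T = m) (o : Orientation ℝ T (Fin m)) :
    (⟨T, hT, -o⟩ : OrientedGrassmannian m n).toMultiVector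
      = -(⟨T, hT, o⟩ : OrientedGrassmannian m n).toMultiVector := by
  simp only [OrientedGrassmannian.toMultiVector]
  set b : OrthonormalBasis (Fin m) ℝ T := (stdOrthonormalBasis ℝ T).reindex (finCongr hT)
  rcases b.toBasis.orientation_eq_or_eq_neg o with h | h
  · subst h
    rw [if_neg (Module.Ray.ne_neg_self _), if_pos rfl]
  · subst h
    rw [show - -b.toBasis.orientation = b.toBasis.orientation from
        @neg_neg (Module.Ray ℝ (T [⋀^Fin m]→ₗ[ℝ] ℝ)) _ _, if_pos rfl,
      if_neg (Module.Ray.ne_neg_self _), neg_neg]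

/-- The two signs of a volume element are the two orientations of the plane; from here on
orientations can be forgotten. -/
theorem mem_grassmannian_iff {y : MultiVector m (m + n)} :
    y ∈ grassmannian m n ↔ ∃ T, IsUnitVolume T y := by
  constructor
  · rintro ⟨P, rfl⟩
    exact ⟨_, isUnitVolume_toMultiVector P⟩
  · rintro ⟨T, b, r, hr, rfl⟩
    have hT : Module.finrank ℝ T = m := by
      rw [Module.finrank_eq_card_basis b.toBasis, Fintype.card_fin]
    let P : OrientedGrassmannian m n := ⟨T, hT, b.toBasis.orientation⟩
    obtain ⟨c, hc, hcw⟩ := exists_wedge_eq_smul_toMultiVector P b.toBasis rfl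
    have h1 : IsUnitVolume T (wedge fun i => (b.toBasis i : EuclideanSpace ℝ (Fin (m + n)))) :=
      ⟨b, 1, by norm_num, by simp⟩
    have h2 := h1.inner_self
    rw [hcw, inner_smul_left, inner_smul_right, (isUnitVolume_toMultiVector P).inner_self] at h2
    have hc1 : c = 1 := by
      simp only [RCLike.conj_to_real, mul_one] at h2
      nlinarith
    rw [hc1, one_smul] at hcw
    simp only [OrthonormalBasis.coe_toBasis] at hcw
    rw [hcw]
    rcases mul_self_eq_one_iff.1 hr with rfl | rfl
    · exact ⟨P, by simp⟩
    · exact ⟨⟨T, hT, -b.toBasis.orientation⟩, by rw [toMultiVector_neg]; simp [P]⟩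

theorem isUnitVolume_of_orthonormal {v : Fin m → EuclideanSpace ℝ (Fin N)} (hv : Orthonormal ℝ v)
    {r : ℝ} (hr : r * r = 1) :
    IsUnitVolume (Submodule.span ℝ (Set.range v)) (r • wedge v) := by
  let e := Module.Basis.span hv.linearIndependent
  have he : ∀ i, (e i : EuclideanSpace ℝ (Fin N)) = v i := fun i => by
    simp [e, Module.Basis.span_apply]
  have ho : Orthonormal ℝ e := by
    rw [orthonormal_iff_ite] at hv ⊢
    intro i j
    rw [← hv i j, Submodule.coe_inner, he, he]
  refine ⟨e.toOrthonormalBasis ho, r, hr, ?_⟩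
  simp [he]

end Grassmannian

/-! ### Tangent spaces of the Grassmannian -/

section TangentSpace

variable {m n N : ℕ} {T : Submodule ℝ (EuclideanSpace ℝ (Fin N))}

/-- Rotating one basis vector towards a unit normal vector keeps the basis orthonormal, and the
resulting curve in the Grassmannian has the required velocity. -/
theorem rankOne_mem_tangentSpaceOf {T : Submodule ℝ (EuclideanSpace ℝ (Fin (m + n)))}
    (b : OrthonormalBasis (Fin m) ℝ T) {r : ℝ} (hr : r * r = 1) (i : Fin m)
    {ν : EuclideanSpace ℝ (Fin (m + n))} (hν : ν ∈ Tᗮ) :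
    r • wedge (Function.update (fun i => (b i : EuclideanSpace ℝ (Fin (m + n)))) i ν) ∈
      tangentSpaceOf (grassmannian m n)
        (r • wedge fun i => (b i : EuclideanSpace ℝ (Fin (m + n)))) := by
  set e : Fin m → EuclideanSpace ℝ (Fin (m + n)) := fun i => b i with he
  have heo : Orthonormal ℝ e := by
    have := b.orthonormal
    rw [orthonormal_iff_ite] at this ⊢
    exact fun i j => this i j
  by_cases h0 : ν = 0
  · rw [h0, ← wedgeAlt_apply (Function.update e i 0), AlternatingMap.map_update_zero, smul_zero]
    exact Submodule.zero_mem _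
  have hn : ‖ν‖ ≠ 0 := norm_ne_zero_iff.2 h0
  set ν' := ‖ν‖⁻¹ • ν with hν'
  have hν1 : inner ℝ ν' ν' = (1 : ℝ) := by
    rw [hν', inner_smul_left, inner_smul_right, real_inner_self_eq_norm_sq]
    simp; field_simp
  have hνe : ∀ j, inner ℝ (e j) ν' = (0 : ℝ) := fun j => by
    rw [hν', inner_smul_right, (Submodule.mem_orthogonal T ν).1 hν _ (b j).2, mul_zero]
  have hνν : ν = ‖ν‖ • ν' := by rw [hν', smul_smul, mul_inv_cancel₀ hn, one_smul]
  have hsm : r • wedge (Function.update e i ν) = ‖ν‖ • (r • wedge (Function.update e i ν')) := by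
    conv_lhs => rw [hνν]
    rw [← wedgeAlt_apply, AlternatingMap.map_update_smul, smul_comm, wedgeAlt_apply]
  rw [hsm]
  refine Submodule.smul_mem _ _ (Submodule.subset_span ?_)
  -- By linearity in the rotated factor the curve is a great circle, so its smoothness and velocity
  -- are immediate.
  have hc : ∀ t : ℝ, r • wedge (Function.update e i (Real.cos t • e i + Real.sin t • ν'))
      = Real.cos t • (r • wedge e) + Real.sin t • (r • wedge (Function.update e i ν')) := by
    intro t
    simp only [← wedgeAlt_apply]
    rw [AlternatingMap.map_update_add, AlternatingMap.map_update_smul,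
      AlternatingMap.map_update_smul, Function.update_eq_self, smul_add, smul_comm r, smul_comm r]
  refine ⟨fun t => r • wedge (Function.update e i (Real.cos t • e i + Real.sin t • ν')),
    ?_, ?_, ?_, ?_⟩
  · simp_rw [hc]
    exact (Real.contDiff_cos.smul contDiff_const).add (Real.contDiff_sin.smul contDiff_const)
  · intro t
    refine mem_grassmannian_iff.2 ⟨_, isUnitVolume_of_orthonormal ?_ hr⟩
    rw [orthonormal_iff_ite] at heo ⊢
    have hei : inner ℝ (e i) (e i) = (1 : ℝ) := by simpa using heo i i
    intro j k
    have hcs := Real.cos_sq_add_sin_sq t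
    by_cases hj : j = i
    · by_cases hk : k = i
      · subst hj; subst hk
        simp only [Function.update_self, if_true, inner_add_left, inner_add_right,
          inner_smul_left, inner_smul_right, hν1, hνe, hei, real_inner_comm (e k) ν']
        simp; nlinarith
      · subst hj
        have hek : inner ℝ (e j) (e k) = (0 : ℝ) := by simpa [Ne.symm hk] using heo j k
        simp only [Function.update_self, Function.update_of_ne hk, inner_add_left,
          inner_smul_left, hek, real_inner_comm (e k) ν', hνe, if_neg (Ne.symm hk)]
        simp
    · by_cases hk : k = i
      · subst hk
        have hek : inner ℝ (e j) (e k) = (0 : ℝ) := by simpa [hj] using heo j k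
        simp only [Function.update_self, Function.update_of_ne hj, inner_add_right,
          inner_smul_right, hek, hνe, if_neg hj]
        simp
      · simp only [Function.update_of_ne hj, Function.update_of_ne hk]
        exact heo j k
  · simp
  · simp_rw [hc]
    have h1 := ((Real.hasDerivAt_cos 0).smul_const (r • wedge e)).add
      ((Real.hasDerivAt_sin 0).smul_const (r • wedge (Function.update e i ν')))
    simpa using! h1.deriv

theorem contDiff_wedge {W : Type*} [NormedAddCommGroup W] [NormedSpace ℝ W] {k : WithTop ℕ∞}
    {v : Fin m → W → EuclideanSpace ℝ (Fin N)} (hv : ∀ i, ContDiff ℝ k (v i)) :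
    ContDiff ℝ k fun z => wedge fun i => v i z := by
  rw [contDiff_euclidean]
  intro I
  simp only [wedge_apply, Matrix.det_apply, Matrix.of_apply]
  refine ContDiff.sum fun σ _ => ContDiff.const_smul _ (contDiff_prod fun i _ => ?_)
  exact (contDiff_euclidean.1 (hv (σ i))) (I i)

/-- `wedge` as a continuous multilinear map. -/
def wedgeCMM (m N : ℕ) :
    ContinuousMultilinearMap ℝ (fun _ : Fin m => EuclideanSpace ℝ (Fin N)) (MultiVector m N) where
  toMultilinearMap := (wedgeAlt m N).toMultilinearMap
  cont := (contDiff_wedge (k := 0) fun i => contDiff_apply ℝ (EuclideanSpace ℝ (Fin N)) i).continuous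

theorem hasFDerivAt_wedge {W : Type*} [NormedAddCommGroup W] [NormedSpace ℝ W]
    {v : Fin m → W → EuclideanSpace ℝ (Fin N)} {v' : Fin m → W →L[ℝ] EuclideanSpace ℝ (Fin N)}
    {z : W} (hv : ∀ i, HasFDerivAt (v i) (v' i) z) :
    ∃ L : W →L[ℝ] MultiVector m N, HasFDerivAt (fun z => wedge fun i => v i z) L z ∧
      ∀ u, L u = ∑ i, wedge (Function.update (fun i => v i z) i (v' i u)) := by
  have h := ((wedgeCMM m N).hasFDerivAt (fun i => v i z)).comp z (hasFDerivAt_pi.2 hv)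
  refine ⟨_, h, fun u => ?_⟩
  simp only [ContinuousLinearMap.comp_apply, ContinuousMultilinearMap.linearDeriv_apply]
  rfl

theorem IsUnitVolume.der_mem_tangentSpaceOf {T : Submodule ℝ (EuclideanSpace ℝ (Fin (m + n)))}
    {y : MultiVector m (m + n)} (h : IsUnitVolume T y) (w : Op (m + n)) :
    der ((1 - T.starProjection) * w * T.starProjection) y
      ∈ tangentSpaceOf (grassmannian m n) y := by
  obtain ⟨b, r, hr, rfl⟩ := h
  rw [map_smul, der_wedge, Finset.smul_sum]
  refine Submodule.sum_mem _ fun i _ => rankOne_mem_tangentSpaceOf b hr i ?_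
  change (1 - T.starProjection) (w (T.starProjection (b i))) ∈ Tᗮ
  exact Submodule.sub_starProjection_mem_orthogonal _

theorem fderiv_moment_self (y U : MultiVector m N) :
    fderiv ℝ (fun z : MultiVector m N => moment z z) y U = moment U y + moment y U := by
  let B := LinearMap.toContinuousBilinearMap (momentBilin m N)
  have hB := B.hasFDerivAt_of_bilinear (hasFDerivAt_id y) (hasFDerivAt_id y)
  have h : fderiv ℝ (fun z : MultiVector m N => moment z z) y = _ := hB.fderiv
  rw [h, add_comm]
  rfl

/-- A smooth system of equations that hold on the Grassmannian and define its tangent space at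
`y`. -/
theorem IsUnitVolume.exists_equations {T : Submodule ℝ (EuclideanSpace ℝ (Fin (m + n)))}
    {y : MultiVector m (m + n)} (h : IsUnitVolume T y) :
    ∃ G : MultiVector m (m + n) → MultiVector m (m + n) × ℝ, Differentiable ℝ G ∧
      (∀ z ∈ grassmannian m n, G z = 0) ∧
      ∀ U, fderiv ℝ G y U = 0 →
        U = der ((1 - T.starProjection) * (moment U y + moment y U) * T.starProjection) y := by
  have hy := h
  obtain ⟨b, r, hr, hyb⟩ := h
  set e : Fin m → EuclideanSpace ℝ (Fin (m + n)) := fun i => b i with he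
  -- On the Grassmannian `moment z z` projects onto the plane of `z`, so `F z` is a multiple of `z`.
  -- The equations say that `F z` is parallel to `z` and that `z` has length 1.
  let F : MultiVector m (m + n) → MultiVector m (m + n) := fun z => wedge fun i => moment z z (e i)
  have hmom : ContDiff ℝ ∞ fun z : MultiVector m (m + n) => moment z z :=
    contDiff_moment contDiff_id contDiff_id
  have hF : ContDiff ℝ ∞ F := contDiff_wedge fun i => hmom.clm_apply contDiff_const
  have hG : ContDiff ℝ ∞ fun z => (F z - (inner ℝ (F z) z : ℝ) • z, (inner ℝ z z : ℝ) - 1) :=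
    (hF.sub ((hF.inner ℝ contDiff_id).smul contDiff_id)).prodMk
      ((contDiff_id.inner ℝ contDiff_id).sub contDiff_const)
  refine ⟨_, hG.differentiable (by simp), ?_, ?_⟩
  · intro z hz
    obtain ⟨T', hz⟩ := mem_grassmannian_iff.1 hz
    have hz' := hz
    obtain ⟨b', r', hr', hzb⟩ := hz
    have hFz : ∃ c : ℝ, F z = c • z := by
      refine ⟨b'.toBasis.det (fun i => ⟨T'.starProjection (e i),
        T'.starProjection_apply_mem _⟩) * r', ?_⟩
      have := wedge_eq_det_smul b'.toBasis (fun i => ⟨T'.starProjection (e i),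
        T'.starProjection_apply_mem _⟩)
      simp only [F, hz'.moment_self]
      refine this.trans ?_
      rw [hzb, smul_smul, mul_assoc, hr', mul_one]
      simp
    obtain ⟨c, hc⟩ := hFz
    simp [hc, inner_smul_left, hz'.inner_self, -inner_self_eq_norm_sq_to_K]
  · intro U hU
    set P' := moment U y + moment y U with hP'
    have hmd : HasFDerivAt (fun z : MultiVector m (m + n) => moment z z)
        (fderiv ℝ (fun z : MultiVector m (m + n) => moment z z) y) y :=
      (hmom.differentiable (by simp) y).hasFDerivAt
    have hmU : fderiv ℝ (fun z : MultiVector m (m + n) => moment z z) y U = P' :=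
      fderiv_moment_self y U
    obtain ⟨L, hL, hLU⟩ := hasFDerivAt_wedge (v := fun i z => moment z z (e i))
      (fun i => hmd.clm_apply (hasFDerivAt_const (e i) y))
    have hPe : ∀ i, moment y y (e i) = e i := fun i => by
      rw [hy.moment_self, Submodule.starProjection_eq_self_iff]; exact (b i).2
    have hFy : F y = wedge e := by simp only [F, hPe]
    have hye : wedge e = r • y := by rw [hyb, smul_smul, hr, one_smul]
    have hLU' : L U = r • der P' y := by
      rw [hLU, ← map_smul, ← hye, der_wedge]
      refine Finset.sum_congr rfl fun i _ => ?_
      simp [hPe, hmU]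
    have hinner := (hL.inner ℝ (hasFDerivAt_id y))
    have hGd := (hL.sub (hinner.smul (hasFDerivAt_id y))).prodMk
      (((hasFDerivAt_id y).inner ℝ (hasFDerivAt_id y)).sub_const 1)
    have h0 : fderiv ℝ (fun z => (F z - (inner ℝ (F z) z : ℝ) • z, (inner ℝ z z : ℝ) - 1)) y = _ :=
      hGd.fderiv
    rw [h0] at hU
    have hU1 := congrArg Prod.fst hU
    have hU2 := congrArg Prod.snd hU
    have hin : inner ℝ (wedge fun i => moment y y (e i)) y = r := by
      simp only [hPe, hye, inner_smul_left, hy.inner_self]; simp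
    simp only [ContinuousLinearMap.prod_apply, sub_apply, add_apply, hLU', id_eq, hin,
      Prod.fst_zero, ContinuousLinearMap.smulRight_apply, smul_apply,
      ContinuousLinearMap.id_apply] at hU1
    have hyU : inner ℝ y U = (0 : ℝ) := by
      simp [fderivInnerCLM_apply, real_inner_comm] at hU2
      linarith
    -- The linearised first equation determines `U` up to a multiple of `y`; the linearised second
    -- one, `hyU`, shows that this multiple removes exactly the `y`-component of `der P' y`.
    obtain ⟨l, hl⟩ : ∃ l : ℝ, r • der P' y - (r • U + l • y) = 0 := ⟨_, by simpa using! hU1⟩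
    have h1 : U = der P' y - (r * l) • y := by
      have h2 : r • der P' y = r • U + l • y := by
        rw [← sub_eq_zero]; exact hl
      have h3 := congrArg (fun z => r • z) h2
      simp only [smul_add, smul_smul, hr, one_smul] at h3
      rw [h3]; abel
    have h4 := hy.der_eq P'
    have h5 : inner ℝ y U = hs T.starProjection P' - r * l := by
      conv_lhs => rw [h1, h4]
      rw [inner_sub_right, inner_add_right, inner_smul_right, inner_smul_right, hy.inner_self,
        hy.inner_der_self_of_proj_mul]
      · ring
      · rw [← mul_assoc, ← mul_assoc, mul_sub, starProjection_mul_self]; simp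
    have h6 : hs T.starProjection P' = r * l := by linarith
    rw [h4, h6] at h1
    rw [← sub_eq_zero] at h1 ⊢
    rw [← h1]; abel

end TangentSpace

/-! ### The Levi-Civita connection and the curvature of a set with smooth tangential projections -/

section Target

variable {V : Type*} [NormedAddCommGroup V] [InnerProductSpace ℝ V] {S : Set V} {x : V}

theorem fderiv_eq_zero_of_mem_tangentSpaceOf {W : Type*} [NormedAddCommGroup W] [NormedSpace ℝ W]
    {G : V → W} (hG : DifferentiableAt ℝ G x) (h0 : ∀ z ∈ S, G z = 0) {u : V}
    (hu : u ∈ tangentSpaceOf S x) : fderiv ℝ G x u = 0 := by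
  have : tangentSpaceOf S x ≤ LinearMap.ker (fderiv ℝ G x).toLinearMap := by
    refine Submodule.span_le.2 ?_
    rintro _ ⟨c, hc, hcS, rfl, rfl⟩
    have h1 : HasDerivAt (G ∘ c) (fderiv ℝ G (c 0) (deriv c 0)) 0 :=
      hG.hasFDerivAt.comp_hasDerivAt 0 (hc.differentiable (by simp) 0).hasDerivAt
    have h2 : G ∘ c = fun _ => 0 := funext fun t => h0 _ (hcS t)
    rw [h2] at h1
    exact h1.unique (hasDerivAt_const _ _)
  exact this hu

/-- Derivatives within `S` need not be unique, so `fderivWithin` involves a choice; on velocities of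
curves in `S` the chain rule forces its value. -/
theorem fderivWithin_eq_of_mem_tangentSpaceOf {W : Type*} [NormedAddCommGroup W]
    [NormedSpace ℝ W] {F G : V → W} (hG : DifferentiableAt ℝ G x) (hFG : Set.EqOn F G S)
    (hx : x ∈ S) {u : V} (hu : u ∈ tangentSpaceOf S x) :
    fderivWithin ℝ F S x u = fderiv ℝ G x u := by
  have hF : HasFDerivWithinAt F (fderivWithin ℝ F S x) S x :=
    (hG.differentiableWithinAt.congr hFG (hFG hx)).hasFDerivWithinAt
  have : tangentSpaceOf S x
      ≤ LinearMap.eqLocus (fderivWithin ℝ F S x).toLinearMap (fderiv ℝ G x).toLinearMap := by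
    refine Submodule.span_le.2 ?_
    rintro _ ⟨c, hc, hcS, rfl, rfl⟩
    have hc' := (hc.differentiable (by simp) 0).hasDerivAt
    have h1 : HasDerivAt (G ∘ c) (fderiv ℝ G (c 0) (deriv c 0)) 0 :=
      hG.hasFDerivAt.comp_hasDerivAt 0 hc'
    have h2 : HasDerivAt (F ∘ c) (fderivWithin ℝ F S (c 0) (deriv c 0)) 0 :=
      hF.comp_hasDerivAt 0 hc' (Filter.Eventually.of_forall hcS)
    have h3 : F ∘ c = G ∘ c := funext fun t => hFG (hcS t)
    rw [h3] at h2
    exact h2.unique h1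
  exact this hu

variable [FiniteDimensional ℝ V] {G : V → V →L[ℝ] V}

theorem covDeriv_extendTo (hG : ContDiff ℝ ∞ G) (hS : ∀ y ∈ S, projTo S y = G y) (hx : x ∈ S)
    {u : V} (hu : u ∈ tangentSpaceOf S x) (w : V) :
    covDeriv S x u (extendTo S w) = G x (fderiv ℝ G x u w) := by
  have h1 : DifferentiableAt ℝ (fun y => G y w) x :=
    (hG.differentiable (by simp) x).clm_apply (differentiableAt_const w)
  have h2 : Set.EqOn (extendTo S w) (fun y => G y w) S := fun y hy => by
    simp only [extendTo, hS y hy]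
  rw [covDeriv, fderivWithin_eq_of_mem_tangentSpaceOf h1 h2 hx hu, hS x hx,
    fderiv_clm_apply (hG.differentiable (by simp) x) (differentiableAt_const w)]
  simp

theorem projTo_mem (S : Set V) (y w : V) : projTo S y w ∈ tangentSpaceOf S y :=
  Submodule.starProjection_apply_mem _ _

theorem projTo_of_mem {S : Set V} {y w : V} (h : w ∈ tangentSpaceOf S y) : projTo S y w = w :=
  Submodule.starProjection_eq_self_iff.2 h

theorem covDeriv_covDeriv_extendTo (hG : ContDiff ℝ ∞ G) (hS : ∀ y ∈ S, projTo S y = G y)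
    (hx : x ∈ S) {u v : V} (hu : u ∈ tangentSpaceOf S x) (hv : v ∈ tangentSpaceOf S x) (w : V) :
    covDeriv S x u (fun y => covDeriv S y (extendTo S v y) (extendTo S w))
      = G x (fderiv ℝ G x u (fderiv ℝ G x v w)) + G x (fderiv ℝ (fderiv ℝ G) x u v w)
        + G x (fderiv ℝ G x (fderiv ℝ G x u v) w) := by
  have hG' : ContDiff ℝ ∞ (fderiv ℝ G) := hG.fderiv_right (by simp)
  have hGd := hG.differentiable (by simp) x
  have hGd' := hG'.differentiable (by simp) x
  have hc (c : V) := differentiableAt_const (𝕜 := ℝ) (x := x) c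
  have hGv : DifferentiableAt ℝ (fun y => G y v) x := hGd.clm_apply (hc v)
  have hGGv : DifferentiableAt ℝ (fun y => fderiv ℝ G y (G y v)) x := hGd'.clm_apply hGv
  have h1 : DifferentiableAt ℝ (fun y => G y (fderiv ℝ G y (G y v) w)) x :=
    hGd.clm_apply (hGGv.clm_apply (hc w))
  have h2 : Set.EqOn (fun y => covDeriv S y (extendTo S v y) (extendTo S w))
      (fun y => G y (fderiv ℝ G y (G y v) w)) S := fun y hy => by
    change covDeriv S y (extendTo S v y) (extendTo S w) = _
    rw [covDeriv_extendTo hG hS hy (u := extendTo S v y) (projTo_mem S y v), extendTo, hS y hy]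
  have hGv' : G x v = v := by rw [← hS x hx, projTo_of_mem hv]
  have hproj : ∀ z, G x (G x z) = G x z := fun z => by
    rw [← hS x hx, projTo_of_mem (projTo_mem _ _ _)]
  rw [covDeriv, fderivWithin_eq_of_mem_tangentSpaceOf h1 h2 hx hu, hS x hx,
    fderiv_clm_apply hGd (hGGv.clm_apply (hc w)), fderiv_clm_apply hGGv (hc w),
    fderiv_clm_apply hGd' hGv, fderiv_clm_apply hGd (hc v)]
  simp [hGv', hproj]
  abel

/-- Condition `huv` makes the extended fields commute at `x`. Symmetry of the second derivative of
`G` cancels the second-order terms, and the commutator of first derivatives of the projection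
remains. -/
theorem riemann_eq (hG : ContDiff ℝ ∞ G) (hS : ∀ y ∈ S, projTo S y = G y)
    (hx : x ∈ S) {u v : V} (hu : u ∈ tangentSpaceOf S x) (hv : v ∈ tangentSpaceOf S x)
    (huv : fderiv ℝ G x u v = fderiv ℝ G x v u) (w : V) :
    riemann S x u v w
      = G x (fderiv ℝ G x u (fderiv ℝ G x v w) - fderiv ℝ G x v (fderiv ℝ G x u w)) := by
  have hsymm : fderiv ℝ (fderiv ℝ G) x u v = fderiv ℝ (fderiv ℝ G) x v u :=
    (hG.contDiffAt.isSymmSndFDerivAt (by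
      rw [minSmoothness_of_isRCLikeNormedField]
      exact WithTop.coe_le_coe.2 (OrderTop.le_top (2 : ℕ∞)))).eq u v
  have hder : ∀ u v : V, u ∈ tangentSpaceOf S x →
      fderivWithin ℝ (extendTo S v) S x u = fderiv ℝ G x u v := fun u v hu => by
    have h1 : DifferentiableAt ℝ (fun y => G y v) x :=
      (hG.differentiable (by simp) x).clm_apply (differentiableAt_const v)
    have h2 : Set.EqOn (extendTo S v) (fun y => G y v) S := fun y hy => by
      simp only [extendTo, hS y hy]
    rw [fderivWithin_eq_of_mem_tangentSpaceOf h1 h2 hx hu,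
      fderiv_clm_apply (hG.differentiable (by simp) x) (differentiableAt_const v)]
    simp
  have hbr : VectorField.lieBracketWithin ℝ (extendTo S u) (extendTo S v) S x = 0 := by
    rw [VectorField.lieBracketWithin]
    have e1 : extendTo S u x = u := projTo_of_mem hu
    have e2 : extendTo S v x = v := projTo_of_mem hv
    rw [e1, e2, hder u v hu, hder v u hv, huv, sub_self]
  have hzero : covDeriv S x 0 (extendTo S w) = 0 := by simp [covDeriv]
  rw [riemann, hbr, hzero, covDeriv_covDeriv_extendTo hG hS hx hu hv,
    covDeriv_covDeriv_extendTo hG hS hx hv hu, hsymm, huv, map_sub]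
  abel

end Target

/-! ### The curvature of the Grassmannian -/

section Curvature

variable {m n N : ℕ} {T : Submodule ℝ (EuclideanSpace ℝ (Fin N))}

/-- Explicit curves give one inclusion, the linearised equations the other. -/
theorem mem_tangentSpaceOf_grassmannian {T : Submodule ℝ (EuclideanSpace ℝ (Fin (m + n)))}
    {y : MultiVector m (m + n)} (h : IsUnitVolume T y) {U : MultiVector m (m + n)} :
    U ∈ tangentSpaceOf (grassmannian m n) y
      ↔ ∃ w : Op (m + n), der ((1 - T.starProjection) * w * T.starProjection) y = U := by
  constructor
  · intro hU
    obtain ⟨G, hG, hG0, hGU⟩ := h.exists_equations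
    exact ⟨_, (hGU U (fderiv_eq_zero_of_mem_tangentSpaceOf (hG y) hG0 hU)).symm⟩
  · rintro ⟨w, rfl⟩
    exact h.der_mem_tangentSpaceOf w

theorem star_one_sub_proj (T : Submodule ℝ (EuclideanSpace ℝ (Fin N))) :
    star (1 - T.starProjection) = 1 - T.starProjection :=
  (star_sub (1 : Op N) T.starProjection).trans (by rw [star_one, starProjection_star])

theorem proj_mul_one_sub (T : Submodule ℝ (EuclideanSpace ℝ (Fin N))) :
    T.starProjection * (1 - T.starProjection) = 0 := by
  rw [mul_sub, mul_one, starProjection_mul_self, sub_self]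

theorem one_sub_mul_proj (T : Submodule ℝ (EuclideanSpace ℝ (Fin N))) :
    (1 - T.starProjection) * T.starProjection = 0 := by
  rw [sub_mul, one_mul, starProjection_mul_self, sub_self]

theorem one_sub_proj_mul_self (T : Submodule ℝ (EuclideanSpace ℝ (Fin N))) :
    (1 - T.starProjection) * (1 - T.starProjection) = 1 - T.starProjection := by
  rw [mul_sub, one_sub_mul_proj, mul_one, sub_zero]

theorem hs_hom (A C : Op N) : hs ((1 - T.starProjection) * A * T.starProjection) C
    = hs A ((1 - T.starProjection) * C * T.starProjection) := by
  rw [hs_mul_right, hs_mul_left, starProjection_star, star_one_sub_proj, mul_assoc]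

theorem contDiff_clm_mul {E W : Type*} [NormedAddCommGroup E] [NormedSpace ℝ E]
    [NormedAddCommGroup W] [NormedSpace ℝ W] {A B : W → E →L[ℝ] E}
    (hA : ContDiff ℝ ∞ A) (hB : ContDiff ℝ ∞ B) : ContDiff ℝ ∞ fun z => A z * B z :=
  hA.clm_comp hB

theorem fderiv_clm_mul {E W : Type*} [NormedAddCommGroup E] [NormedSpace ℝ E]
    [NormedAddCommGroup W] [NormedSpace ℝ W] {A B : W → E →L[ℝ] E} {z : W}
    (hA : DifferentiableAt ℝ A z) (hB : DifferentiableAt ℝ B z) (u : W) :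
    fderiv ℝ (fun z => A z * B z) z u = fderiv ℝ A z u * B z + A z * fderiv ℝ B z u := by
  have h : fderiv ℝ (fun z => A z * B z) z = _ := (hA.hasFDerivAt.clm_comp hB.hasFDerivAt).fderiv
  rw [h, add_comm]
  rfl

/-- The orthogonal projection onto the tangent space of the Grassmannian at `y`, extended to a
polynomial function of `y ∈ Λ^m ℝ^N`. -/
def tangentMap (y : MultiVector m N) : MultiVector m N →L[ℝ] MultiVector m N :=
  LinearMap.toContinuousLinearMap
    { toFun := fun ζ => der ((1 - moment y y) * moment ζ y) y
      map_add' := fun ζ ζ' => by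
        rw [moment_add_left, mul_add, map_add, add_apply]
      map_smul' := fun r ζ => by
        have : moment (r • ζ) y = r • moment ζ y := by
          have := (momentBilin m N).map_smul r ζ
          exact congrArg (fun g => g y) this
        have h2 : (1 - moment y y) * (r • moment ζ y) = r • ((1 - moment y y) * moment ζ y) := by
          ext; simp
        rw [this, h2, map_smul, smul_apply]
        rfl }

theorem tangentMap_apply (y ζ : MultiVector m N) :
    tangentMap y ζ = der ((1 - moment y y) * moment ζ y) y := rfl

theorem contDiff_tangentMap : ContDiff ℝ ∞ (tangentMap : MultiVector m N → _) := by
  refine contDiff_clm_apply_iff.2 fun ζ => ?_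
  simp only [tangentMap_apply]
  have h1 : ContDiff ℝ ∞ fun y : MultiVector m N => 1 - moment y y :=
    contDiff_const.sub (contDiff_moment contDiff_id contDiff_id)
  exact contDiff_der (contDiff_clm_mul h1 (contDiff_moment contDiff_const contDiff_id)) contDiff_id

theorem IsUnitVolume.tangentMap_apply {y : MultiVector m N} (h : IsUnitVolume T y)
    (ζ : MultiVector m N) :
    tangentMap y ζ = der ((1 - T.starProjection) * moment ζ y * T.starProjection) y := by
  rw [GaussMap.tangentMap_apply, h.der_eq, h.moment_self]
  have h1 : hs T.starProjection ((1 - T.starProjection) * moment ζ y) = 0 := by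
    rw [hs_mul_left, star_one_sub_proj, one_sub_mul_proj]
    simp [hs]
  have h2 : (1 - T.starProjection) * ((1 - T.starProjection) * moment ζ y)
      = (1 - T.starProjection) * moment ζ y := by
    rw [← mul_assoc, one_sub_proj_mul_self]
  rw [h1, h2, zero_smul, zero_add]

theorem proj_mul_hom (T : Submodule ℝ (EuclideanSpace ℝ (Fin N))) (w : Op N) :
    T.starProjection * ((1 - T.starProjection) * w * T.starProjection) = 0 := by
  rw [← mul_assoc, ← mul_assoc, proj_mul_one_sub]; simp

theorem hom_mul_proj (T : Submodule ℝ (EuclideanSpace ℝ (Fin N))) (w : Op N) :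
    (1 - T.starProjection) * w * T.starProjection * T.starProjection
      = (1 - T.starProjection) * w * T.starProjection := by
  rw [mul_assoc, starProjection_mul_self]

theorem hom_eq_self {u : Op N} (hu : T.starProjection * u = 0) (hu' : u * T.starProjection = u) :
    (1 - T.starProjection) * u * T.starProjection = u := by
  rw [sub_mul, hu, sub_zero, one_mul, hu']

/-- For tangent vectors `D_w y`, `⟨ζ, D_w y⟩` is the pairing of `moment ζ y` with `w`; as `w ↦ D_w
y` is isometric on `Hom(T, T^⊥)`, the projection of `ζ` is given by the corresponding block of
`moment ζ y`. -/
theorem IsUnitVolume.projTo_eq {T : Submodule ℝ (EuclideanSpace ℝ (Fin (m + n)))}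
    {y : MultiVector m (m + n)} (h : IsUnitVolume T y) :
    projTo (grassmannian m n) y = tangentMap y := by
  ext ζ : 1
  refine Submodule.eq_starProjection_of_mem_of_inner_eq_zero ?_ ?_
  · rw [h.tangentMap_apply]
    exact h.der_mem_tangentSpaceOf _
  · intro U hU
    obtain ⟨w, rfl⟩ := (mem_tangentSpaceOf_grassmannian h).1 hU
    rw [inner_sub_left, h.tangentMap_apply,
      h.inner_der_der (proj_mul_hom T _) (hom_mul_proj T _), ← hs_moment, hs_hom, ← mul_assoc,
      ← mul_assoc, one_sub_proj_mul_self, hom_mul_proj, sub_self]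

theorem IsUnitVolume.tangentMap_der {y : MultiVector m N} (h : IsUnitVolume T y) {u : Op N}
    (hu : T.starProjection * u = 0) (hu' : u * T.starProjection = u) :
    tangentMap y (der u y) = der u y := by
  have : moment (der u y) y * T.starProjection = u := by
    refine ext_hs fun A => ?_
    have h1 := hs_mul_right (moment (der u y) y) A T.starProjection
    rw [starProjection_star] at h1
    rw [← h1, hs_moment, h.inner_der_der hu (by rw [mul_assoc, starProjection_mul_self]),
      hs_mul_right, starProjection_star, hu']
  rw [h.tangentMap_apply, mul_assoc, this, sub_mul, hu]
  simp

theorem IsUnitVolume.tangentMap_self {y : MultiVector m N} (h : IsUnitVolume T y) :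
    tangentMap y y = 0 := by
  rw [GaussMap.tangentMap_apply, h.moment_self, sub_mul, starProjection_mul_self]
  simp

theorem IsUnitVolume.tangentMap_der_der {y : MultiVector m N} (h : IsUnitVolume T y) {u w : Op N}
    (hu : T.starProjection * u = 0) (hu' : u * T.starProjection = u)
    (hw : T.starProjection * w = 0) :
    tangentMap y (der u (der w y)) = 0 := by
  have : (1 - T.starProjection) * moment (der u (der w y)) y * T.starProjection = 0 := by
    refine ext_hs fun A => ?_
    rw [hs_hom, hs_moment, h.inner_der_der_der hu hu' hw]
    simp [hs]
  rw [h.tangentMap_apply, this]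
  simp

theorem fderiv_der {W : Type*} [NormedAddCommGroup W] [NormedSpace ℝ W] {A : W → Op N}
    {b : W → MultiVector m N} {z : W} (hA : DifferentiableAt ℝ A z) (hb : DifferentiableAt ℝ b z)
    (u : W) : fderiv ℝ (fun z => der (A z) (b z)) z u
      = der (fderiv ℝ A z u) (b z) + der (A z) (fderiv ℝ b z u) := by
  let D : Op N →L[ℝ] (MultiVector m N →L[ℝ] MultiVector m N) :=
    LinearMap.toContinuousLinearMap (der (m := m) (N := N))
  have h : fderiv ℝ (fun z => der (A z) (b z)) z = _ :=
    ((D.hasFDerivAt.comp z hA.hasFDerivAt).clm_apply hb.hasFDerivAt).fderiv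
  rw [h, add_comm]
  rfl

theorem fderiv_moment_right (ζ y U : MultiVector m N) :
    fderiv ℝ (fun z : MultiVector m N => moment ζ z) y U = moment ζ U := by
  have h : fderiv ℝ (fun z : MultiVector m N => moment ζ z) y = _ :=
    (LinearMap.toContinuousLinearMap (momentBilin m N ζ)).hasFDerivAt.fderiv
  rw [h]
  rfl

/-- Used with `M = moment y y`, `ν = moment ζ y`, `μ' = moment (der A ζ) y`: the left side is the
derivative of `(1 - M) ν` along `der A y`. -/
theorem skew_commutator_identity {R : Type*} [Ring R] (A M ν μ' : R) :
    (0 - (A * M - M * A)) * ν + (1 - M) * (A * ν - ν * A - μ')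
      = A * ((1 - M) * ν) - (1 - M) * ν * A - (1 - M) * μ' := by
  noncomm_ring

/-- The infinitesimal form of the equivariance of `tangentMap` under rotations, which it inherits
from `moment`. -/
theorem fderiv_tangentMap_skew {A : Op N} (hA : star A = -A) (y ζ : MultiVector m N) :
    fderiv ℝ tangentMap y (der A y) ζ = der A (tangentMap y ζ) - tangentMap y (der A ζ) := by
  have h0 : fderiv ℝ (fun z => tangentMap z ζ) y (der A y) = fderiv ℝ tangentMap y (der A y) ζ := by
    rw [fderiv_clm_apply (contDiff_tangentMap.differentiable (by simp) y)
      (differentiableAt_const ζ)]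
    simp
  have hM : ContDiff ℝ ∞ fun z : MultiVector m N => moment z z :=
    contDiff_moment contDiff_id contDiff_id
  have hν : ContDiff ℝ ∞ fun z : MultiVector m N => moment ζ z :=
    contDiff_moment contDiff_const contDiff_id
  have h1M : ContDiff ℝ ∞ fun z : MultiVector m N => 1 - moment z z := contDiff_const.sub hM
  have dd : ∀ {W : Type} [NormedAddCommGroup W] [NormedSpace ℝ W] {g : MultiVector m N → W},
    ContDiff ℝ ∞ g → DifferentiableAt ℝ g y := fun hg => hg.differentiable (by simp) y
  rw [← h0]
  simp only [tangentMap_apply]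
  rw [fderiv_der (dd (contDiff_clm_mul h1M hν)) differentiableAt_fun_id,
    fderiv_clm_mul (dd h1M) (dd hν), fderiv_moment_right, fderiv_fun_sub (differentiableAt_const _)
    (dd hM), sub_apply, fderiv_moment_self, moment_skew hA,
    eq_sub_of_add_eq' (moment_skew hA ζ y)]
  simp only [fderiv_fun_const, Pi.zero_apply, zero_apply, fderiv_fun_id, ContinuousLinearMap.id_apply]
  rw [skew_commutator_identity, map_sub, sub_apply, ← der_comm]
  abel

theorem skew_commutator_mul_left {R : Type*} [Ring R] {P u v u' v' : R}
    (hu : P * u = 0) (hu' : u * P = u) (hv : P * v = 0) (hv' : v * P = v)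
    (hu2 : u' * P = 0) (hv2 : v' * P = 0) :
    ((u - u') * (v - v') - (v - v') * (u - u')) * P = v' * u - u' * v := by
  have e1 : u * v = 0 := by rw [← hu', mul_assoc, hv, mul_zero]
  have e2 : v * u = 0 := by rw [← hv', mul_assoc, hu, mul_zero]
  have e3 : (u - u') * (v - v') - (v - v') * (u - u')
      = u * v - v * u + (v' * u - u' * v) - u * v' + v * u' + u' * v' - v' * u' := by noncomm_ring
  rw [e3, e1, e2]
  simp only [sub_mul, add_mul, mul_assoc, hu', hv', hu2, hv2, zero_mul, mul_zero]
  abel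

/-- Block multiplication: `u, v, w` map the range of `P` to its complement and `u', v'` map back, so
products of two blocks of the same kind vanish. -/
theorem skew_commutator_hom {R : Type*} [Ring R] {P u v w u' v' : R}
    (hu : P * u = 0) (hu' : u * P = u) (hv : P * v = 0) (hv' : v * P = v)
    (hw : P * w = 0) (hw' : w * P = w)
    (hu2 : u' * P = 0) (hu3 : P * u' = u') (hv2 : v' * P = 0) (hv3 : P * v' = v') :
    ((u - u') * (v - v') - (v - v') * (u - u')) * w
        - w * ((u - u') * (v - v') - (v - v') * (u - u'))
      = -(u * v' * w - v * u' * w + w * v' * u - w * u' * v) := by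
  have e1 : u * v = 0 := by rw [← hu', mul_assoc, hv, mul_zero]
  have e2 : v * u = 0 := by rw [← hv', mul_assoc, hu, mul_zero]
  have e3 : u' * v' = 0 := by rw [← hv3, ← mul_assoc, hu2, zero_mul]
  have e4 : v' * u' = 0 := by rw [← hu3, ← mul_assoc, hv2, zero_mul]
  have e5 : w * u = 0 := by rw [← hw', mul_assoc, hu, mul_zero]
  have e6 : w * v = 0 := by rw [← hw', mul_assoc, hv, mul_zero]
  have e7 : u * w = 0 := by rw [← hu', mul_assoc, hw, mul_zero]
  have e8 : v * w = 0 := by rw [← hv', mul_assoc, hw, mul_zero]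
  have e9 : ((u - u') * (v - v') - (v - v') * (u - u')) * w
        - w * ((u - u') * (v - v') - (v - v') * (u - u'))
      = -(u * v' * w - v * u' * w + w * v' * u - w * u' * v)
        + (u * v) * w - (v * u) * w + (u' * v') * w - (v' * u') * w - u' * (v * w) + v' * (u * w)
        - (w * u) * v + (w * v) * u - w * (u' * v') + w * (v' * u') + (w * u) * v' - (w * v) * u' := by
    noncomm_ring
  rw [e9, e1, e2, e3, e4, e5, e6, e7, e8]
  simp

/-- Tangent vectors `D_u y` are also generated by the skew operators `u - u*`, so equivariance
differentiates the projection. The commutator `k` of two such operators fixes `y`, and the curvature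
is `-D_{[k,w]} y`. -/
theorem IsUnitVolume.riemann_eq {T : Submodule ℝ (EuclideanSpace ℝ (Fin (m + n)))}
    {y : MultiVector m (m + n)} (h : IsUnitVolume T y) {u v w : Op (m + n)}
    (hu : T.starProjection * u = 0) (hu' : u * T.starProjection = u)
    (hv : T.starProjection * v = 0) (hv' : v * T.starProjection = v)
    (hw : T.starProjection * w = 0) (hw' : w * T.starProjection = w) :
    riemann (grassmannian m n) y (der u y) (der v y) (der w y)
      = der (u * star v * w - v * star u * w + w * star v * u - w * star u * v) y := by
  set P := T.starProjection with hP
  have hu2 : star u * P = 0 := by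
    rw [← star_eq_zero, star_mul, star_star, hP, starProjection_star, hu]
  have hv2 : star v * P = 0 := by
    rw [← star_eq_zero, star_mul, star_star, hP, starProjection_star, hv]
  have hu3 : P * star u = star u := by
    rw [← star_inj, star_mul, star_star, hP, starProjection_star, hu']
  have hv3 : P * star v = star v := by
    rw [← star_inj, star_mul, star_star, hP, starProjection_star, hv']
  have hskew : ∀ u : Op (m + n), star (u - star u) = -(u - star u) := fun u =>
    (star_sub u (star u)).trans (by rw [star_star, neg_sub])
  have hderu : ∀ {u : Op (m + n)}, star u * P = 0 → der (u - star u) y = der u y := fun h2 => by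
    rw [map_sub, sub_apply, h.der_eq_zero h2, sub_zero]
  have hcomp : ∀ {u w : Op (m + n)}, P * u = 0 → u * P = u → P * star u = star u → P * w = 0 →
      tangentMap y (der (u - star u) (der w y)) = 0 := fun hu hu' hu3 hw => by
    rw [map_sub, sub_apply, map_sub, h.tangentMap_der_der hu hu' hw, h.der_star_der hu,
      ← hu3, mul_assoc, h.der_proj_mul, map_smul, h.tangentMap_self, smul_zero, sub_zero]
  have hfd : ∀ {u w : Op (m + n)}, star u * P = 0 → P * w = 0 → w * P = w → P * u = 0 → u * P = u →
      P * star u = star u →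
      fderiv ℝ tangentMap y (der u y) (der w y) = der (u - star u) (der w y) :=
    fun hu2 hw hw' hu hu' hu3 => by
      rw [← hderu hu2, fderiv_tangentMap_skew (hskew _), h.tangentMap_der hw hw',
        hcomp hu hu' hu3 hw, sub_zero]
  set k : Op (m + n) := (u - star u) * (v - star v) - (v - star v) * (u - star u) with hk
  have hkP : k * P = star v * u - star u * v :=
    skew_commutator_mul_left hu hu' hv hv' hu2 hv2
  have hkstar : star k = -k := by
    refine (star_sub ((u - star u) * (v - star v)) _).trans ?_
    rw [star_mul, star_mul, hskew, hskew, clm_neg_mul, clm_neg_mul, clm_mul_neg, clm_mul_neg,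
      neg_neg, neg_neg, hk, neg_sub]
  -- A skew operator has zero trace on `T`, and `k` maps `T` to itself, so both parts of `der_eq`
  -- vanish.
  have hky : der k y = 0 := by
    rw [h.der_eq, hs_skew (starProjection_star T) hkstar, mul_assoc, hkP, ← hu3, ← hv3,
      mul_assoc, mul_assoc, ← mul_sub, ← mul_assoc, one_sub_mul_proj]
    simp
  have hmem : ∀ {u : Op (m + n)}, P * u = 0 → u * P = u →
      der u y ∈ tangentSpaceOf (grassmannian m n) y := fun {u} hu hu' =>
    (mem_tangentSpaceOf_grassmannian h).2 ⟨u, by rw [hom_eq_self hu hu']⟩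
  have huv : fderiv ℝ tangentMap y (der u y) (der v y)
      = fderiv ℝ tangentMap y (der v y) (der u y) := by
    rw [hfd hu2 hv hv' hu hu' hu3, hfd hv2 hu hu' hv hv' hv3, ← hderu hv2, ← hderu hu2,
      ← sub_eq_zero, der_comm, hky]
  rw [GaussMap.riemann_eq contDiff_tangentMap
    (fun z hz => (mem_grassmannian_iff.1 hz).choose_spec.projTo_eq)
    (mem_grassmannian_iff.2 ⟨T, h⟩) (hmem hu hu') (hmem hv hv') huv,
    hfd hu2 hw hw' hu hu' hu3, hfd hv2 hw hw' hv hv' hv3]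
  have hfd2 : ∀ {u v : Op (m + n)}, star u * P = 0 → P * v = 0 → v * P = v →
      P * star v = star v →
      fderiv ℝ tangentMap y (der u y) (der (v - star v) (der w y))
        = -tangentMap y (der (u - star u) (der (v - star v) (der w y))) :=
    fun hu2 hv hv' hv3 => by
      rw [← hderu hu2, fderiv_tangentMap_skew (hskew _), hcomp hv hv' hv3 hw, map_zero, zero_sub]
  have hkw : k * w - w * k = -(u * star v * w - v * star u * w + w * star v * u - w * star u * v) :=
    skew_commutator_hom hu hu' hv hv' hw hw' hu2 hu3 hv2 hv3
  have hkk := der_comm k w y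
  rw [hky, map_zero, sub_zero, hkw] at hkk
  rw [hfd2 hu2 hv hv' hv3, hfd2 hv2 hu hu' hu3, ← neg_sub', ← map_sub, der_comm, ← hk, hkk,
    map_neg]
  set X := u * star v * w - v * star u * w + w * star v * u - w * star u * v with hX
  have hneg : (der (-X) : MultiVector m (m + n) →L[ℝ] _) = -der X := map_neg der X
  have hX1 : P * X = 0 := by
    simp only [hX, mul_sub, mul_add, ← mul_assoc, hu, hv, hw, zero_mul, sub_zero, add_zero]
  have hX2 : X * P = X := by
    simp only [hX, sub_mul, add_mul, mul_assoc, hw', hu', hv']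
  rw [hneg, neg_apply, map_neg, map_neg, neg_neg, h.tangentMap_der hX1 hX2, h.tangentMap_der hX1 hX2]

end Curvature

/-! ### Directional derivatives along tangential parts of constant vectors -/

section Ambient

variable {m : ℕ} {E : Type*} [NormedAddCommGroup E] [InnerProductSpace ℝ E]
  [FiniteDimensional ℝ E] {V : Type*} [NormedAddCommGroup V] [NormedSpace ℝ V]
  {M : Type*} [TopologicalSpace M] [ChartedSpace (EuclideanSpace ℝ (Fin m)) M]

/-- Smoothness of vector-valued functions on `M`. -/
abbrev IsSmooth (m : ℕ) {M : Type*} [TopologicalSpace M]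
    [ChartedSpace (EuclideanSpace ℝ (Fin m)) M] {V : Type*} [NormedAddCommGroup V]
    [NormedSpace ℝ V] (s : M → V) : Prop := ContMDiff (𝓡 m) 𝓘(ℝ, V) ∞ s

/-- The derivative of `s` in the direction of the tangential part of `a`. -/
def ambDeriv (f : Immersion m M E) (a : E) (s : M → V) (p : M) : V :=
  mvfderiv (𝓡 m) s p (tanPart f p a)

variable (f : Immersion m M E)

theorem tanPart_add (p : M) (v w : E) : tanPart f p (v + w) = tanPart f p v + tanPart f p w := by
  simp only [tanPart, map_add]

theorem tanPart_smul (p : M) (r : ℝ) (w : E) : tanPart f p (r • w) = r • tanPart f p w := by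
  simp only [tanPart, map_smul]

theorem tanPart_mvfderiv (p : M) (v : TangentSpace (𝓡 m) p) :
    tanPart f p (mvfderiv (𝓡 m) f p v) = v := by
  have h : tanProj f p (mvfderiv (𝓡 m) f p v) = mvfderiv (𝓡 m) f p v :=
    Submodule.starProjection_eq_self_iff.2 ⟨v, rfl⟩
  rw [tanPart, h]
  exact LinearMap.leftInverse_apply_of_inj (LinearMap.ker_eq_bot.2 (f.injective p)) v

theorem mvfderiv_tanPart (p : M) (w : E) :
    mvfderiv (𝓡 m) f p (tanPart f p w) = tanProj f p w := by
  obtain ⟨v, hv⟩ : tanProj f p w ∈ tangentPlane f p := Submodule.starProjection_apply_mem _ _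
  have h : tanPart f p w = v := by
    rw [tanPart, ← hv]
    exact LinearMap.leftInverse_apply_of_inj (LinearMap.ker_eq_bot.2 (f.injective p)) v
  rw [h]
  exact hv

theorem tanProj_tanProj (p : M) (w : E) : tanProj f p (tanProj f p w) = tanProj f p w :=
  Submodule.starProjection_eq_self_iff.2 (Submodule.starProjection_apply_mem _ _)

theorem tanPart_tanProj (p : M) (w : E) : tanPart f p (tanProj f p w) = tanPart f p w := by
  rw [tanPart, tanPart, tanProj_tanProj]

theorem tanPart_eq_zero {p : M} {w : E} (h : tanProj f p w = 0) : tanPart f p w = 0 := by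
  rw [tanPart, h, map_zero]

theorem ambDeriv_tanProj (p : M) (a : E) (s : M → V) :
    ambDeriv f (tanProj f p a) s p = ambDeriv f a s p := by
  rw [ambDeriv, tanPart_tanProj, ambDeriv]

theorem ambDeriv_immersion (a : E) (p : M) : ambDeriv f a f p = tanProj f p a :=
  mvfderiv_tanPart f p a

theorem mvfderiv_eq_ambDeriv (s : M → V) (p : M) (v : TangentSpace (𝓡 m) p) :
    mvfderiv (𝓡 m) s p v = ambDeriv f (mvfderiv (𝓡 m) f p v) s p := by
  rw [ambDeriv, tanPart_mvfderiv]

/-- The adjoint as a real linear map. -/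
def adjointCLM (F E : Type*) [NormedAddCommGroup F] [InnerProductSpace ℝ F]
    [FiniteDimensional ℝ F] [NormedAddCommGroup E] [InnerProductSpace ℝ E] [FiniteDimensional ℝ E] :
    (F →L[ℝ] E) →L[ℝ] (E →L[ℝ] F) :=
  LinearMap.toContinuousLinearMap
    { toFun := fun A => ContinuousLinearMap.adjoint A
      map_add' := fun A B => by simp
      map_smul' := fun r A => by simp }

/-- The left inverse `(L† L)⁻¹ L†` of an injective linear map `L`, which vanishes on the orthogonal
complement of its range. -/
def pseudoInverse {F E : Type*} [NormedAddCommGroup F] [InnerProductSpace ℝ F]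
    [FiniteDimensional ℝ F] [NormedAddCommGroup E] [InnerProductSpace ℝ E]
    [FiniteDimensional ℝ E] (L : F →L[ℝ] E) : E →L[ℝ] F :=
  (adjointCLM F E L ∘L L).inverse ∘L adjointCLM F E L

/-! ### Smooth dependence of the left inverse on the linear map. -/

section PseudoInverse

variable {F : Type*} [NormedAddCommGroup F] [InnerProductSpace ℝ F] [FiniteDimensional ℝ F]

theorem isInvertible_adjoint_comp {L : F →L[ℝ] E} (hL : Function.Injective L) :
    (adjointCLM F E L ∘L L).IsInvertible := by
  have hinj : Function.Injective (adjointCLM F E L ∘L L).toLinearMap := by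
    rw [← LinearMap.ker_eq_bot, LinearMap.ker_eq_bot']
    intro x hx
    have h1 : inner ℝ (ContinuousLinearMap.adjoint L (L x)) x = (0 : ℝ) := by
      have : ContinuousLinearMap.adjoint L (L x) = 0 := hx
      rw [this, inner_zero_left]
    rw [ContinuousLinearMap.adjoint_inner_left, inner_self_eq_zero] at h1
    exact hL (by rw [h1, map_zero])
  refine ⟨(LinearEquiv.ofInjectiveEndo _ hinj).toContinuousLinearEquiv, ?_⟩
  ext x
  rfl

theorem pseudoInverse_apply {L : F →L[ℝ] E} (hL : Function.Injective L) (x : F) :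
    pseudoInverse L (L x) = x := by
  have h := isInvertible_adjoint_comp hL
  exact h.inverse_apply_eq.2 rfl

/-- The hypothesis is the normal equation `L† (w - L x) = 0` of least squares. -/
theorem pseudoInverse_eq {L : F →L[ℝ] E} (hL : Function.Injective L) {x : F} {w : E}
    (hw : ∀ z, inner ℝ (L z) (w - L x) = (0 : ℝ)) : pseudoInverse L w = x := by
  have h0 : adjointCLM F E L (w - L x) = 0 := by
    rw [← inner_self_eq_zero (𝕜 := ℝ)]
    change inner ℝ (ContinuousLinearMap.adjoint L (w - L x)) (adjointCLM F E L (w - L x)) = _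
    rw [ContinuousLinearMap.adjoint_inner_left, real_inner_comm]
    exact hw _
  have h1 : pseudoInverse L (w - L x) = 0 := by
    change (adjointCLM F E L ∘L L).inverse (adjointCLM F E L (w - L x)) = 0
    rw [h0, map_zero]
  rw [map_sub, pseudoInverse_apply hL, sub_eq_zero] at h1
  exact h1

theorem contDiffAt_pseudoInverse {L : F →L[ℝ] E} (hL : Function.Injective L) :
    ContDiffAt ℝ ∞ (pseudoInverse : (F →L[ℝ] E) → (E →L[ℝ] F)) L := by
  have h1 : ContDiffAt ℝ ∞ (fun L : F →L[ℝ] E => adjointCLM F E L) L :=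
    (adjointCLM F E).contDiff.contDiffAt
  have h2 : ContDiffAt ℝ ∞ (fun L : F →L[ℝ] E => adjointCLM F E L ∘L L) L :=
    h1.clm_comp contDiffAt_id
  have h3 : ContDiffAt ℝ ∞ (fun L : F →L[ℝ] E => (adjointCLM F E L ∘L L).inverse) L :=
    ContDiffAt.comp (g := ContinuousLinearMap.inverse) L
      (isInvertible_adjoint_comp hL).contDiffAt_map_inverse h2
  exact h3.clm_comp h1

end PseudoInverse

/-! #### In a chart -/

variable [IsManifold (𝓡 m) ∞ M]

/-- A function on `M` in the chart at `p`. -/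
abbrev inChart (m : ℕ) {M : Type*} [TopologicalSpace M]
    [ChartedSpace (EuclideanSpace ℝ (Fin m)) M] {V : Type*} (p : M) (s : M → V) :
    EuclideanSpace ℝ (Fin m) → V := s ∘ (extChartAt (𝓡 m) p).symm

theorem contDiffOn_inChart {s : M → V} (hs : IsSmooth m s) (p : M) :
    ContDiffOn ℝ ∞ (inChart m p s) (extChartAt (𝓡 m) p).target :=
  contMDiffOn_iff_contDiffOn.1 (hs.comp_contMDiffOn (contMDiffOn_extChartAt_symm p))

theorem contDiffAt_inChart {s : M → V} (hs : IsSmooth m s) (p : M) {x : EuclideanSpace ℝ (Fin m)}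
    (hx : x ∈ (extChartAt (𝓡 m) p).target) : ContDiffAt ℝ ∞ (inChart m p s) x :=
  (contDiffOn_inChart hs p).contDiffAt ((isOpen_extChartAt_target p).mem_nhds hx)

theorem mvfderiv_eq_fderiv_inChart {s : M → V} (hs : IsSmooth m s) {p q : M}
    (hq : q ∈ (extChartAt (𝓡 m) p).source) (v : TangentSpace (𝓡 m) q) :
    mvfderiv (𝓡 m) s q v = fderiv ℝ (inChart m p s) (extChartAt (𝓡 m) p q)
      (mfderiv (𝓡 m) 𝓘(ℝ, EuclideanSpace ℝ (Fin m)) (extChartAt (𝓡 m) p) q v) := by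
  have hφ : MDifferentiableAt (𝓡 m) 𝓘(ℝ, EuclideanSpace ℝ (Fin m)) (extChartAt (𝓡 m) p) q :=
    mdifferentiableAt_extChartAt (by rwa [extChartAt_source] at hq)
  have hs' := (contDiffAt_inChart hs p ((extChartAt (𝓡 m) p).map_source hq)).differentiableAt
    (by simp)
  have heq : s =ᶠ[nhds q] inChart m p s ∘ extChartAt (𝓡 m) p := by
    filter_upwards [(isOpen_extChartAt_source p).mem_nhds hq] with q' hq'
    exact congrArg s ((extChartAt (𝓡 m) p).left_inv hq').symm
  have h1 : mvfderiv (𝓡 m) s q v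
      = mfderiv (𝓡 m) 𝓘(ℝ, V) (inChart m p s ∘ extChartAt (𝓡 m) p) q v := by
    change mfderiv (𝓡 m) 𝓘(ℝ, V) s q v = _
    rw [heq.mfderiv_eq]
    rfl
  rw [h1, mfderiv_comp q hs'.mdifferentiableAt hφ, mfderiv_eq_fderiv]
  rfl

omit [FiniteDimensional ℝ E] in
theorem injective_fderiv_inChart {p : M} {x : EuclideanSpace ℝ (Fin m)}
    (hx : x ∈ (extChartAt (𝓡 m) p).target) :
    Function.Injective (fderiv ℝ (inChart m p f) x) := by
  have hq := (extChartAt (𝓡 m) p).map_target hx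
  have hinv := isInvertible_mfderiv_extChartAt (I := 𝓡 m) hq
  obtain ⟨e, he⟩ := hinv
  intro u v huv
  have key : ∀ u, fderiv ℝ (inChart m p f) x u
      = mvfderiv (𝓡 m) f ((extChartAt (𝓡 m) p).symm x) (e.symm u) := fun u => by
    rw [mvfderiv_eq_fderiv_inChart f.contMDiff hq, (extChartAt (𝓡 m) p).right_inv hx, ← he]
    congr 1
    exact (e.apply_symm_apply u).symm
  rw [key, key] at huv
  exact e.symm.injective (f.injective _ huv)

/-- The tangential part of ambient vectors, in the chart at `p`. -/
def tanChart (p : M) (x : EuclideanSpace ℝ (Fin m)) : E →L[ℝ] EuclideanSpace ℝ (Fin m) :=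
  pseudoInverse (fderiv ℝ (inChart m p f) x)

theorem contDiffAt_tanChart {p : M} {x : EuclideanSpace ℝ (Fin m)}
    (hx : x ∈ (extChartAt (𝓡 m) p).target) : ContDiffAt ℝ ∞ (tanChart f p) x :=
  (contDiffAt_pseudoInverse (injective_fderiv_inChart f hx)).comp x
    ((contDiffAt_inChart f.contMDiff p hx).fderiv_right (by simp))

/-- The tangential part solves the least squares problem for `df`; in a chart it is thus a
pseudo-inverse, which depends smoothly on the point. -/
theorem mfderiv_extChartAt_tanPart {p q : M} (hq : q ∈ (extChartAt (𝓡 m) p).source) (w : E) :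
    mfderiv (𝓡 m) 𝓘(ℝ, EuclideanSpace ℝ (Fin m)) (extChartAt (𝓡 m) p) q (tanPart f q w)
      = tanChart f p (extChartAt (𝓡 m) p q) w := by
  have hx := (extChartAt (𝓡 m) p).map_source hq
  obtain ⟨e, he⟩ := isInvertible_mfderiv_extChartAt (I := 𝓡 m) hq
  symm
  refine pseudoInverse_eq (injective_fderiv_inChart f hx) fun z => ?_
  rw [← mvfderiv_eq_fderiv_inChart f.contMDiff hq, mvfderiv_tanPart]
  have hz : fderiv ℝ (inChart m p f) (extChartAt (𝓡 m) p q) z ∈ tangentPlane f q := by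
    refine ⟨e.symm z, ?_⟩
    change mvfderiv (𝓡 m) f q (e.symm z) = _
    rw [mvfderiv_eq_fderiv_inChart f.contMDiff hq, ← he]
    congr 1
    exact e.apply_symm_apply z
  exact (Submodule.mem_orthogonal _ _).1 (Submodule.sub_starProjection_mem_orthogonal w) _ hz

theorem ambDeriv_eq_fderiv_inChart {s : M → V} (hs : IsSmooth m s) {p q : M}
    (hq : q ∈ (extChartAt (𝓡 m) p).source) (w : E) :
    ambDeriv f w s q = fderiv ℝ (inChart m p s) (extChartAt (𝓡 m) p q)
      (tanChart f p (extChartAt (𝓡 m) p q) w) := by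
  rw [ambDeriv, mvfderiv_eq_fderiv_inChart hs hq, mfderiv_extChartAt_tanPart f hq]

theorem IsSmooth.ambDeriv {s : M → V} (hs : IsSmooth m s) (w : E) :
    IsSmooth m (ambDeriv f w s) := by
  intro p
  have hp := mem_extChartAt_source (I := 𝓡 m) p
  have hx := mem_extChartAt_target (I := 𝓡 m) p
  have h1 : ContDiffAt ℝ ∞ (fun x => fderiv ℝ (inChart m p s) x (tanChart f p x w))
      (extChartAt (𝓡 m) p p) :=
    ((contDiffAt_inChart hs p hx).fderiv_right (by simp)).clm_apply
      ((contDiffAt_tanChart f hx).clm_apply contDiffAt_const)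
  have h2 := h1.comp_contMDiffAt (contMDiffAt_extChartAt (I := 𝓡 m) (n := ∞) (x := p))
  refine h2.congr_of_eventuallyEq ?_
  filter_upwards [(isOpen_extChartAt_source p).mem_nhds hp] with q hq
  exact ambDeriv_eq_fderiv_inChart f hs hq w

theorem ambDeriv_ambDeriv_eq {s : M → V} (hs : IsSmooth m s) (p : M) (v w : E) :
    ambDeriv f v (ambDeriv f w s) p
      = fderiv ℝ (fderiv ℝ (inChart m p s)) (extChartAt (𝓡 m) p p)
          (tanChart f p (extChartAt (𝓡 m) p p) v) (tanChart f p (extChartAt (𝓡 m) p p) w)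
        + fderiv ℝ (inChart m p s) (extChartAt (𝓡 m) p p)
          (fderiv ℝ (tanChart f p) (extChartAt (𝓡 m) p p)
            (tanChart f p (extChartAt (𝓡 m) p p) v) w) := by
  have hp := mem_extChartAt_source (I := 𝓡 m) p
  have hx := mem_extChartAt_target (I := 𝓡 m) p
  have heq : inChart m p (ambDeriv f w s)
      =ᶠ[nhds (extChartAt (𝓡 m) p p)] fun x => fderiv ℝ (inChart m p s) x (tanChart f p x w) := by
    filter_upwards [(isOpen_extChartAt_target p).mem_nhds hx] with x hx
    have := ambDeriv_eq_fderiv_inChart f hs ((extChartAt (𝓡 m) p).map_target hx) w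
    rw [(extChartAt (𝓡 m) p).right_inv hx] at this
    exact this
  have h1 := ((contDiffAt_inChart hs p hx).fderiv_right (m := ∞) (by simp)).differentiableAt
    (by simp)
  have h2 := (contDiffAt_tanChart f hx).differentiableAt (by simp)
  rw [ambDeriv_eq_fderiv_inChart f (hs.ambDeriv f w) hp, heq.fderiv_eq,
    fderiv_clm_apply h1 (h2.clm_apply (differentiableAt_const w)),
    fderiv_clm_apply h2 (differentiableAt_const w)]
  simp
  abel

theorem ambDeriv_commutator_eq {s : M → V} (hs : IsSmooth m s) (p : M) (v w : E) :
    ambDeriv f v (ambDeriv f w s) p - ambDeriv f w (ambDeriv f v s) p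
      = fderiv ℝ (inChart m p s) (extChartAt (𝓡 m) p p)
          (fderiv ℝ (tanChart f p) (extChartAt (𝓡 m) p p)
              (tanChart f p (extChartAt (𝓡 m) p p) v) w
            - fderiv ℝ (tanChart f p) (extChartAt (𝓡 m) p p)
              (tanChart f p (extChartAt (𝓡 m) p p) w) v) := by
  have hx := mem_extChartAt_target (I := 𝓡 m) p
  have hsymm := ((contDiffAt_inChart hs p hx).isSymmSndFDerivAt (by
    rw [minSmoothness_of_isRCLikeNormedField]
    exact WithTop.coe_le_coe.2 (OrderTop.le_top (2 : ℕ∞)))).eq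
    (tanChart f p (extChartAt (𝓡 m) p p) v) (tanChart f p (extChartAt (𝓡 m) p p) w)
  rw [ambDeriv_ambDeriv_eq f hs, ambDeriv_ambDeriv_eq f hs, hsymm, map_sub]
  abel

omit [IsManifold (𝓡 m) ∞ M] in
theorem isSmooth_of_clm_apply {A : M → E →L[ℝ] V} (hA : ∀ w, IsSmooth m fun q => A q w) :
    IsSmooth m A := by
  have h : A = fun q => ∑ k, ContinuousLinearMap.smulRightL ℝ E V
      (innerSL ℝ (stdOrthonormalBasis ℝ E k)) (A q (stdOrthonormalBasis ℝ E k)) := by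
    funext q
    ext x
    conv_lhs => rw [← (stdOrthonormalBasis ℝ E).sum_repr' x, map_sum]
    simp
  rw [h]
  exact contMDiff_finsetSum fun k _ =>
    ((ContinuousLinearMap.smulRightL ℝ E V (innerSL ℝ (stdOrthonormalBasis ℝ E k))).contDiff
      (n := ∞)).comp_contMDiff (hA _)

/-- The projection of a constant vector `w` is the derivative of the immersion itself along the
tangential part of `w`. -/
theorem isSmooth_tanProj : IsSmooth m (tanProj f) :=
  isSmooth_of_clm_apply fun w => by
    have := IsSmooth.ambDeriv f f.contMDiff w
    have h : ambDeriv f w f = fun q => tanProj f q w := funext fun q => ambDeriv_immersion f w q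
    rwa [h] at this

omit [FiniteDimensional ℝ E] in
theorem fderiv_inChart_mem (p : M) (c : EuclideanSpace ℝ (Fin m)) :
    ∃ v : TangentSpace (𝓡 m) p,
      mfderiv (𝓡 m) 𝓘(ℝ, EuclideanSpace ℝ (Fin m)) (extChartAt (𝓡 m) p) p v = c ∧
      mvfderiv (𝓡 m) f p v = fderiv ℝ (inChart m p f) (extChartAt (𝓡 m) p p) c := by
  obtain ⟨e, he⟩ := isInvertible_mfderiv_extChartAt (I := 𝓡 m) (mem_extChartAt_source (I := 𝓡 m) p)
  have h : mfderiv (𝓡 m) 𝓘(ℝ, EuclideanSpace ℝ (Fin m)) (extChartAt (𝓡 m) p) p (e.symm c) = c := by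
    rw [← he]; exact e.apply_symm_apply c
  refine ⟨e.symm c, h, ?_⟩
  rw [mvfderiv_eq_fderiv_inChart f.contMDiff (mem_extChartAt_source p), h]

/-- The second derivatives of the immersion differ by a tangent vector. -/
theorem ambDeriv_commutator_immersion (p : M) (v w : E) :
    ambDeriv f v (fun q => tanProj f q w) p - ambDeriv f w (fun q => tanProj f q v) p
      = fderiv ℝ (inChart m p f) (extChartAt (𝓡 m) p p)
          (fderiv ℝ (tanChart f p) (extChartAt (𝓡 m) p p)
              (tanChart f p (extChartAt (𝓡 m) p p) v) w
            - fderiv ℝ (tanChart f p) (extChartAt (𝓡 m) p p)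
              (tanChart f p (extChartAt (𝓡 m) p p) w) v) := by
  have h := ambDeriv_commutator_eq f f.contMDiff p v w
  have h1 : ∀ w, ambDeriv f w f = fun q => tanProj f q w :=
    fun w => funext fun q => ambDeriv_immersion f w q
  rw [h1, h1] at h
  exact h

/-- The left difference is the image under `df` of a bracket of vector fields; its tangency amounts
to the symmetry of the second fundamental form. -/
theorem tanProj_commutator (p : M) (v w : E) :
    tanProj f p (ambDeriv f v (fun q => tanProj f q w) p - ambDeriv f w (fun q => tanProj f q v) p)
      = ambDeriv f v (fun q => tanProj f q w) p - ambDeriv f w (fun q => tanProj f q v) p := by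
  rw [ambDeriv_commutator_immersion]
  refine Submodule.starProjection_eq_self_iff.2 ?_
  obtain ⟨z, -, hz⟩ := fderiv_inChart_mem f p
    (fderiv ℝ (tanChart f p) (extChartAt (𝓡 m) p p)
        (tanChart f p (extChartAt (𝓡 m) p p) v) w
      - fderiv ℝ (tanChart f p) (extChartAt (𝓡 m) p p)
        (tanChart f p (extChartAt (𝓡 m) p p) w) v)
  exact ⟨z, hz⟩

theorem ambDeriv_commutator {s : M → V} (hs : IsSmooth m s) (p : M) (v w : E) :
    ambDeriv f v (ambDeriv f w s) p - ambDeriv f w (ambDeriv f v s) p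
      = ambDeriv f (ambDeriv f v (fun q => tanProj f q w) p
          - ambDeriv f w (fun q => tanProj f q v) p) s p := by
  rw [ambDeriv_commutator_eq f hs, ambDeriv_commutator_immersion]
  obtain ⟨z, hz, hz'⟩ := fderiv_inChart_mem f p
    (fderiv ℝ (tanChart f p) (extChartAt (𝓡 m) p p)
        (tanChart f p (extChartAt (𝓡 m) p p) v) w
      - fderiv ℝ (tanChart f p) (extChartAt (𝓡 m) p p)
        (tanChart f p (extChartAt (𝓡 m) p p) w) v)
  rw [← hz', ambDeriv, tanPart_mvfderiv, mvfderiv_eq_fderiv_inChart hs (mem_extChartAt_source p), hz]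

theorem mpullbackWithin_extend (p : M) (w : E) {x : EuclideanSpace ℝ (Fin m)}
    (hx : x ∈ (extChartAt (𝓡 m) p).target) :
    VectorField.mpullbackWithin 𝓘(ℝ, EuclideanSpace ℝ (Fin m)) (𝓡 m) (extChartAt (𝓡 m) p).symm
      (fun q => tanPart f q w) (Set.range (𝓡 m)) x = tanChart f p x w := by
  have hq := (extChartAt (𝓡 m) p).map_target hx
  have h1 := mfderiv_extChartAt_tanPart f hq w
  rw [(extChartAt (𝓡 m) p).right_inv hx] at h1
  rw [VectorField.mpullbackWithin_apply, ← h1,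
    (isInvertible_mfderivWithin_extChartAt_symm hx).inverse_apply_eq]
  have h2 := mfderivWithin_extChartAt_symm_comp_mfderiv_extChartAt' (I := 𝓡 m) hq
  rw [(extChartAt (𝓡 m) p).right_inv hx] at h2
  exact (congrArg (fun L => L (tanPart f ((extChartAt (𝓡 m) p).symm x) w)) h2).symm

/-! #### Rules of differentiation -/

section Rules

variable {W : Type*} [NormedAddCommGroup W] [NormedSpace ℝ W] {s t : M → V} (a : E) (p : M)

theorem ambDeriv_eq_fderiv (hs : IsSmooth m s) :
    ambDeriv f a s p = fderiv ℝ (inChart m p s) (extChartAt (𝓡 m) p p)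
      (tanChart f p (extChartAt (𝓡 m) p p) a) :=
  ambDeriv_eq_fderiv_inChart f hs (mem_extChartAt_source p) a

omit f in
theorem differentiableAt_inChart (hs : IsSmooth m s) :
    DifferentiableAt ℝ (inChart m p s) (extChartAt (𝓡 m) p p) :=
  (contDiffAt_inChart hs p (mem_extChartAt_target p)).differentiableAt (by simp)

theorem ambDeriv_add (hs : IsSmooth m s) (ht : IsSmooth m t) :
    ambDeriv f a (fun q => s q + t q) p = ambDeriv f a s p + ambDeriv f a t p := by
  have h : IsSmooth m fun q => s q + t q := hs.add ht
  rw [ambDeriv_eq_fderiv f a p hs, ambDeriv_eq_fderiv f a p ht, ambDeriv_eq_fderiv f a p h,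
    ← add_apply]
  exact DFunLike.congr_fun
    (fderiv_fun_add (differentiableAt_inChart p hs) (differentiableAt_inChart p ht)) _

theorem ambDeriv_sub (hs : IsSmooth m s) (ht : IsSmooth m t) :
    ambDeriv f a (fun q => s q - t q) p = ambDeriv f a s p - ambDeriv f a t p := by
  have h : IsSmooth m fun q => s q - t q := hs.sub ht
  rw [ambDeriv_eq_fderiv f a p hs, ambDeriv_eq_fderiv f a p ht, ambDeriv_eq_fderiv f a p h,
    ← sub_apply]
  exact DFunLike.congr_fun
    (fderiv_fun_sub (differentiableAt_inChart p hs) (differentiableAt_inChart p ht)) _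

omit [IsManifold (𝓡 m) ∞ M] in
theorem ambDeriv_const (c : V) : ambDeriv f a (fun _ => c) p = 0 := by
  rw [ambDeriv, mvfderiv_const]
  rfl

theorem ambDeriv_sum {ι : Type*} (I : Finset ι) {s : ι → M → V} (hs : ∀ i, IsSmooth m (s i)) :
    ambDeriv f a (fun q => ∑ i ∈ I, s i q) p = ∑ i ∈ I, ambDeriv f a (s i) p := by
  classical
  induction I using Finset.induction_on with
  | empty => simpa using ambDeriv_const f a p (0 : V)
  | insert i I hi ih =>
    simp only [Finset.sum_insert hi]
    rw [ambDeriv_add f a p (hs i) (contMDiff_finsetSum fun i _ => hs i), ih]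

theorem ambDeriv_comp {g : V → W} (hg : ContDiff ℝ ∞ g) (hs : IsSmooth m s) :
    ambDeriv f a (fun q => g (s q)) p = fderiv ℝ g (s p) (ambDeriv f a s p) := by
  have h1 : IsSmooth m fun q => g (s q) := hg.comp_contMDiff hs
  have h2 : inChart m p (fun q => g (s q)) = g ∘ inChart m p s := rfl
  have h3 : inChart m p s (extChartAt (𝓡 m) p p) = s p :=
    congrArg s ((extChartAt (𝓡 m) p).left_inv (mem_extChartAt_source p))
  rw [ambDeriv_eq_fderiv f a p hs, ambDeriv_eq_fderiv f a p h1, h2,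
    fderiv_comp _ (hg.differentiable (by simp) _) (differentiableAt_inChart p hs), h3]
  rfl

theorem ambDeriv_clm (L : V →L[ℝ] W) (hs : IsSmooth m s) :
    ambDeriv f a (fun q => L (s q)) p = L (ambDeriv f a s p) := by
  rw [ambDeriv_comp f a p L.contDiff hs, L.fderiv]

theorem ambDeriv_clm_apply {A : M → V →L[ℝ] W} (hA : IsSmooth m A) (hs : IsSmooth m s) :
    ambDeriv f a (fun q => A q (s q)) p = ambDeriv f a A p (s p) + A p (ambDeriv f a s p) := by
  have h1 : inChart m p (fun q => A q (s q)) = fun x => inChart m p A x (inChart m p s x) := rfl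
  have h3 : inChart m p s (extChartAt (𝓡 m) p p) = s p :=
    congrArg s ((extChartAt (𝓡 m) p).left_inv (mem_extChartAt_source p))
  have h4 : inChart m p A (extChartAt (𝓡 m) p p) = A p :=
    congrArg A ((extChartAt (𝓡 m) p).left_inv (mem_extChartAt_source p))
  rw [ambDeriv_eq_fderiv f a p hs, ambDeriv_eq_fderiv f a p hA,
    ambDeriv_eq_fderiv f a p (hA.clm_apply hs), h1,
    fderiv_clm_apply (differentiableAt_inChart p hA) (differentiableAt_inChart p hs)]
  simp only [add_apply, ContinuousLinearMap.comp_apply, ContinuousLinearMap.flip_apply, h3, h4]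
  exact add_comm _ _

theorem ambDeriv_apply {A : M → V →L[ℝ] W} (hA : IsSmooth m A) (v : V) :
    ambDeriv f a (fun q => A q v) p = ambDeriv f a A p v := by
  rw [ambDeriv_clm_apply f a p hA (contMDiff_const (c := v)), ambDeriv_const, map_zero, add_zero]

end Rules

/-- For `d` tangent at `p`, the derivative at `p` of the tangential part of `d` is normal. The image
of the bracket under `df` is therefore both normal and tangent, and `df` is injective. -/
theorem mlieBracket_extend (p : M) (u v : TangentSpace (𝓡 m) p) :
    VectorField.mlieBracket (𝓡 m) (extend f p u) (extend f p v) p = 0 := by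
  set φ := extChartAt (𝓡 m) p with hφ
  set a := mvfderiv (𝓡 m) f p u with ha
  set b := mvfderiv (𝓡 m) f p v with hb
  have hx : φ p ∈ φ.target := mem_extChartAt_target p
  let Y : E → EuclideanSpace ℝ (Fin m) → EuclideanSpace ℝ (Fin m) := fun w =>
    VectorField.mpullbackWithin 𝓘(ℝ, EuclideanSpace ℝ (Fin m)) (𝓡 m) φ.symm
      (fun q => tanPart f q w) (Set.range (𝓡 m))
  have hev : ∀ w : E, Y w =ᶠ[nhds (φ p)] fun x => tanChart f p x w :=
    fun w => by
      filter_upwards [(isOpen_extChartAt_target p).mem_nhds hx] with x hx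
      exact mpullbackWithin_extend f p w hx
  have hset : φ.symm ⁻¹' Set.univ ∩ Set.range (𝓡 m) = Set.univ := by simp
  have hd := (contDiffAt_tanChart f hx).differentiableAt (by simp)
  have hdw : ∀ w z, fderiv ℝ (fun x => tanChart f p x w) (φ p) z
      = fderiv ℝ (tanChart f p) (φ p) z w := fun w z => by
    rw [fderiv_clm_apply hd (differentiableAt_const w)]; simp
  have hc : fderiv ℝ (tanChart f p) (φ p) (tanChart f p (φ p) a) b
      - fderiv ℝ (tanChart f p) (φ p) (tanChart f p (φ p) b) a = 0 := by
    apply injective_fderiv_inChart f hx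
    rw [map_zero, ← ambDeriv_commutator_immersion, ← tanProj_commutator, map_sub]
    have hz : ∀ c d, tanProj f p d = d → tanProj f p (ambDeriv f c (fun q => tanProj f q d) p) = 0 := by
      intro c d hd
      have h1 : IsSmooth m fun q => tanProj f q d := (isSmooth_tanProj f).clm_apply contMDiff_const
      have h2 := ambDeriv_clm_apply f c p (isSmooth_tanProj f) h1
      simp only [tanProj_tanProj] at h2
      rw [hd, ← ambDeriv_apply f c p (isSmooth_tanProj f)] at h2
      simpa using h2
    have hta : tanProj f p a = a := Submodule.starProjection_eq_self_iff.2 ⟨u, rfl⟩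
    have htb : tanProj f p b = b := Submodule.starProjection_eq_self_iff.2 ⟨v, rfl⟩
    rw [hz a b htb, hz b a hta, sub_zero]
  rw [VectorField.mlieBracket, VectorField.mlieBracketWithin_apply, hset]
  have hbr : VectorField.lieBracket ℝ (Y a) (Y b) (φ p) = 0 := by
    change fderiv ℝ (Y b) (φ p) (Y a (φ p)) - fderiv ℝ (Y a) (φ p) (Y b (φ p)) = 0
    rw [(hev a).fderiv_eq, (hev b).fderiv_eq, (hev a).eq_of_nhds, (hev b).eq_of_nhds, hdw, hdw]
    exact hc
  exact (congrArg (mfderiv (𝓡 m) 𝓘(ℝ, EuclideanSpace ℝ (Fin m)) φ p).inverse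
    ((congrFun VectorField.lieBracketWithin_univ (φ p)).trans hbr)).trans (map_zero _)

end Ambient

/-! ### The derivative of the tangential projection -/

section Projection

variable {m : ℕ} {E : Type*} [NormedAddCommGroup E] [InnerProductSpace ℝ E]
  [FiniteDimensional ℝ E] {V : Type*} [NormedAddCommGroup V] [NormedSpace ℝ V]
  {M : Type*} [TopologicalSpace M] [ChartedSpace (EuclideanSpace ℝ (Fin m)) M]
  (f : Immersion m M E)

theorem norProj_apply (p : M) (w : E) : norProj f p w = w - tanProj f p w := by
  rw [norProj, Submodule.starProjection_orthogonal]
  rfl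

theorem norProj_eq (p : M) : norProj f p = 1 - tanProj f p := by
  ext w
  exact norProj_apply f p w

theorem tanProj_norProj (p : M) (w : E) : tanProj f p (norProj f p w) = 0 := by
  rw [norProj_apply, map_sub, tanProj_tanProj, sub_self]

theorem norProj_norProj (p : M) (w : E) : norProj f p (norProj f p w) = norProj f p w := by
  rw [norProj_apply f p (norProj f p w), tanProj_norProj, sub_zero]

theorem norProj_of_tanProj_eq_zero {p : M} {w : E} (h : tanProj f p w = 0) :
    norProj f p w = w := by
  rw [norProj_apply, h, sub_zero]

theorem norProj_eq_zero_of_tanProj {p : M} {w : E} (h : tanProj f p w = w) :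
    norProj f p w = 0 := by
  rw [norProj_apply, h, sub_self]

theorem inner_tanProj (p : M) (u v : E) :
    inner ℝ (tanProj f p u) v = inner ℝ u (tanProj f p v) :=
  Submodule.inner_starProjection_left_eq_right _ u v

theorem tanProj_mvfderiv (p : M) (v : TangentSpace (𝓡 m) p) :
    tanProj f p (mvfderiv (𝓡 m) f p v) = mvfderiv (𝓡 m) f p v :=
  Submodule.starProjection_eq_self_iff.2 ⟨v, rfl⟩

theorem ambDeriv_eq_zero_of_normal {p : M} {a : E} (h : tanProj f p a = 0) (s : M → V) :
    ambDeriv f a s p = 0 := by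
  rw [ambDeriv, tanPart_eq_zero f h, map_zero]

theorem isLinearMap_ambDeriv (s : M → V) (p : M) : IsLinearMap ℝ fun a => ambDeriv f a s p :=
  ⟨fun a b => by rw [ambDeriv, tanPart_add, map_add]; rfl,
    fun r a => by rw [ambDeriv, tanPart_smul, map_smul]; rfl⟩

/-- The derivative `∂_a P` of the tangential projection `P`. -/
def projVar (a : E) (p : M) : E →L[ℝ] E := ambDeriv f a (tanProj f) p

theorem projVar_tanProj (a : E) (p : M) : projVar f (tanProj f p a) p = projVar f a p :=
  ambDeriv_tanProj f p a _

theorem projVar_eq_zero_of_normal {p : M} {a : E} (h : tanProj f p a = 0) : projVar f a p = 0 :=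
  ambDeriv_eq_zero_of_normal f h _

theorem isLinearMap_projVar (p : M) : IsLinearMap ℝ fun a => projVar f a p :=
  isLinearMap_ambDeriv f _ p

variable [IsManifold (𝓡 m) ∞ M]

theorem isSmooth_norProj : IsSmooth m (norProj f) := by
  have h : norProj f = fun p => 1 - tanProj f p := funext fun p => norProj_eq f p
  rw [h]
  exact contMDiff_const.sub (isSmooth_tanProj f)

theorem isSmooth_projVar (a : E) : IsSmooth m (projVar f a) :=
  IsSmooth.ambDeriv f (isSmooth_tanProj f) a

theorem ambDeriv_norProj (a : E) (p : M) : ambDeriv f a (norProj f) p = -projVar f a p := by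
  have h : norProj f = fun p => 1 - tanProj f p := funext fun p => norProj_eq f p
  rw [h, ambDeriv_sub f a p contMDiff_const (isSmooth_tanProj f), ambDeriv_const, zero_sub]
  rfl

theorem ambDeriv_tanProj_apply {s : M → E} (hs : IsSmooth m s) (a : E) (p : M) :
    ambDeriv f a (fun q => tanProj f q (s q)) p
      = projVar f a p (s p) + tanProj f p (ambDeriv f a s p) :=
  ambDeriv_clm_apply f a p (isSmooth_tanProj f) hs

theorem ambDeriv_norProj_apply {s : M → E} (hs : IsSmooth m s) (a : E) (p : M) :
    ambDeriv f a (fun q => norProj f q (s q)) p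
      = -projVar f a p (s p) + norProj f p (ambDeriv f a s p) := by
  rw [ambDeriv_clm_apply f a p (isSmooth_norProj f) hs, ambDeriv_norProj, neg_apply]

/-- Differentiate `P² = P`. Consequently `∂_a P` maps tangent vectors to normal ones and conversely.
-/
theorem projVar_apply_tanProj (a : E) (p : M) (v : E) :
    projVar f a p (tanProj f p v) + tanProj f p (projVar f a p v) = projVar f a p v := by
  have h1 : IsSmooth m fun q => tanProj f q v := (isSmooth_tanProj f).clm_apply contMDiff_const
  have h2 := ambDeriv_tanProj_apply f h1 a p
  simp only [tanProj_tanProj] at h2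
  rw [ambDeriv_apply f a p (isSmooth_tanProj f)] at h2
  exact h2.symm

theorem tanProj_projVar_of_tangent {p : M} {v : E} (hv : tanProj f p v = v) (a : E) :
    tanProj f p (projVar f a p v) = 0 := by
  simpa [hv] using projVar_apply_tanProj f a p v

theorem tanProj_projVar_of_normal {p : M} {v : E} (hv : tanProj f p v = 0) (a : E) :
    tanProj f p (projVar f a p v) = projVar f a p v := by
  simpa [hv] using projVar_apply_tanProj f a p v

theorem norProj_projVar_norProj (a : E) (p : M) (v : E) :
    norProj f p (projVar f a p (norProj f p v)) = 0 :=
  norProj_eq_zero_of_tanProj f (tanProj_projVar_of_normal f (tanProj_norProj f p v) a)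

theorem norProj_projVar_tanProj (a : E) (p : M) (v : E) :
    norProj f p (projVar f a p (tanProj f p v)) = norProj f p (projVar f a p v) := by
  have h := norProj_projVar_norProj f a p v
  rw [norProj_apply f p v, map_sub, map_sub, sub_eq_zero] at h
  exact h.symm

theorem inner_projVar (a : E) (p : M) (u v : E) :
    inner ℝ (projVar f a p u) v = inner ℝ u (projVar f a p v) := by
  have hs (u : E) : IsSmooth m fun q => tanProj f q u :=
    (isSmooth_tanProj f).clm_apply contMDiff_const
  have h1 := ambDeriv_clm f a p (innerSL ℝ v) (hs u)
  have h2 := ambDeriv_clm f a p (innerSL ℝ u) (hs v)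
  have h3 : (fun q => innerSL ℝ v (tanProj f q u)) = fun q => innerSL ℝ u (tanProj f q v) := by
    funext q
    simp only [innerSL_apply_apply]
    rw [real_inner_comm, inner_tanProj]
  rw [h3, h2, ambDeriv_apply f a p (isSmooth_tanProj f),
    ambDeriv_apply f a p (isSmooth_tanProj f)] at h1
  simp only [innerSL_apply_apply] at h1
  rw [real_inner_comm]
  exact h1.symm

theorem star_projVar (a : E) (p : M) : star (projVar f a p) = projVar f a p := by
  rw [ContinuousLinearMap.star_eq_adjoint]
  refine ((ContinuousLinearMap.eq_adjoint_iff _ _).2 fun u v => inner_projVar f a p u v).symm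

theorem tanProj_projVar_sub (a c : E) (p : M) :
    tanProj f p (projVar f a p c - projVar f c p a) = projVar f a p c - projVar f c p a := by
  have h := tanProj_commutator f p a c
  rwa [ambDeriv_apply f a p (isSmooth_tanProj f), ambDeriv_apply f c p (isSmooth_tanProj f)] at h

theorem norProj_projVar_comm (a c : E) (p : M) :
    norProj f p (projVar f a p c) = norProj f p (projVar f c p a) := by
  rw [← sub_eq_zero, ← map_sub]
  exact norProj_eq_zero_of_tanProj f (tanProj_projVar_sub f a c p)

theorem projVar_comm_of_tangent {p : M} {a c : E} (ha : tanProj f p a = a) (hc : tanProj f p c = c) :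
    projVar f a p c = projVar f c p a := by
  rw [← norProj_of_tanProj_eq_zero f (tanProj_projVar_of_tangent f hc a), norProj_projVar_comm,
    norProj_of_tanProj_eq_zero f (tanProj_projVar_of_tangent f ha c)]

theorem ambDeriv_commutator' {s : M → V} (hs : IsSmooth m s) (p : M) (v w : E) :
    ambDeriv f v (ambDeriv f w s) p - ambDeriv f w (ambDeriv f v s) p
      = ambDeriv f (projVar f v p w - projVar f w p v) s p := by
  rw [ambDeriv_commutator f hs, ambDeriv_apply f v p (isSmooth_tanProj f),
    ambDeriv_apply f w p (isSmooth_tanProj f)]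
  rfl

theorem ambDeriv_comm_of_tangent {s : M → V} (hs : IsSmooth m s) {p : M} {v w : E}
    (hv : tanProj f p v = v) (hw : tanProj f p w = w) :
    ambDeriv f v (ambDeriv f w s) p = ambDeriv f w (ambDeriv f v s) p := by
  rw [← sub_eq_zero, ambDeriv_commutator' f hs, projVar_comm_of_tangent f hv hw, sub_self]
  exact ambDeriv_eq_zero_of_normal f (map_zero _) s

end Projection

/-! ### Traces -/

section Trace

variable {m : ℕ} {E : Type*} [NormedAddCommGroup E] [InnerProductSpace ℝ E]
  [FiniteDimensional ℝ E] {V : Type*}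
  {M : Type*} [TopologicalSpace M] [ChartedSpace (EuclideanSpace ℝ (Fin m)) M]
  (f : Immersion m M E)

/-- The orthonormal basis of `df_p(T_p M)` in which traces are taken. -/
def frame (p : M) (i : Fin (Module.finrank ℝ (tangentPlane f p))) : E :=
  stdOrthonormalBasis ℝ (tangentPlane f p) i

theorem tanProj_frame (p : M) (i : Fin (Module.finrank ℝ (tangentPlane f p))) :
    tanProj f p (frame f p i) = frame f p i :=
  Submodule.starProjection_eq_self_iff.2 (stdOrthonormalBasis ℝ (tangentPlane f p) i).2

theorem tanProj_eq_sum_frame (p : M) (v : E) :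
    tanProj f p v = ∑ i, (inner ℝ (frame f p i) v : ℝ) • frame f p i := by
  rw [tanProj, (stdOrthonormalBasis ℝ (tangentPlane f p)).starProjection_eq_sum_rankOne]
  simp [frame]

section

variable [NormedAddCommGroup V] [InnerProductSpace ℝ V] [FiniteDimensional ℝ V]

omit [InnerProductSpace ℝ V] in
theorem trace_eq_sum_frame (p : M) {β : TangentSpace (𝓡 m) p → TangentSpace (𝓡 m) p → V}
    {F : E → E → V} (h : ∀ a b, tanProj f p a = a → tanProj f p b = b →
      β (tanPart f p a) (tanPart f p b) = F a b) :
    trace f p β = ∑ i, F (frame f p i) (frame f p i) :=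
  Finset.sum_congr rfl fun i _ => h _ _ (tanProj_frame f p i) (tanProj_frame f p i)

end

variable [AddCommGroup V] [Module ℝ V]

theorem sum_frame_eq (p : M) {F : E → E → V} (h1 : ∀ b, IsLinearMap ℝ fun a => F a b)
    (h2 : ∀ a, IsLinearMap ℝ (F a)) :
    ∑ i, F (frame f p i) (frame f p i)
      = ∑ k, F (tanProj f p (stdOrthonormalBasis ℝ E k)) (stdOrthonormalBasis ℝ E k) := by
  have h3 : ∀ k, F (tanProj f p (stdOrthonormalBasis ℝ E k)) (stdOrthonormalBasis ℝ E k)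
      = ∑ i, (inner ℝ (frame f p i) (stdOrthonormalBasis ℝ E k) : ℝ)
        • F (frame f p i) (stdOrthonormalBasis ℝ E k) := fun k => by
    rw [tanProj_eq_sum_frame]
    have := map_sum (h1 (stdOrthonormalBasis ℝ E k)).mk'
      (fun i => (inner ℝ (frame f p i) (stdOrthonormalBasis ℝ E k) : ℝ) • frame f p i) Finset.univ
    refine this.trans (Finset.sum_congr rfl fun i _ => ?_)
    exact (h1 (stdOrthonormalBasis ℝ E k)).map_smul _ _
  simp_rw [h3]
  rw [Finset.sum_comm]
  refine Finset.sum_congr rfl fun i _ => ?_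
  conv_lhs => rw [← (stdOrthonormalBasis ℝ E).sum_repr' (frame f p i)]
  have := map_sum (h2 (frame f p i)).mk' (fun k => (inner ℝ (stdOrthonormalBasis ℝ E k)
    (frame f p i) : ℝ) • stdOrthonormalBasis ℝ E k) Finset.univ
  rw [OrthonormalBasis.sum_repr'] at this ⊢
  refine this.trans (Finset.sum_congr rfl fun k _ => ?_)
  rw [real_inner_comm]
  exact (h2 (frame f p i)).map_smul _ _

/-- The frame is chosen point by point, without continuity, whereas a fixed ambient basis can be
differentiated through. The mixed tangential-normal terms sum to the trace of `F(a, Q b)` over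
tangent vectors, which is zero; `h0` removes the purely normal ones. -/
theorem sum_frame_eq_sum (p : M) {F : E → E → V} (h1 : ∀ b, IsLinearMap ℝ fun a => F a b)
    (h2 : ∀ a, IsLinearMap ℝ (F a))
    (h0 : ∀ a b, tanProj f p a = 0 → tanProj f p b = 0 → F a b = 0) :
    ∑ i, F (frame f p i) (frame f p i)
      = ∑ k, F (stdOrthonormalBasis ℝ E k) (stdOrthonormalBasis ℝ E k) := by
  have hc : ∀ {F : E → E → V}, (∀ b, IsLinearMap ℝ fun a => F a b) → (∀ a, IsLinearMap ℝ (F a)) →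
      ∑ k, F (tanProj f p (stdOrthonormalBasis ℝ E k)) (norProj f p (stdOrthonormalBasis ℝ E k))
        = 0 := fun {F} h1 h2 => by
    rw [← sum_frame_eq f p (F := fun a b => F a (norProj f p b)) (fun b => h1 _)
      (fun a => ⟨fun x y => by rw [map_add, (h2 a).map_add],
        fun r x => by rw [map_smul, (h2 a).map_smul]⟩)]
    refine Finset.sum_eq_zero fun i _ => ?_
    rw [norProj_eq_zero_of_tanProj f (tanProj_frame f p i)]
    exact (h2 _).map_zero
  have hd : ∀ v : E, tanProj f p v + norProj f p v = v := fun v => by rw [norProj_apply]; abel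
  have hd1 : ∀ a b, F a b = F (tanProj f p a) b + F (norProj f p a) b := fun a b => by
    rw [← (h1 b).map_add, hd]
  have hd2 : ∀ a b, F a b = F a (tanProj f p b) + F a (norProj f p b) := fun a b => by
    rw [← (h2 a).map_add, hd]
  have e1 : ∀ k, F (stdOrthonormalBasis ℝ E k) (stdOrthonormalBasis ℝ E k)
      = F (tanProj f p (stdOrthonormalBasis ℝ E k)) (stdOrthonormalBasis ℝ E k)
        + F (norProj f p (stdOrthonormalBasis ℝ E k)) (tanProj f p (stdOrthonormalBasis ℝ E k)) :=
    fun k => by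
      rw [hd1, hd2 (norProj f p _), h0 _ _ (tanProj_norProj _ _ _) (tanProj_norProj _ _ _),
        add_zero]
  rw [sum_frame_eq f p h1 h2, Finset.sum_congr rfl fun k _ => e1 k, Finset.sum_add_distrib,
    hc (F := fun a b => F b a) h2 h1, add_zero]

end Trace

/-! ### The normal connection and its curvature -/

section Normal

variable {m : ℕ} {E : Type*} [NormedAddCommGroup E] [InnerProductSpace ℝ E]
  [FiniteDimensional ℝ E] {V : Type*} [NormedAddCommGroup V] [InnerProductSpace ℝ V]
  [FiniteDimensional ℝ V]
  {M : Type*} [TopologicalSpace M] [ChartedSpace (EuclideanSpace ℝ (Fin m)) M]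
  (f : Immersion m M E)

/-- The derivative of `ξ` with respect to the normal connection in the direction of the tangential
part of `a`. -/
def norDeriv (a : E) (ξ : M → E) (p : M) : E := norProj f p (ambDeriv f a ξ p)

/-- The operator `Q [∂_a P, ∂_b P]`, where `P` and `Q` are the tangential and normal projections. -/
def norCurv (a b : E) (p : M) : E →L[ℝ] E :=
  norProj f p * (projVar f a p * projVar f b p - projVar f b p * projVar f a p)

theorem norCurv_apply (a b : E) (p : M) (v : E) : norCurv f a b p v
    = norProj f p (projVar f a p (projVar f b p v)) - norProj f p (projVar f b p (projVar f a p v)) :=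
  map_sub (norProj f p) (projVar f a p (projVar f b p v)) (projVar f b p (projVar f a p v))

theorem norProj_norCurv (a b : E) (p : M) (v : E) :
    norProj f p (norCurv f a b p v) = norCurv f a b p v :=
  norProj_norProj f p _

theorem norCurv_tanProj (a b : E) (p : M) :
    norCurv f (tanProj f p a) (tanProj f p b) p = norCurv f a b p := by
  rw [norCurv, projVar_tanProj, projVar_tanProj, norCurv]

theorem norCurv_zero_left (b : E) (p : M) : norCurv f 0 b p = 0 := by
  have h : projVar f 0 p = 0 := projVar_eq_zero_of_normal f (map_zero _)
  ext v
  simp [norCurv_apply, h]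

theorem norCurv_zero_right (b : E) (p : M) : norCurv f b 0 p = 0 := by
  have h : projVar f 0 p = 0 := projVar_eq_zero_of_normal f (map_zero _)
  ext v
  simp [norCurv_apply, h]

/-- The normal covariant derivative of `ξ`, as an operator. -/
def norDerivOp (ξ : M → E) (p : M) : E →L[ℝ] E :=
  norProj f p ∘L LinearMap.toContinuousLinearMap (isLinearMap_ambDeriv f ξ p).mk'

theorem norDerivOp_apply (ξ : M → E) (p : M) (a : E) : norDerivOp f ξ p a = norDeriv f a ξ p := rfl

theorem norDerivOp_tanProj (ξ : M → E) (p : M) (a : E) :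
    norDerivOp f ξ p (tanProj f p a) = norDerivOp f ξ p a :=
  congrArg (norProj f p) (ambDeriv_tanProj f p a ξ)

theorem norDerivOp_eq_zero {ξ : M → E} {p : M} {a : E} (h : tanProj f p a = 0) :
    norDerivOp f ξ p a = 0 := by
  rw [← norDerivOp_tanProj, h, map_zero]

theorem norProj_norDeriv (a : E) (ξ : M → E) (p : M) :
    norProj f p (norDeriv f a ξ p) = norDeriv f a ξ p :=
  norProj_norProj f p _

theorem tanProj_norDeriv (a : E) (ξ : M → E) (p : M) : tanProj f p (norDeriv f a ξ p) = 0 :=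
  tanProj_norProj f p _

theorem nablaPerp_eq (p : M) (u : TangentSpace (𝓡 m) p) (ξ : M → E) :
    nablaPerp f p u ξ = norDeriv f (mvfderiv (𝓡 m) f p u) ξ p :=
  congrArg (norProj f p) (mvfderiv_eq_ambDeriv f ξ p u)

theorem mvfderiv_extend (p q : M) (v : TangentSpace (𝓡 m) p) :
    mvfderiv (𝓡 m) f q (extend f p v q) = tanProj f q (mvfderiv (𝓡 m) f p v) :=
  mvfderiv_tanPart f q _

variable [IsManifold (𝓡 m) ∞ M]

/-- Extensions are parallel at `p`, so all correction terms with `∇_u v` drop out of second-order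
operators. -/
theorem leviCivita_extend (p : M) (u v : TangentSpace (𝓡 m) p) :
    leviCivita f p u (extend f p v) = 0 := by
  simp only [leviCivita, mvfderiv_extend]
  rw [mvfderiv_eq_ambDeriv f, ambDeriv_apply f _ p (isSmooth_tanProj f)]
  exact tanPart_eq_zero f (tanProj_projVar_of_tangent f (tanProj_mvfderiv f p v) _)

theorem secondFF_eq (p : M) (u v : TangentSpace (𝓡 m) p) :
    secondFF f p u v = projVar f (mvfderiv (𝓡 m) f p u) p (mvfderiv (𝓡 m) f p v) := by
  simp only [secondFF, mvfderiv_extend]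
  rw [mvfderiv_eq_ambDeriv f, ambDeriv_apply f _ p (isSmooth_tanProj f)]
  exact norProj_of_tanProj_eq_zero f
    (tanProj_projVar_of_tangent f (tanProj_mvfderiv f p v) _)

theorem ambDeriv_extendNormal (a ξ : E) (p : M) :
    ambDeriv f a (extendNormal f ξ) p = -projVar f a p ξ := by
  have h := ambDeriv_norProj_apply f (s := fun _ => ξ) contMDiff_const a p
  rwa [ambDeriv_const, map_zero, add_zero] at h

theorem mvfderiv_weingarten {p : M} {ξ : E} (hξ : tanProj f p ξ = 0) (u : TangentSpace (𝓡 m) p) :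
    mvfderiv (𝓡 m) f p (weingarten f p ξ u) = projVar f (mvfderiv (𝓡 m) f p u) p ξ := by
  rw [weingarten, map_neg, mvfderiv_tanPart, mvfderiv_eq_ambDeriv f, ambDeriv_extendNormal,
    map_neg, neg_neg]
  exact tanProj_projVar_of_normal f hξ _

theorem IsSmooth.norDeriv {ξ : M → E} (hξ : IsSmooth m ξ) (a : E) : IsSmooth m (norDeriv f a ξ) :=
  (isSmooth_norProj f).clm_apply (IsSmooth.ambDeriv f hξ a)

theorem isSmooth_norDerivOp {ξ : M → E} (hξ : IsSmooth m ξ) : IsSmooth m (norDerivOp f ξ) :=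
  isSmooth_of_clm_apply fun w => hξ.norDeriv f w

theorem isSmooth_norCurv (a b : E) : IsSmooth m (norCurv f a b) :=
  (isSmooth_norProj f).clm_comp (((isSmooth_projVar f a).clm_comp (isSmooth_projVar f b)).sub
    ((isSmooth_projVar f b).clm_comp (isSmooth_projVar f a)))

theorem norDeriv_norProj {s : M → E} (hs : IsSmooth m s) (a : E) (p : M) :
    norDeriv f a (fun q => norProj f q (s q)) p
      = -norProj f p (projVar f a p (s p)) + norProj f p (ambDeriv f a s p) := by
  rw [norDeriv, ambDeriv_norProj_apply f hs, map_add, map_neg, norProj_norProj]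

theorem norProj_projVar_of_normal {p : M} {ξ : E} (h : norProj f p ξ = ξ) (a : E) :
    norProj f p (projVar f a p ξ) = 0 := by
  rw [← h, norProj_projVar_norProj]

/-- Only the tangential part of `∂_b ξ` survives `Q ∂_a P`, and differentiating `Q ξ = ξ` identifies
it with `-(∂_b P) ξ`. -/
theorem norProj_projVar_ambDeriv {ξ : M → E} (hξ : IsSmooth m ξ) (hn : ∀ q, norProj f q (ξ q) = ξ q)
    (a b : E) (p : M) : norProj f p (projVar f a p (ambDeriv f b ξ p))
      = -norProj f p (projVar f a p (projVar f b p (ξ p))) := by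
  have h := ambDeriv_norProj_apply f hξ b p
  simp only [hn] at h
  rw [h, map_add, map_add, norProj_projVar_norProj, add_zero, map_neg, map_neg]

/-- The Ricci identity for the normal connection. -/
theorem norDeriv_commutator {ξ : M → E} (hξ : IsSmooth m ξ) (hn : ∀ q, norProj f q (ξ q) = ξ q)
    (a b : E) (p : M) :
    norDeriv f a (norDeriv f b ξ) p - norDeriv f b (norDeriv f a ξ) p
      = norCurv f a b p (ξ p) + norDerivOp f ξ p (projVar f a p b - projVar f b p a) := by
  have h1 := fun a b => norDeriv_norProj f (IsSmooth.ambDeriv f hξ b) a p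
  have h2 : norDerivOp f ξ p (projVar f a p b - projVar f b p a)
      = norProj f p (ambDeriv f (projVar f a p b - projVar f b p a) ξ p) := rfl
  rw [h2, ← ambDeriv_commutator' f hξ, map_sub, norCurv_apply]
  refine (congrArg₂ (· - ·) (h1 a b) (h1 b a)).trans ?_
  rw [norProj_projVar_ambDeriv f hξ hn, norProj_projVar_ambDeriv f hξ hn]
  abel

theorem curvPerp_eq (p : M) (u v : TangentSpace (𝓡 m) p) (ξ : E) :
    curvPerp f p u v ξ
      = norCurv f (mvfderiv (𝓡 m) f p u) (mvfderiv (𝓡 m) f p v) p ξ := by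
  have h0 : nablaPerp f p (VectorField.mlieBracket (𝓡 m) (extend f p u) (extend f p v) p)
      (extendNormal f ξ) = 0 := by
    rw [mlieBracket_extend, nablaPerp, projDeriv, map_zero, map_zero]
  have h1 : ∀ v : TangentSpace (𝓡 m) p,
      (fun q => nablaPerp f q (extend f p v q) (extendNormal f ξ))
        = norDeriv f (mvfderiv (𝓡 m) f p v) (extendNormal f ξ) := fun v => rfl
  have hs : IsSmooth m (extendNormal f ξ) := (isSmooth_norProj f).clm_apply contMDiff_const
  rw [curvPerp, h0, h1, h1, sub_zero, nablaPerp_eq, nablaPerp_eq,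
    norDeriv_commutator f hs (fun q => norProj_norProj f q ξ),
    projVar_comm_of_tangent f (tanProj_mvfderiv f p u) (tanProj_mvfderiv f p v), sub_self, map_zero,
    add_zero, norCurv_apply, norCurv_apply, extendNormal]
  -- Here `ξ` is arbitrary; its tangential part does not contribute, since `∂_b P` maps it to a
  -- normal vector, which `Q ∂_a P` kills.
  have h2 : ∀ a b : E, norProj f p (projVar f a p (projVar f b p (norProj f p ξ)))
      = norProj f p (projVar f a p (projVar f b p ξ)) := fun a b => by
    have h3 : projVar f b p (norProj f p ξ) = tanProj f p (projVar f b p ξ) := by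
      rw [norProj_apply, map_sub, sub_eq_iff_eq_add, add_comm]
      exact (projVar_apply_tanProj f b p ξ).symm
    rw [h3, norProj_projVar_tanProj]
  rw [h2, h2]

theorem norCurv_eq_zero {p : M} {x : E} (hx : tanProj f p x = x) (a b : E) :
    norCurv f a b p x = 0 := by
  have h : ∀ a b, norProj f p (projVar f a p (projVar f b p x)) = 0 := fun a b =>
    norProj_projVar_of_normal f
      (norProj_of_tanProj_eq_zero f (tanProj_projVar_of_tangent f hx b)) a
  rw [norCurv_apply, h, h, sub_zero]

theorem norCurv_norProj (a b : E) (p : M) (x : E) :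
    norCurv f a b p (norProj f p x) = norCurv f a b p x := by
  rw [norProj_apply, map_sub, norCurv_eq_zero f (tanProj_tanProj f p x), sub_zero]

theorem norDeriv_norCurv {ξ : M → E} (hξ : IsSmooth m ξ) (a b c : E) (p : M) :
    norDeriv f a (fun q => norCurv f b c q (ξ q)) p
      = norProj f p (ambDeriv f a (norCurv f b c) p (ξ p))
        + norCurv f b c p (norDerivOp f ξ p a) := by
  rw [norDeriv, ambDeriv_clm_apply f a p (isSmooth_norCurv f b c) hξ, map_add, norProj_norCurv,
    norDerivOp_apply, norDeriv, norCurv_norProj]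

/-- The extensions of `v` and `w` are parallel at `p`, and the term with the derivative of the
extended `ξ` cancels the one from the product rule; only the derivative of the operator is left. -/
theorem nablaCurvPerp_eq {p : M} {ξ : E} (hξ : norProj f p ξ = ξ)
    (u v w : TangentSpace (𝓡 m) p) :
    nablaCurvPerp f p u v w ξ = norProj f p (ambDeriv f (mvfderiv (𝓡 m) f p u)
      (norCurv f (mvfderiv (𝓡 m) f p v) (mvfderiv (𝓡 m) f p w)) p ξ) := by
  have hs : IsSmooth m (extendNormal f ξ) := (isSmooth_norProj f).clm_apply contMDiff_const
  have h1 : (fun q => curvPerp f q (extend f p v q) (extend f p w q) (extendNormal f ξ q))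
      = fun q => norCurv f (mvfderiv (𝓡 m) f p v) (mvfderiv (𝓡 m) f p w) q (extendNormal f ξ q) :=
    funext fun q => by
      rw [curvPerp_eq, mvfderiv_extend, mvfderiv_extend, norCurv_tanProj]
  have h2 : extendNormal f ξ p = ξ := hξ
  rw [nablaCurvPerp, h1, leviCivita_extend, leviCivita_extend, curvPerp_eq, curvPerp_eq,
    curvPerp_eq, map_zero, norCurv_zero_left, norCurv_zero_right, nablaPerp_eq, nablaPerp_eq,
    norDeriv_norCurv f hs, h2, norDerivOp_apply]
  simp

omit [FiniteDimensional ℝ V] in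
/-- The trace formula for the rough Laplacian. -/
theorem roughLaplacian_eq (Q : M → V →L[ℝ] V) (s : M → V) (p : M) :
    roughLaplacian f Q s p = -∑ i, Q p (ambDeriv f (frame f p i)
      (fun q => Q q (ambDeriv f (frame f p i) s q)) p) := by
  rw [roughLaplacian, trace_eq_sum_frame f p
    (F := fun a b => Q p (ambDeriv f a (fun q => Q q (ambDeriv f b s q)) p))]
  intro a b ha hb
  rw [leviCivita_extend]
  have h1 : (fun q => projDeriv Q q (extend f p (tanPart f p b) q) s)
      = fun q => Q q (ambDeriv f b s q) := funext fun q => by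
    have : extend f p (tanPart f p b) q = tanPart f q b := by
      rw [extend, mvfderiv_tanPart, hb]
    rw [this]; rfl
  rw [h1, projDeriv, projDeriv, map_zero, map_zero, sub_zero]
  rfl

omit [IsManifold (𝓡 m) ∞ M] in
theorem isLinearMap_norDeriv (ξ : M → E) (p : M) : IsLinearMap ℝ fun a => norDeriv f a ξ p :=
  (norDerivOp f ξ p).toLinearMap.isLinear

omit [FiniteDimensional ℝ V] in
theorem isLinearMap_ambDeriv_apply {A : E → M → V} (hA : ∀ b, IsSmooth m (A b))
    (hlin : ∀ q, IsLinearMap ℝ fun b => A b q) (a : E) (p : M) :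
    IsLinearMap ℝ fun b => ambDeriv f a (A b) p := by
  refine ⟨fun b c => ?_, fun r b => ?_⟩
  · rw [← ambDeriv_add f a p (hA b) (hA c)]
    exact congrArg (fun s => ambDeriv f a s p) (funext fun q => (hlin q).map_add b c)
  · have h := ambDeriv_clm f a p (r • ContinuousLinearMap.id ℝ V) (hA b)
    refine (congrArg (fun s => ambDeriv f a s p) (funext fun q => (hlin q).map_smul r b)).trans h

theorem laplacianPerp_eq {ξ : M → E} (hξ : IsSmooth m ξ) (p : M) :
    laplacianPerp f ξ p = -∑ k, norDeriv f (stdOrthonormalBasis ℝ E k)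
      (norDeriv f (stdOrthonormalBasis ℝ E k) ξ) p := by
  rw [laplacianPerp, roughLaplacian_eq, ← sum_frame_eq_sum f p
    (F := fun a b => norDeriv f a (norDeriv f b ξ) p)]
  · rfl
  · exact fun b => isLinearMap_norDeriv f _ p
  · intro a
    have h := isLinearMap_ambDeriv_apply f (A := fun b => norDeriv f b ξ)
      (fun b => hξ.norDeriv f b) (fun q => isLinearMap_norDeriv f ξ q) a p
    exact ((norProj f p).toLinearMap.comp h.mk').isLinear
  · intro a b ha _
    exact norDerivOp_eq_zero f ha

/-! #### The mean curvature -/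

/-- The trace of the second fundamental form. -/
def traceSecondFF (p : M) : E :=
  ∑ k, norProj f p (projVar f (stdOrthonormalBasis ℝ E k) p (stdOrthonormalBasis ℝ E k))

theorem sum_frame_projVar (p : M) :
    ∑ i, projVar f (frame f p i) p (frame f p i) = traceSecondFF f p := by
  rw [traceSecondFF, ← sum_frame_eq_sum f p (F := fun a b => norProj f p (projVar f a p b))]
  · refine Finset.sum_congr rfl fun i _ => ?_
    exact (norProj_of_tanProj_eq_zero f
      (tanProj_projVar_of_tangent f (tanProj_frame f p i) _)).symm
  · exact fun b => ⟨fun x y => by rw [(isLinearMap_projVar f p).map_add, add_apply, map_add],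
      fun r x => by rw [(isLinearMap_projVar f p).map_smul, smul_apply, map_smul]⟩
  · exact fun a => (norProj f p ∘L projVar f a p).toLinearMap.isLinear
  · intro a b ha _
    rw [projVar_eq_zero_of_normal f ha, zero_apply, map_zero]

theorem meanCurvature_eq (p : M) : meanCurvature f p = (1 / (m : ℝ)) • traceSecondFF f p := by
  rw [meanCurvature, ← sum_frame_projVar, trace_eq_sum_frame f p (F := fun a b => projVar f a p b)]
  intro a b ha hb
  rw [secondFF_eq, mvfderiv_tanPart, mvfderiv_tanPart, ha, hb]

theorem smul_meanCurvature (p : M) : (m : ℝ) • meanCurvature f p = traceSecondFF f p := by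
  rw [meanCurvature_eq]
  -- For `m = 0` the factor `1 / m` is `0` by convention, and the trace is an empty sum.
  by_cases hm : m = 0
  · have h : Module.finrank ℝ (tangentPlane f p) = 0 := by
      rw [← (tangentEquiv f p).finrank_eq, ← hm]
      exact finrank_euclideanSpace_fin
    rw [← sum_frame_projVar, Finset.sum_eq_zero fun i _ => absurd i.2 (by omega), smul_zero,
      smul_zero]
  · rw [smul_smul, mul_one_div_cancel (by exact_mod_cast hm), one_smul]

theorem isSmooth_traceSecondFF : IsSmooth m (traceSecondFF f) :=
  contMDiff_finsetSum fun _ _ =>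
    (isSmooth_norProj f).clm_apply ((isSmooth_projVar f _).clm_apply contMDiff_const)

theorem isSmooth_meanCurvature : IsSmooth m (meanCurvature f) := by
  have h : meanCurvature f = fun p => (1 / (m : ℝ)) • traceSecondFF f p :=
    funext (meanCurvature_eq f)
  rw [h]
  exact ((1 / (m : ℝ)) • ContinuousLinearMap.id ℝ E).contDiff.comp_contMDiff
    (isSmooth_traceSecondFF f)

omit [IsManifold (𝓡 m) ∞ M] in
theorem norProj_traceSecondFF (p : M) : norProj f p (traceSecondFF f p) = traceSecondFF f p := by
  rw [traceSecondFF, map_sum]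
  exact Finset.sum_congr rfl fun k _ => norProj_norProj f p _

theorem norProj_meanCurvature (p : M) : norProj f p (meanCurvature f p) = meanCurvature f p := by
  rw [meanCurvature_eq, map_smul, norProj_traceSecondFF]

end Normal

/-! ### Operators from the tangent to the normal bundle -/

section Hom

variable {m : ℕ} {E : Type*} [NormedAddCommGroup E] [InnerProductSpace ℝ E]
  [FiniteDimensional ℝ E]
  {M : Type*} [TopologicalSpace M] [ChartedSpace (EuclideanSpace ℝ (Fin m)) M]
  (f : Immersion m M E)

/-- The covariant derivative of a section `A` of `Hom(TM, NM)`. -/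
def homDeriv (a : E) (A : M → E →L[ℝ] E) (p : M) : E →L[ℝ] E :=
  norProj f p * ambDeriv f a A p * tanProj f p

/-- The second fundamental form as an operator. -/
def secondFFOp (a : E) (p : M) : E →L[ℝ] E := norProj f p * projVar f a p * tanProj f p

theorem homDeriv_apply (a : E) (A : M → E →L[ℝ] E) (p : M) (v : E) :
    homDeriv f a A p v = norProj f p (ambDeriv f a A p (tanProj f p v)) := rfl

theorem secondFFOp_apply (a : E) (p : M) (v : E) :
    secondFFOp f a p v = norProj f p (projVar f a p (tanProj f p v)) := rfl

variable [IsManifold (𝓡 m) ∞ M]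

theorem secondFFOp_of_tangent {p : M} {v : E} (hv : tanProj f p v = v) (a : E) :
    secondFFOp f a p v = projVar f a p v := by
  rw [secondFFOp_apply, hv]
  exact norProj_of_tanProj_eq_zero f (tanProj_projVar_of_tangent f hv a)

theorem isSmooth_homDeriv {A : M → E →L[ℝ] E} (hA : IsSmooth m A) (a : E) :
    IsSmooth m (homDeriv f a A) :=
  ((isSmooth_norProj f).clm_comp (IsSmooth.ambDeriv f hA a)).clm_comp (isSmooth_tanProj f)

theorem isSmooth_secondFFOp (a : E) : IsSmooth m (secondFFOp f a) :=
  ((isSmooth_norProj f).clm_comp (isSmooth_projVar f a)).clm_comp (isSmooth_tanProj f)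

theorem norDeriv_clm_apply {A : M → E →L[ℝ] E} (hA : IsSmooth m A) (a v : E) (p : M) :
    norDeriv f a (fun q => A q v) p = norProj f p (ambDeriv f a A p v) :=
  congrArg (norProj f p) (ambDeriv_apply f a p hA v)

theorem norDeriv_sub {s t : M → E} (hs : IsSmooth m s) (ht : IsSmooth m t) (a : E) (p : M) :
    norDeriv f a (fun q => s q - t q) p = norDeriv f a s p - norDeriv f a t p := by
  rw [norDeriv, ambDeriv_sub f a p hs ht, map_sub]; rfl

theorem norDeriv_add {s t : M → E} (hs : IsSmooth m s) (ht : IsSmooth m t) (a : E) (p : M) :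
    norDeriv f a (fun q => s q + t q) p = norDeriv f a s p + norDeriv f a t p := by
  rw [norDeriv, ambDeriv_add f a p hs ht, map_add]; rfl

theorem norDeriv_sum {ι : Type*} (I : Finset ι) {s : ι → M → E} (hs : ∀ i, IsSmooth m (s i))
    (a : E) (p : M) :
    norDeriv f a (fun q => ∑ i ∈ I, s i q) p = ∑ i ∈ I, norDeriv f a (s i) p := by
  rw [norDeriv, ambDeriv_sum f a p I hs, map_sum]; rfl

theorem star_secondFFOp (a : E) (p : M) :
    star (secondFFOp f a p) = tanProj f p * projVar f a p * norProj f p := by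
  have h1 : star (tanProj f p) = tanProj f p := isSelfAdjoint_starProjection _
  have h2 : star (norProj f p) = norProj f p := isSelfAdjoint_starProjection _
  have h3 := star_mul (norProj f p * projVar f a p) (tanProj f p)
  have h4 := star_mul (norProj f p) (projVar f a p)
  exact h3.trans (by rw [h4, h1, h2, star_projVar, mul_assoc])

/-! ### Second and third covariant derivatives of a normal field. -/

section Second

variable {ξ : M → E} (hξ : IsSmooth m ξ) (hn : ∀ q, norProj f q (ξ q) = ξ q)
include hξ

/-- This is the Hessian `∇²ξ(a,b)`: the tangential part of the constant `b` has derivative `(∂_a P)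
b`, whose tangential part gives the correction. -/
theorem homDeriv_norDerivOp_apply (a b : E) (p : M) :
    homDeriv f a (norDerivOp f ξ) p b
      = norDeriv f a (norDeriv f b ξ) p - norDerivOp f ξ p (projVar f a p b) := by
  have hP : IsSmooth m fun q => tanProj f q b := (isSmooth_tanProj f).clm_apply contMDiff_const
  have h1 : norDeriv f b ξ = fun q => norDerivOp f ξ q (tanProj f q b) := funext fun q => by
    rw [norDerivOp_tanProj, norDerivOp_apply]
  rw [h1, homDeriv_apply, norDeriv,
    ambDeriv_clm_apply f a p (isSmooth_norDerivOp f hξ) hP, ambDeriv_apply f a p (isSmooth_tanProj f),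
    map_add, eq_sub_iff_add_eq]
  congr 1
  exact (norProj_norDeriv f _ ξ p).symm

/-- Obtained by differentiating the fact that `norDerivOp` vanishes on normal vectors while the
normal space turns. -/
theorem homDeriv_comp_norDerivOp (a : E) {p : M} {y : E} (hy : tanProj f p y = 0) :
    norProj f p (ambDeriv f a (norDerivOp f ξ) p y) = norDerivOp f ξ p (projVar f a p y) := by
  have h := homDeriv_norDerivOp_apply f hξ a y p
  rw [homDeriv_apply, hy, map_zero, map_zero, eq_comm, sub_eq_zero] at h
  rw [← h, ← norDeriv_clm_apply f (isSmooth_norDerivOp f hξ)]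
  rfl

theorem norDeriv_norDerivOp_projVar {p : M} {e : E} (he : tanProj f p e = e) (v w : E) :
    norDeriv f v (fun q => norDerivOp f ξ q (projVar f w q e)) p
      = norDerivOp f ξ p (projVar f v p (projVar f w p e))
        + norDerivOp f ξ p (ambDeriv f v (projVar f w) p e) := by
  have hs : IsSmooth m fun q => projVar f w q e := (isSmooth_projVar f w).clm_apply contMDiff_const
  rw [norDeriv, ambDeriv_clm_apply f v p (isSmooth_norDerivOp f hξ) hs,
    ambDeriv_apply f v p (isSmooth_projVar f w), map_add,
    homDeriv_comp_norDerivOp f hξ v (tanProj_projVar_of_tangent f he w)]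
  congr 1
  exact norProj_norDeriv f _ ξ p

theorem norDeriv_homDeriv {p : M} {e : E} (he : tanProj f p e = e) (v w : E) :
    norDeriv f v (fun q => homDeriv f w (norDerivOp f ξ) q e) p
      = norDeriv f v (norDeriv f w (norDeriv f e ξ)) p
        - norDerivOp f ξ p (projVar f v p (projVar f w p e))
        - norDerivOp f ξ p (ambDeriv f v (projVar f w) p e) := by
  have hs : IsSmooth m fun q => norDerivOp f ξ q (projVar f w q e) :=
    (isSmooth_norDerivOp f hξ).clm_apply ((isSmooth_projVar f w).clm_apply contMDiff_const)
  rw [funext fun q => homDeriv_norDerivOp_apply f hξ w e q,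
    norDeriv_sub f ((hξ.norDeriv f e).norDeriv f w) hs, norDeriv_norDerivOp_projVar f hξ he, sub_sub]

/-- The Ricci identity applies to the normal field `norDeriv f e ξ`; the second derivatives of `P`
in directions `v, w` commute at `p`, and the remaining terms record that `e` is tangent only at `p`.
-/
theorem norDeriv_homDeriv_comm {p : M} {v w e : E} (hv : tanProj f p v = v) (hw : tanProj f p w = w)
    (he : tanProj f p e = e) :
    norDeriv f v (fun q => homDeriv f w (norDerivOp f ξ) q e) p
      = norDeriv f w (fun q => homDeriv f v (norDerivOp f ξ) q e) p
        + norCurv f v w p (norDerivOp f ξ p e)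
        + norDerivOp f ξ p (projVar f w p (projVar f v p e))
        - norDerivOp f ξ p (projVar f v p (projVar f w p e)) := by
  have h1 := norDeriv_commutator f (hξ.norDeriv f e) (norProj_norDeriv f e ξ) v w p
  rw [projVar_comm_of_tangent f hv hw, sub_self, map_zero, add_zero, sub_eq_iff_eq_add] at h1
  have h2 : ambDeriv f v (projVar f w) p = ambDeriv f w (projVar f v) p :=
    ambDeriv_comm_of_tangent f (isSmooth_tanProj f) hv hw
  rw [norDeriv_homDeriv f hξ he, norDeriv_homDeriv f hξ he, h1, h2, norDerivOp_apply f ξ p e]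
  abel

/-- Contraction commutes with covariant differentiation: in a fixed basis the trace passes under the
derivative, and the traced Hessian is `-Δ^⊥ ξ`. -/
theorem sum_norDeriv_homDeriv (w : E) (p : M) :
    ∑ i, norDeriv f w (fun q => homDeriv f (frame f p i) (norDerivOp f ξ) q (frame f p i)) p
      = -norDeriv f w (laplacianPerp f ξ) p := by
  have hA := fun a => isSmooth_homDeriv f (isSmooth_norDerivOp f hξ) a
  have hAb : ∀ a b, IsSmooth m fun q => homDeriv f a (norDerivOp f ξ) q b :=
    fun a b => (hA a).clm_apply contMDiff_const
  have hlin : ∀ b q, IsLinearMap ℝ fun a => homDeriv f a (norDerivOp f ξ) q b := fun b q =>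
    ⟨fun x y => by
      simp only [homDeriv_apply]
      rw [(isLinearMap_ambDeriv f _ q).map_add, add_apply, map_add],
    fun r x => by
      simp only [homDeriv_apply]
      rw [(isLinearMap_ambDeriv f _ q).map_smul, smul_apply, map_smul]⟩
  have hQ : ∀ {A : E → M → E}, (∀ b, IsSmooth m (A b)) → (∀ q, IsLinearMap ℝ fun b => A b q) →
      IsLinearMap ℝ fun b => norDeriv f w (A b) p := fun h1 h2 =>
    ((norProj f p).toLinearMap.comp (isLinearMap_ambDeriv_apply f h1 h2 w p).mk').isLinear
  rw [sum_frame_eq_sum f p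
    (F := fun a b => norDeriv f w (fun q => homDeriv f a (norDerivOp f ξ) q b) p)
    (fun b => hQ (fun a => hAb a b) (hlin b))
    (fun a => hQ (A := fun b q => homDeriv f a (norDerivOp f ξ) q b) (hAb a)
      (fun q => (homDeriv f a (norDerivOp f ξ) q).toLinearMap.isLinear)),
    ← norDeriv_sum f _ fun k => hAb _ _]
  · have h1 : laplacianPerp f ξ = fun q => -∑ k, homDeriv f (stdOrthonormalBasis ℝ E k)
        (norDerivOp f ξ) q (stdOrthonormalBasis ℝ E k) := funext fun q => by
      rw [laplacianPerp_eq f hξ, Finset.sum_congr rfl fun k _ =>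
        homDeriv_norDerivOp_apply f hξ (stdOrthonormalBasis ℝ E k) (stdOrthonormalBasis ℝ E k) q,
        Finset.sum_sub_distrib]
      have h2 : ∑ k, norDerivOp f ξ q (projVar f (stdOrthonormalBasis ℝ E k) q
          (stdOrthonormalBasis ℝ E k)) = 0 := by
        rw [← sum_frame_eq_sum f q (F := fun a b => norDerivOp f ξ q (projVar f a q b))]
        · refine Finset.sum_eq_zero fun i _ => norDerivOp_eq_zero f ?_
          exact tanProj_projVar_of_tangent f (tanProj_frame f q i) _
        · exact fun b => ⟨fun x y => by
              rw [(isLinearMap_projVar f q).map_add, add_apply, map_add],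
            fun r x => by rw [(isLinearMap_projVar f q).map_smul, smul_apply, map_smul]⟩
        · exact fun a => (norDerivOp f ξ q ∘L projVar f a q).toLinearMap.isLinear
        · intro a b ha _
          rw [projVar_eq_zero_of_normal f ha, zero_apply, map_zero]
      rw [h2, sub_zero]
    have hS : IsSmooth m fun q => ∑ k, homDeriv f (stdOrthonormalBasis ℝ E k)
        (norDerivOp f ξ) q (stdOrthonormalBasis ℝ E k) := contMDiff_finsetSum fun k _ => hAb _ _
    have h3 := ambDeriv_clm f w p (-ContinuousLinearMap.id ℝ E) hS
    rw [h1, eq_neg_iff_add_eq_zero, norDeriv, norDeriv, ← map_add]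
    refine (congrArg (norProj f p) ?_).trans (map_zero _)
    refine (congrArg (_ + ·) h3).trans ?_
    exact add_neg_cancel _
  · intro a b ha hb
    rw [norDeriv_clm_apply f (hA a)]
    have h1 : ∀ q, homDeriv f a (norDerivOp f ξ) q b
        = norProj f q (ambDeriv f a (norDerivOp f ξ) q (tanProj f q b)) := fun q => rfl
    rw [← ambDeriv_apply f w p (hA a), funext h1]
    have hs : IsSmooth m fun q => tanProj f q b := (isSmooth_tanProj f).clm_apply contMDiff_const
    have hB := IsSmooth.ambDeriv f (isSmooth_norDerivOp f hξ) a
    rw [ambDeriv_norProj_apply f (hB.clm_apply hs), ambDeriv_clm_apply f w p hB hs, hb,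
      ambDeriv_eq_zero_of_normal f ha, map_zero, map_zero, zero_apply, neg_zero,
      zero_add, map_zero, zero_add, map_zero, map_zero]

include hn

theorem homDeriv_norDerivOp_comm (a b : E) (p : M) :
    homDeriv f a (norDerivOp f ξ) p b
      = homDeriv f b (norDerivOp f ξ) p a + norCurv f a b p (ξ p) := by
  have h := norDeriv_commutator f hξ hn a b p
  rw [homDeriv_norDerivOp_apply f hξ, homDeriv_norDerivOp_apply f hξ, sub_eq_iff_eq_add.1 h, map_sub]
  abel

/-- The rough Laplacian of the operator `∇^⊥ ξ`. -/
theorem sum_homDeriv_homDeriv {p : M} {w : E} (hw : tanProj f p w = w) :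
    ∑ i, homDeriv f (frame f p i) (homDeriv f (frame f p i) (norDerivOp f ξ)) p w
      = -norDeriv f w (laplacianPerp f ξ) p
        + (2 : ℝ) • ∑ i, norCurv f (frame f p i) w p (norDerivOp f ξ p (frame f p i))
        + ∑ i, norProj f p (ambDeriv f (frame f p i) (norCurv f (frame f p i) w) p (ξ p))
        + norDerivOp f ξ p (projVar f w p (traceSecondFF f p))
        - ∑ i, norDerivOp f ξ p (projVar f (frame f p i) p (projVar f w p (frame f p i))) := by
  have hA := fun a => isSmooth_homDeriv f (isSmooth_norDerivOp f hξ) a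
  -- Two exchanges bring `w` outermost: inside the Hessian, then between the two outer derivatives.
  -- Each yields one term `R^⊥(e_i, w) ∇_{e_i} ξ`, whence the factor 2.
  have h1 : ∀ i, homDeriv f (frame f p i) (homDeriv f (frame f p i) (norDerivOp f ξ)) p w
      = norDeriv f w (fun q => homDeriv f (frame f p i) (norDerivOp f ξ) q (frame f p i)) p
        + (2 : ℝ) • norCurv f (frame f p i) w p (norDerivOp f ξ p (frame f p i))
        + norProj f p (ambDeriv f (frame f p i) (norCurv f (frame f p i) w) p (ξ p))
        + norDerivOp f ξ p (projVar f w p (projVar f (frame f p i) p (frame f p i)))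
        - norDerivOp f ξ p (projVar f (frame f p i) p (projVar f w p (frame f p i))) := fun i => by
    have he := tanProj_frame f p i
    rw [homDeriv_apply, hw, ← norDeriv_clm_apply f (hA _),
      funext fun q => homDeriv_norDerivOp_comm f hξ hn (frame f p i) w q,
      norDeriv_add f ((hA w).clm_apply contMDiff_const) ((isSmooth_norCurv f _ w).clm_apply hξ),
      norDeriv_homDeriv_comm f hξ he hw he, norDeriv_norCurv f hξ, two_smul]
    abel
  rw [Finset.sum_congr rfl fun i _ => h1 i]
  simp only [Finset.sum_add_distrib, Finset.sum_sub_distrib]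
  rw [sum_norDeriv_homDeriv f hξ, ← Finset.smul_sum,
    ← map_sum (norDerivOp f ξ p), ← map_sum (projVar f w p), sum_frame_projVar]

end Second

theorem norDeriv_secondFFOp {p : M} {e : E} (he : tanProj f p e = e) (v w : E) :
    norDeriv f v (fun q => secondFFOp f w q e) p = norProj f p (ambDeriv f v (projVar f w) p e) := by
  have h1 : (fun q => secondFFOp f w q e) = fun q => norProj f q (projVar f w q e) :=
    funext fun q => norProj_projVar_tanProj f w q e
  have hs : IsSmooth m fun q => projVar f w q e := (isSmooth_projVar f w).clm_apply contMDiff_const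
  rw [h1, norDeriv_norProj f hs, ambDeriv_apply f v p (isSmooth_projVar f w),
    norProj_projVar_of_normal f
      (norProj_of_tanProj_eq_zero f (tanProj_projVar_of_tangent f he w)), neg_zero, zero_add]

theorem secondFFOp_comm (a b : E) (p : M) :
    secondFFOp f a p b = secondFFOp f b p a :=
  (norProj_projVar_tanProj f a p b).trans
    ((norProj_projVar_comm f a b p).trans (norProj_projVar_tanProj f b p a).symm)

/-- The trace of the Codazzi equation. -/
theorem sum_homDeriv_secondFFOp {p : M} {w : E} (hw : tanProj f p w = w) :
    ∑ i, homDeriv f (frame f p i) (secondFFOp f (frame f p i)) p w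
      = norDeriv f w (traceSecondFF f) p := by
  have hs : ∀ a b, IsSmooth m fun q => secondFFOp f a q b :=
    fun a b => (isSmooth_secondFFOp f a).clm_apply contMDiff_const
  -- Codazzi: `w` and `e_i` change places first by symmetry of `B`, then because second derivatives
  -- of `P` commute at `p`.
  have h1 : ∀ i, homDeriv f (frame f p i) (secondFFOp f (frame f p i)) p w
      = norDeriv f w (fun q => secondFFOp f (frame f p i) q (frame f p i)) p := fun i => by
    have he := tanProj_frame f p i
    rw [homDeriv_apply, hw, ← norDeriv_clm_apply f (isSmooth_secondFFOp f _),
      funext fun q => secondFFOp_comm f (frame f p i) w q, norDeriv_secondFFOp f he,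
      norDeriv_secondFFOp f he]
    exact congrArg (fun B : E →L[ℝ] E => norProj f p (B (frame f p i)))
      (ambDeriv_comm_of_tangent f (isSmooth_tanProj f) he hw)
  have hlin : ∀ a q, IsLinearMap ℝ fun b => secondFFOp f a q b := fun a q =>
    (secondFFOp f a q).toLinearMap.isLinear
  have hQ : ∀ {A : E → M → E}, (∀ b, IsSmooth m (A b)) → (∀ q, IsLinearMap ℝ fun b => A b q) →
      IsLinearMap ℝ fun b => norDeriv f w (A b) p := fun h1 h2 =>
    ((norProj f p).toLinearMap.comp (isLinearMap_ambDeriv_apply f h1 h2 w p).mk').isLinear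
  have h2 : traceSecondFF f = fun q => ∑ k, secondFFOp f (stdOrthonormalBasis ℝ E k) q
      (stdOrthonormalBasis ℝ E k) := funext fun q =>
    Finset.sum_congr rfl fun k _ => (norProj_projVar_tanProj f _ q _).symm
  rw [Finset.sum_congr rfl fun i _ => h1 i, h2, norDeriv_sum f _ fun k => hs _ _]
  refine sum_frame_eq_sum f p (F := fun a b => norDeriv f w (fun q => secondFFOp f a q b) p)
    (fun b => hQ (fun a => hs a b) fun q => ?_) (fun a => hQ (hs a) (hlin a)) fun a b ha hb => ?_
  · simp_rw [secondFFOp_comm f _ b q]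
    exact hlin b q
  · have hP : IsSmooth m fun q => tanProj f q b := (isSmooth_tanProj f).clm_apply contMDiff_const
    have hB := isSmooth_projVar f a
    have h3 : (fun q => secondFFOp f a q b) = fun q => norProj f q (projVar f a q (tanProj f q b)) :=
      rfl
    rw [h3, norDeriv_norProj f (hB.clm_apply hP), ambDeriv_clm_apply f w p hB hP, hb,
      projVar_eq_zero_of_normal f ha, map_zero, map_zero, zero_apply, add_zero,
      map_zero, map_zero, neg_zero, zero_add, map_zero]

theorem star_secondFFOp_of_normal {p : M} {x : E} (hx : tanProj f p x = 0) (a : E) :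
    star (secondFFOp f a p) x = projVar f a p x := by
  rw [star_secondFFOp]
  change tanProj f p (projVar f a p (norProj f p x)) = _
  rw [norProj_of_tanProj_eq_zero f hx, tanProj_projVar_of_normal f hx]

/-- In the frame both sides are `∑ ⟨T e_j, B(e_i, w)⟩ B(e_i, e_j)`, summed over `i` and `j`. This
turns the adjoint of `∇^⊥ ξ` into Weingarten operators. -/
theorem sum_projVar_star {p : M} {w : E} (hw : tanProj f p w = w) {T : E →L[ℝ] E}
    (hT : ∀ v, T (tanProj f p v) = T v) (hT' : ∀ v, tanProj f p (T v) = 0) :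
    ∑ i, projVar f (frame f p i) p (star T (projVar f (frame f p i) p w))
      = ∑ i, projVar f (frame f p i) p (projVar f w p (T (frame f p i))) := by
  have hstar : ∀ v, tanProj f p (star T v) = star T v := fun v => by
    refine ext_inner_left ℝ fun u => ?_
    rw [← inner_tanProj, ContinuousLinearMap.star_eq_adjoint,
      ContinuousLinearMap.adjoint_inner_right, ContinuousLinearMap.adjoint_inner_right, hT]
  have hexp : ∀ i (x : E), tanProj f p x = x → projVar f (frame f p i) p x
      = ∑ j, (inner ℝ (frame f p j) x : ℝ) • projVar f (frame f p i) p (frame f p j) := by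
    intro i x hx
    conv_lhs => rw [← hx, tanProj_eq_sum_frame, map_sum]
    exact Finset.sum_congr rfl fun j _ => map_smul _ _ _
  rw [Finset.sum_congr rfl fun i _ => hexp i _ (hstar _), Finset.sum_comm]
  refine Finset.sum_congr rfl fun j _ => ?_
  rw [hexp j _ (tanProj_projVar_of_normal f (hT' _) w)]
  refine Finset.sum_congr rfl fun i _ => ?_
  rw [projVar_comm_of_tangent f (tanProj_frame f p i) (tanProj_frame f p j)]
  congr 1
  rw [ContinuousLinearMap.star_eq_adjoint, ContinuousLinearMap.adjoint_inner_right,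
    projVar_comm_of_tangent f (tanProj_frame f p i) hw, ← inner_projVar, real_inner_comm]

/-- The operator whose vanishing is the biharmonic equation of the Gauss map. -/
def biharmonicOp (ξ : M → E) (p : M) : E →L[ℝ] E :=
  ∑ i, homDeriv f (frame f p i) (homDeriv f (frame f p i) (norDerivOp f ξ)) p
    - ∑ i, (secondFFOp f (frame f p i) p * star (norDerivOp f ξ p) * secondFFOp f (frame f p i) p
      - norDerivOp f ξ p * star (secondFFOp f (frame f p i) p) * secondFFOp f (frame f p i) p
      + secondFFOp f (frame f p i) p * star (norDerivOp f ξ p) * secondFFOp f (frame f p i) p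
      - secondFFOp f (frame f p i) p * star (secondFFOp f (frame f p i) p) * norDerivOp f ξ p)

/-- With `T = ∇^⊥ ξ` and `b_i = B(e_i, ·)`, the curvature term `T b_i* b_i` cancels the last sum of
`sum_homDeriv_homDeriv`, the two terms `b_i T* b_i` give the factor 2, and `b_i b_i* T` gives the
remaining Weingarten term. -/
theorem biharmonicOp_apply {ξ : M → E} (hξ : IsSmooth m ξ) (hn : ∀ q, norProj f q (ξ q) = ξ q)
    {p : M} {w : E} (hw : tanProj f p w = w) :
    biharmonicOp f ξ p w
      = -(norDeriv f w (laplacianPerp f ξ) p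
        - norDerivOp f ξ p (projVar f w p (traceSecondFF f p))
        + ∑ i, projVar f (frame f p i) p
            ((2 : ℝ) • projVar f w p (norDerivOp f ξ p (frame f p i))
              - projVar f (frame f p i) p (norDerivOp f ξ p w))
        - (2 : ℝ) • ∑ i, norCurv f (frame f p i) w p (norDerivOp f ξ p (frame f p i))
        - ∑ i, norProj f p (ambDeriv f (frame f p i) (norCurv f (frame f p i) w) p (ξ p))) := by
  have hT : ∀ v, norDerivOp f ξ p (tanProj f p v) = norDerivOp f ξ p v :=
    fun v => norDerivOp_tanProj f ξ p v
  have hT' : ∀ v, tanProj f p (norDerivOp f ξ p v) = 0 := fun v => tanProj_norDeriv f v ξ p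
  have hstar : ∀ v, tanProj f p (star (norDerivOp f ξ p) v) = star (norDerivOp f ξ p) v := fun v => by
    refine ext_inner_left ℝ fun u => ?_
    rw [← inner_tanProj, ContinuousLinearMap.star_eq_adjoint,
      ContinuousLinearMap.adjoint_inner_right, ContinuousLinearMap.adjoint_inner_right, hT]
  have h1 : ∀ i, secondFFOp f (frame f p i) p (star (norDerivOp f ξ p)
      (secondFFOp f (frame f p i) p w)) = projVar f (frame f p i) p
        (star (norDerivOp f ξ p) (projVar f (frame f p i) p w)) := fun i => by
    rw [secondFFOp_of_tangent f (hstar _), secondFFOp_of_tangent f hw]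
  have h2 : ∀ i, norDerivOp f ξ p (star (secondFFOp f (frame f p i) p)
      (secondFFOp f (frame f p i) p w)) = norDerivOp f ξ p (projVar f (frame f p i) p
        (projVar f w p (frame f p i))) := fun i => by
    rw [secondFFOp_of_tangent f hw, star_secondFFOp_of_normal f (tanProj_projVar_of_tangent f hw _),
      projVar_comm_of_tangent f (tanProj_frame f p i) hw]
  have h3 : ∀ i, secondFFOp f (frame f p i) p (star (secondFFOp f (frame f p i) p)
      (norDerivOp f ξ p w)) = projVar f (frame f p i) p (projVar f (frame f p i) p
        (norDerivOp f ξ p w)) := fun i => by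
    rw [star_secondFFOp_of_normal f (hT' w), secondFFOp_of_tangent f
      (tanProj_projVar_of_normal f (hT' w) _)]
  have h4 : biharmonicOp f ξ p w
      = ∑ i, homDeriv f (frame f p i) (homDeriv f (frame f p i) (norDerivOp f ξ)) p w
        - ∑ i, (projVar f (frame f p i) p (star (norDerivOp f ξ p) (projVar f (frame f p i) p w))
          - norDerivOp f ξ p (projVar f (frame f p i) p (projVar f w p (frame f p i)))
          + projVar f (frame f p i) p (star (norDerivOp f ξ p) (projVar f (frame f p i) p w))
          - projVar f (frame f p i) p (projVar f (frame f p i) p (norDerivOp f ξ p w))) := by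
    rw [biharmonicOp, sub_apply, sum_apply, sum_apply]
    congr 1
    refine Finset.sum_congr rfl fun i _ => ?_
    rw [← h1, ← h2, ← h3]
    rfl
  rw [h4, sum_homDeriv_homDeriv f hξ hn hw]
  simp only [map_sub, map_smul, Finset.sum_add_distrib, Finset.sum_sub_distrib, ← Finset.smul_sum]
  rw [sum_projVar_star f hw hT hT', two_smul, two_smul]
  abel

end Hom

/-! ### Linearity in the normal field -/

section HomSpace

variable {m : ℕ} {E : Type*} [NormedAddCommGroup E] [InnerProductSpace ℝ E]
  [FiniteDimensional ℝ E]
  {M : Type*} [TopologicalSpace M] [ChartedSpace (EuclideanSpace ℝ (Fin m)) M]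
  (f : Immersion m M E)

/-- The space `Hom(T_p M, N_p M)`. -/
def homSpace (p : M) : Submodule ℝ (E →L[ℝ] E) where
  carrier := {A | (∀ v, tanProj f p (A v) = 0) ∧ ∀ v, A (tanProj f p v) = A v}
  add_mem' {A B} hA hB := ⟨fun v => by rw [add_apply, map_add, hA.1, hB.1, add_zero],
    fun v => by rw [add_apply, hA.2, hB.2, add_apply]⟩
  zero_mem' := ⟨fun v => by rw [zero_apply, map_zero], fun v => rfl⟩
  smul_mem' c A hA := ⟨fun v => by rw [smul_apply, map_smul, hA.1, smul_zero],
    fun v => by rw [smul_apply, hA.2, smul_apply]⟩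

theorem norProj_mul_mul_tanProj_mem (A : E →L[ℝ] E) (p : M) :
    norProj f p * A * tanProj f p ∈ homSpace f p :=
  ⟨fun _ => tanProj_norProj f p _, fun v =>
    congrArg (fun x => norProj f p (A x)) (tanProj_tanProj f p v)⟩

theorem homDeriv_mem (a : E) (A : M → E →L[ℝ] E) (p : M) : homDeriv f a A p ∈ homSpace f p :=
  norProj_mul_mul_tanProj_mem f _ p

theorem secondFFOp_mem (a : E) (p : M) : secondFFOp f a p ∈ homSpace f p :=
  norProj_mul_mul_tanProj_mem f _ p

theorem norDerivOp_mem (ξ : M → E) (p : M) : norDerivOp f ξ p ∈ homSpace f p :=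
  ⟨fun v => tanProj_norDeriv f v ξ p, norDerivOp_tanProj f ξ p⟩

theorem mul_mul_mem {p : M} {A C : E →L[ℝ] E} (hA : A ∈ homSpace f p) (hC : C ∈ homSpace f p)
    (B : E →L[ℝ] E) : A * B * C ∈ homSpace f p :=
  ⟨fun v => hA.1 (B (C v)), fun v => congrArg (fun x => A (B x)) (hC.2 v)⟩

theorem tanProj_mul_of_mem {p : M} {A : E →L[ℝ] E} (hA : A ∈ homSpace f p) :
    (tangentPlane f p).starProjection * A = 0 :=
  ContinuousLinearMap.ext hA.1

theorem mul_tanProj_of_mem {p : M} {A : E →L[ℝ] E} (hA : A ∈ homSpace f p) :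
    A * (tangentPlane f p).starProjection = A :=
  ContinuousLinearMap.ext hA.2

theorem eq_of_mem_homSpace {p : M} {A B : E →L[ℝ] E} (hA : A ∈ homSpace f p)
    (hB : B ∈ homSpace f p) (h : ∀ w, tanProj f p w = w → A w = B w) : A = B := by
  ext v
  rw [← hA.2, ← hB.2, h _ (tanProj_tanProj f p v)]

variable [IsManifold (𝓡 m) ∞ M]

omit [IsManifold (𝓡 m) ∞ M] in
theorem biharmonicOp_mem (ξ : M → E) (p : M) : biharmonicOp f ξ p ∈ homSpace f p := by
  have hb := fun i => secondFFOp_mem f (frame f p i) p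
  have hT := norDerivOp_mem f ξ p
  exact Submodule.sub_mem _ (Submodule.sum_mem _ fun i _ => homDeriv_mem f _ _ p)
    (Submodule.sum_mem _ fun i _ => Submodule.sub_mem _ (Submodule.add_mem _ (Submodule.sub_mem _
      (mul_mul_mem f (hb i) (hb i) _) (mul_mul_mem f hT (hb i) _)) (mul_mul_mem f (hb i) (hb i) _))
      (mul_mul_mem f (hb i) hT _))

theorem norDeriv_smul {s : M → E} (hs : IsSmooth m s) (c : ℝ) (a : E) (p : M) :
    norDeriv f a (fun q => c • s q) p = c • norDeriv f a s p := by
  have h := ambDeriv_clm f a p (c • ContinuousLinearMap.id ℝ E) hs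
  exact (congrArg (norProj f p) h).trans (map_smul _ _ _)

theorem homDeriv_smul {A : M → E →L[ℝ] E} (hA : IsSmooth m A) (c : ℝ) (a : E) (p : M) :
    homDeriv f a (fun q => c • A q) p = c • homDeriv f a A p := by
  have h := ambDeriv_clm f a p (c • ContinuousLinearMap.id ℝ (E →L[ℝ] E)) hA
  have h' : ambDeriv f a (fun q => c • A q) p = c • ambDeriv f a A p := h
  ext v
  rw [homDeriv_apply, h', smul_apply, map_smul, smul_apply, homDeriv_apply]

theorem biharmonicOp_smul {ξ : M → E} (hξ : IsSmooth m ξ) (c : ℝ) (p : M) :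
    biharmonicOp f (fun q => c • ξ q) p = c • biharmonicOp f ξ p := by
  have h1 : norDerivOp f (fun q => c • ξ q) = fun q => c • norDerivOp f ξ q :=
    funext fun q => ContinuousLinearMap.ext fun v => norDeriv_smul f hξ c v q
  have h2 : ∀ a, homDeriv f a (fun q => c • norDerivOp f ξ q)
      = fun q => c • homDeriv f a (norDerivOp f ξ) q := fun a =>
    funext fun q => homDeriv_smul f (isSmooth_norDerivOp f hξ) c a q
  have h3 : star (c • norDerivOp f ξ p) = c • star (norDerivOp f ξ p) := by
    rw [star_smul]; rfl
  rw [biharmonicOp, biharmonicOp, smul_sub, Finset.smul_sum, Finset.smul_sum, h1]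
  congr 1
  · refine Finset.sum_congr rfl fun i _ => ?_
    rw [h2, homDeriv_smul f (isSmooth_homDeriv f (isSmooth_norDerivOp f hξ) _)]
  · refine Finset.sum_congr rfl fun i _ => ?_
    ext v
    simp only [h3, sub_apply, add_apply, smul_apply, mul_apply_eq_comp, map_smul,
      smul_sub, smul_add]

end HomSpace

/-! ### The Gauss map -/

section Gauss

variable {m n : ℕ} {M : Type*} [TopologicalSpace M] [ChartedSpace (EuclideanSpace ℝ (Fin m)) M]
  [IsManifold (𝓡 m) ∞ M] (f : Immersion m M (EuclideanSpace ℝ (Fin (m + n))))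
  {γ : M → MultiVector m (m + n)}

theorem ambDeriv_eq_zero_of_comp {W : Type*} [NormedAddCommGroup W] [NormedSpace ℝ W]
    {G : MultiVector m (m + n) → W} (hγ : IsSmooth m γ) (hG : Differentiable ℝ G)
    (h0 : ∀ q, G (γ q) = 0) (a : EuclideanSpace ℝ (Fin (m + n))) (p : M) :
    fderiv ℝ G (γ p) (ambDeriv f a γ p) = 0 := by
  have h3 : inChart m p γ (extChartAt (𝓡 m) p p) = γ p :=
    congrArg γ ((extChartAt (𝓡 m) p).left_inv (mem_extChartAt_source p))
  have h4 : G ∘ inChart m p γ = fun _ => 0 := funext fun x => h0 _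
  have h5 := fderiv_comp (extChartAt (𝓡 m) p p) (hG (inChart m p γ (extChartAt (𝓡 m) p p)))
    (differentiableAt_inChart p hγ)
  rw [h3, h4, fderiv_fun_const] at h5
  rw [ambDeriv_eq_fderiv f a p hγ]
  exact (DFunLike.congr_fun h5 _).symm

variable (hγ : IsSmooth m γ) (hU : ∀ q, IsUnitVolume (tangentPlane f q) (γ q))
include hγ hU

/-- The equations of the Grassmannian recover a tangent vector from the derivative of `moment`, and
along `γ` that moment is the tangential projection of `M`. -/
theorem ambDeriv_gauss (a : EuclideanSpace ℝ (Fin (m + n))) (p : M) :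
    ambDeriv f a γ p = der (secondFFOp f a p) (γ p) := by
  obtain ⟨G, hG, hG0, hG1⟩ := (hU p).exists_equations
  have h1 := hG1 _ (ambDeriv_eq_zero_of_comp f hγ hG
    (fun q => hG0 _ (mem_grassmannian_iff.2 ⟨_, hU q⟩)) a p)
  have h2 : ambDeriv f a (fun q => moment (γ q) (γ q)) p = projVar f a p :=
    congrArg (fun s => ambDeriv f a s p) (funext fun q => (hU q).moment_self)
  rw [ambDeriv_comp f a p (g := fun z => moment z z) (contDiff_moment contDiff_id contDiff_id) hγ,
    fderiv_moment_self] at h2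
  rw [h2] at h1
  rw [secondFFOp, norProj_eq]
  exact h1

/-- In the product rule the term `D_A (dγ)` is a second derivative `D_A D_b γ`, normal to the
Grassmannian; of `D_{∂A} γ` only the `Hom(TM, NM)` block of `∂A` is tangential. -/
theorem tangentMap_ambDeriv_der {A : M → Op (m + n)} (hA : IsSmooth m A)
    (hA' : ∀ q, A q ∈ homSpace f q) (a : EuclideanSpace ℝ (Fin (m + n))) (p : M) :
    projTo (grassmannian m n) (γ p) (ambDeriv f a (fun q => der (A q) (γ q)) p)
      = der (homDeriv f a A p) (γ p) := by
  let D : Op (m + n) →L[ℝ] (MultiVector m (m + n) →L[ℝ] MultiVector m (m + n)) :=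
    LinearMap.toContinuousLinearMap (der (m := m) (N := m + n))
  have hD : IsSmooth m fun q => D (A q) := D.contDiff.comp_contMDiff hA
  have h1 : ambDeriv f a (fun q => der (A q) (γ q)) p
      = der (ambDeriv f a A p) (γ p) + der (A p) (ambDeriv f a γ p) := by
    refine (ambDeriv_clm_apply f a p hD hγ).trans ?_
    rw [ambDeriv_clm f a p D hA]
    rfl
  have hd := homDeriv_mem f a A p
  rw [(hU p).projTo_eq, h1, ambDeriv_gauss f hγ hU, map_add,
    (hU p).tangentMap_der_der (tanProj_mul_of_mem f (hA' p)) (mul_tanProj_of_mem f (hA' p))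
      (tanProj_mul_of_mem f (secondFFOp_mem f a p)), add_zero, (hU p).der_eq, map_add, map_smul,
    (hU p).tangentMap_self, smul_zero, zero_add]
  have h2 : (1 - (tangentPlane f p).starProjection) * ambDeriv f a A p
      * (tangentPlane f p).starProjection = homDeriv f a A p := by
    rw [homDeriv, norProj_eq]; rfl
  rw [h2, (hU p).tangentMap_der (tanProj_mul_of_mem f hd) (mul_tanProj_of_mem f hd)]

theorem tension_gauss (p : M) :
    tension f (grassmannian m n) γ p = der (norDerivOp f (traceSecondFF f) p) (γ p) := by
  rw [tension, trace_eq_sum_frame f p (F := fun a b => projTo (grassmannian m n) (γ p)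
    (ambDeriv f a (fun q => der (secondFFOp f b q) (γ q)) p))]
  · rw [Finset.sum_congr rfl fun i _ => tangentMap_ambDeriv_der f hγ hU
      (isSmooth_secondFFOp f (frame f p i)) (fun q => secondFFOp_mem f _ q) (frame f p i) p]
    have h : ∑ i, homDeriv f (frame f p i) (secondFFOp f (frame f p i)) p
        = norDerivOp f (traceSecondFF f) p := by
      refine eq_of_mem_homSpace f (Submodule.sum_mem _ fun i _ => homDeriv_mem f _ _ p)
        (norDerivOp_mem f _ p) fun w hw => ?_
      rw [sum_apply, sum_homDeriv_secondFFOp f hw, norDerivOp_apply]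
    rw [← h, map_sum, sum_apply]
  · intro a b ha hb
    rw [leviCivita_extend, map_zero, sub_zero]
    have h1 : (fun q => mvfderiv (𝓡 m) γ q (extend f p (tanPart f p b) q))
        = fun q => der (secondFFOp f b q) (γ q) := funext fun q => by
      rw [← ambDeriv_gauss f hγ hU, extend, mvfderiv_tanPart, hb]
      rfl
    rw [h1]
    rfl

theorem bitension_gauss (p : M) :
    bitension f (grassmannian m n) γ p = der (biharmonicOp f (traceSecondFF f) p) (γ p) := by
  have hη := isSmooth_traceSecondFF f
  have ht := isSmooth_norDerivOp f hη
  have hT := norDerivOp_mem f (traceSecondFF f) p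
  rw [bitension, roughLaplacian_eq, funext fun q => tension_gauss f hγ hU q, neg_neg,
    trace_eq_sum_frame f p (F := fun a b => riemann (grassmannian m n) (γ p)
      (der (secondFFOp f a p) (γ p)) (der (norDerivOp f (traceSecondFF f) p) (γ p))
      (der (secondFFOp f b p) (γ p))), biharmonicOp, map_sub, sub_apply, map_sum, map_sum,
    sum_apply, sum_apply]
  · congr 1
    · refine Finset.sum_congr rfl fun i _ => ?_
      rw [funext fun q => tangentMap_ambDeriv_der f hγ hU ht
        (fun q => norDerivOp_mem f (traceSecondFF f) q) (frame f p i) q,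
        tangentMap_ambDeriv_der f hγ hU (isSmooth_homDeriv f ht _) fun q => homDeriv_mem f _ _ q]
    · refine Finset.sum_congr rfl fun i _ => ?_
      have hb := secondFFOp_mem f (frame f p i) p
      exact (hU p).riemann_eq (tanProj_mul_of_mem f hb) (mul_tanProj_of_mem f hb)
        (tanProj_mul_of_mem f hT) (mul_tanProj_of_mem f hT)
        (tanProj_mul_of_mem f hb) (mul_tanProj_of_mem f hb)
  · intro a b ha hb
    rw [← ambDeriv_gauss f hγ hU, ← ambDeriv_gauss f hγ hU]
    rfl

/-- The isometry `u ↦ D_u y` is injective on `Hom(TM, NM)`, and `biharmonicOp` is linear in the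
field `trace B = m H`. -/
theorem bitension_gauss_eq_zero_iff (p : M) :
    bitension f (grassmannian m n) γ p = 0 ↔ biharmonicOp f (meanCurvature f) p = 0 := by
  have h1 : traceSecondFF f = fun q => (m : ℝ) • meanCurvature f q :=
    funext fun q => (smul_meanCurvature f q).symm
  have hω := biharmonicOp_mem f (traceSecondFF f) p
  have h2 : der (biharmonicOp f (traceSecondFF f) p) (γ p) = 0
      ↔ biharmonicOp f (traceSecondFF f) p = 0 := by
    refine ⟨fun h => eq_zero_of_hs_self ?_, fun h => by rw [h, map_zero, zero_apply]⟩
    rw [← (hU p).inner_der_der (tanProj_mul_of_mem f hω) (mul_tanProj_of_mem f hω), h,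
      inner_zero_left]
  rw [bitension_gauss f hγ hU, h2, h1, biharmonicOp_smul f (isSmooth_meanCurvature f), smul_eq_zero,
    or_iff_right_iff_imp]
  -- If `m = 0` the factor cannot be cancelled, but then the sums over the frame are empty.
  intro hm
  have h : Module.finrank ℝ (tangentPlane f p) = 0 := by
    rw [← (tangentEquiv f p).finrank_eq, ← Nat.cast_eq_zero (R := ℝ).1 hm]
    exact finrank_euclideanSpace_fin
  rw [biharmonicOp, Finset.sum_eq_zero fun i _ => absurd i.2 (by omega),
    Finset.sum_eq_zero fun i _ => absurd i.2 (by omega), sub_zero]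

end Gauss

/-! ### Smoothness of the Gauss map. -/

section Smoothness

variable {m n : ℕ} {M : Type*} [TopologicalSpace M] [ChartedSpace (EuclideanSpace ℝ (Fin m)) M]
  [IsManifold (𝓡 m) ∞ M] (f : Immersion m M (EuclideanSpace ℝ (Fin (m + n))))

theorem contMDiffOn_mvfderiv_apply {X : ∀ q : M, TangentSpace (𝓡 m) q} {U : Set M}
    (hX : ContMDiffOn (𝓡 m) (𝓡 m).tangent ∞ (fun q => (⟨q, X q⟩ : TangentBundle (𝓡 m) M)) U) :
    ContMDiffOn (𝓡 m) 𝓘(ℝ, EuclideanSpace ℝ (Fin (m + n))) ∞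
      (fun q => mvfderiv (𝓡 m) f q (X q)) U := by
  have h1 := f.contMDiff.contMDiff_tangentMap (m := ∞) (by simp)
  have h2 := contMDiff_snd_tangentBundle_modelSpace (n := ∞) (EuclideanSpace ℝ (Fin (m + n)))
    𝓘(ℝ, EuclideanSpace ℝ (Fin (m + n)))
  exact (h2.comp h1).comp_contMDiffOn hX

theorem eq_normalize_wedge (P : OrientedGrassmannian m n) (v : Module.Basis (Fin m) ℝ P.plane)
    (hv : v.orientation = P.orientation) :
    P.toMultiVector = (‖wedge fun i => (v i : EuclideanSpace ℝ (Fin (m + n)))‖⁻¹)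
      • wedge fun i => (v i : EuclideanSpace ℝ (Fin (m + n))) := by
  obtain ⟨c, hc, h⟩ := exists_wedge_eq_smul_toMultiVector P v hv
  have h1 : ‖P.toMultiVector‖ = 1 := by
    have h2 := (isUnitVolume_toMultiVector P).inner_self
    rw [real_inner_self_eq_norm_sq] at h2
    exact (pow_eq_one_iff_of_nonneg (norm_nonneg _) (by norm_num)).1 h2
  rw [h, norm_smul, h1, mul_one, Real.norm_of_nonneg hc.le, smul_smul, inv_mul_cancel₀ hc.ne',
    one_smul]

/-- Near each point `γ` is the normalised wedge of the image of a positive smooth frame; this is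
where local compatibility of the orientations enters. -/
theorem isSmooth_gaussMap (o : ∀ p : M, Orientation ℝ (TangentSpace (𝓡 m) p) (Fin m))
    (ho : IsOrientation o) : IsSmooth m fun p => (gaussMap f o p).toMultiVector := by
  intro p
  obtain ⟨U, hUo, hpU, X, hX, hb⟩ := ho p
  let w : M → MultiVector m (m + n) := fun q => wedge fun i => mvfderiv (𝓡 m) f q (X i q)
  have h1 : ∀ q ∈ U, (gaussMap f o q).toMultiVector = ‖w q‖⁻¹ • w q := fun q hq => by
    obtain ⟨b, hbX, hbo⟩ := hb q hq
    have ho : (b.map (tangentEquiv f q)).orientation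
        = Orientation.map (Fin m) (tangentEquiv f q) (o q) := by
      rw [Module.Basis.orientation_map, hbo]
    have h2 := eq_normalize_wedge (gaussMap f o q) (b.map (tangentEquiv f q)) ho
    have h3 : (fun i => ((b.map (tangentEquiv f q)) i : EuclideanSpace ℝ (Fin (m + n))))
        = fun i => mvfderiv (𝓡 m) f q (X i q) := funext fun i => by
      rw [← hbX]; rfl
    exact h2.trans (congrArg (fun x : Fin m → EuclideanSpace ℝ (Fin (m + n)) =>
      ‖(wedge x : MultiVector m (m + n))‖⁻¹ • (wedge x : MultiVector m (m + n))) h3)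
  have hw : w p ≠ 0 := fun h => by
    have h2 := (isUnitVolume_toMultiVector (gaussMap f o p)).inner_self
    rw [h1 p hpU, h, smul_zero, inner_zero_left] at h2
    exact zero_ne_one h2
  have h4 : ContMDiffAt (𝓡 m) 𝓘(ℝ, MultiVector m (m + n)) ∞ w p :=
    (contDiff_wedge (v := fun i (z : Fin m → EuclideanSpace ℝ (Fin (m + n))) => z i)
      fun i => contDiff_apply ℝ _ i).contDiffAt.comp_contMDiffAt
      (contMDiffAt_pi_space.2 fun i =>
        (contMDiffOn_mvfderiv_apply f (hX i)).contMDiffAt (hUo.mem_nhds hpU))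
  have h5 : ContDiffAt ℝ ∞ (fun z : MultiVector m (m + n) => ‖z‖⁻¹ • z) (w p) :=
    ((contDiffAt_norm ℝ hw).inv (norm_ne_zero_iff.2 hw)).smul contDiffAt_id
  refine (h5.comp_contMDiffAt h4).congr_of_eventuallyEq ?_
  filter_upwards [hUo.mem_nhds hpU] with q hq using h1 q hq

end Smoothness

/-! ### The equation in terms of the classical invariants. -/

section Equation

variable {m : ℕ} {E : Type*} [NormedAddCommGroup E] [InnerProductSpace ℝ E]
  [FiniteDimensional ℝ E] {M : Type*} [TopologicalSpace M]
  [ChartedSpace (EuclideanSpace ℝ (Fin m)) M] [IsManifold (𝓡 m) ∞ M] (f : Immersion m M E)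

theorem biharmonicOp_meanCurvature (p : M) (X : TangentSpace (𝓡 m) p) :
    nablaPerp f p X (laplacianPerp f (meanCurvature f))
        - (m : ℝ) • nablaPerp f p (weingarten f p (meanCurvature f p) X) (meanCurvature f)
        + trace f p (fun u v => secondFF f p
            ((2 : ℝ) • weingarten f p (nablaPerp f p u (meanCurvature f)) X
              - weingarten f p (nablaPerp f p X (meanCurvature f)) u) v)
        - (2 : ℝ) • trace f p (fun u v => curvPerp f p u X (nablaPerp f p v (meanCurvature f)))
        - trace f p (fun u v => nablaCurvPerp f p u v X (meanCurvature f p))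
      = -biharmonicOp f (meanCurvature f) p (mvfderiv (𝓡 m) f p X) := by
  have hH := isSmooth_meanCurvature f
  have hn := norProj_meanCurvature f
  have hHp : tanProj f p (meanCurvature f p) = 0 := by
    rw [← hn, tanProj_norProj]
  set w := mvfderiv (𝓡 m) f p X with hw
  have hwt : tanProj f p w = w := tanProj_mvfderiv f p X
  -- The factor `m` is absorbed into `m H = trace B`, by linearity of `A` in the normal vector and
  -- of `∇^⊥` in the direction.
  have e1 : (m : ℝ) • nablaPerp f p (weingarten f p (meanCurvature f p) X) (meanCurvature f)
      = norDerivOp f (meanCurvature f) p (projVar f w p (traceSecondFF f p)) := by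
    rw [nablaPerp_eq, mvfderiv_weingarten f hHp, ← smul_meanCurvature, map_smul, map_smul]
    rfl
  have e2 : trace f p (fun u v => secondFF f p
      ((2 : ℝ) • weingarten f p (nablaPerp f p u (meanCurvature f)) X
        - weingarten f p (nablaPerp f p X (meanCurvature f)) u) v)
      = ∑ i, projVar f (frame f p i) p
          ((2 : ℝ) • projVar f w p (norDerivOp f (meanCurvature f) p (frame f p i))
            - projVar f (frame f p i) p (norDerivOp f (meanCurvature f) p w)) := by
    refine trace_eq_sum_frame f p (F := fun a b => projVar f b p
      ((2 : ℝ) • projVar f w p (norDerivOp f (meanCurvature f) p a)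
        - projVar f a p (norDerivOp f (meanCurvature f) p w))) fun a b ha hb => ?_
    have hT : ∀ c, tanProj f p (norDerivOp f (meanCurvature f) p c) = 0 :=
      fun c => tanProj_norDeriv f c _ p
    have h1 : ∀ c, norDeriv f c (meanCurvature f) p = norDerivOp f (meanCurvature f) p c :=
      fun c => rfl
    rw [secondFF_eq, map_sub, map_smul, nablaPerp_eq, nablaPerp_eq, mvfderiv_tanPart,
      mvfderiv_tanPart, ha, hb, h1, h1, mvfderiv_weingarten f (hT _), mvfderiv_weingarten f (hT _),
      mvfderiv_tanPart, ha, ← hw]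
    refine projVar_comm_of_tangent f ?_ hb
    rw [map_sub, map_smul, tanProj_projVar_of_normal f (hT _), tanProj_projVar_of_normal f (hT _)]
  have e3 : trace f p (fun u v => curvPerp f p u X (nablaPerp f p v (meanCurvature f)))
      = ∑ i, norCurv f (frame f p i) w p (norDerivOp f (meanCurvature f) p (frame f p i)) := by
    refine trace_eq_sum_frame f p (F := fun a b => norCurv f a w p
      (norDerivOp f (meanCurvature f) p b)) fun a b ha hb => ?_
    rw [curvPerp_eq, nablaPerp_eq, mvfderiv_tanPart, mvfderiv_tanPart, ha, hb, norDerivOp_apply]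
  have e4 : trace f p (fun u v => nablaCurvPerp f p u v X (meanCurvature f p))
      = ∑ i, norProj f p (ambDeriv f (frame f p i) (norCurv f (frame f p i) w) p
          (meanCurvature f p)) := by
    refine trace_eq_sum_frame f p (F := fun a b => norProj f p (ambDeriv f a (norCurv f b w) p
      (meanCurvature f p))) fun a b ha hb => ?_
    rw [nablaCurvPerp_eq f (hn p), mvfderiv_tanPart, mvfderiv_tanPart, ha, hb]
  rw [biharmonicOp_apply f hH hn hwt, e1, e2, e3, e4, nablaPerp_eq, neg_neg]

omit [IsManifold (𝓡 m) ∞ M] in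
theorem biharmonicOp_eq_zero_iff (ξ : M → E) (p : M) : biharmonicOp f ξ p = 0
    ↔ ∀ X : TangentSpace (𝓡 m) p, biharmonicOp f ξ p (mvfderiv (𝓡 m) f p X) = 0 := by
  refine ⟨fun h X => by rw [h, zero_apply], fun h => ?_⟩
  ext v
  rw [← (biharmonicOp_mem f ξ p).2, ← mvfderiv_tanPart, h, zero_apply]

end Equation

end GaussMap

end

open GaussMap in
theorem mainTheorem1 (m n : ℕ) {M : Type*} [TopologicalSpace M]
    [ChartedSpace (EuclideanSpace ℝ (Fin m)) M] [IsManifold (𝓡 m) ∞ M]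
    (f : Immersion m M (EuclideanSpace ℝ (Fin (m + n))))
    (o : ∀ p : M, Orientation ℝ (TangentSpace (𝓡 m) p) (Fin m)) (ho : IsOrientation o) :
    IsBiharmonic f (grassmannian m n) (fun p => (gaussMap f o p).toMultiVector) ↔
      ∀ (p : M) (X : TangentSpace (𝓡 m) p),
        nablaPerp f p X (laplacianPerp f (meanCurvature f))
          - (m : ℝ) • nablaPerp f p (weingarten f p (meanCurvature f p) X) (meanCurvature f)
          + trace f p (fun u v => secondFF f p
              ((2 : ℝ) • weingarten f p (nablaPerp f p u (meanCurvature f)) X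
                - weingarten f p (nablaPerp f p X (meanCurvature f)) u) v)
          - (2 : ℝ) • trace f p (fun u v => curvPerp f p u X (nablaPerp f p v (meanCurvature f)))
          - trace f p (fun u v => nablaCurvPerp f p u v X (meanCurvature f p)) = 0 := by
  have hγ := isSmooth_gaussMap f o ho
  have hU : ∀ p, IsUnitVolume (tangentPlane f p) ((gaussMap f o p).toMultiVector) :=
    fun p => isUnitVolume_toMultiVector (gaussMap f o p)
  have hS : ∀ p, (gaussMap f o p).toMultiVector ∈ grassmannian m n := fun p => ⟨_, rfl⟩
  simp only [IsBiharmonic, biharmonicOp_meanCurvature, neg_eq_zero]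
  refine ⟨fun h p => ?_, fun h => ⟨hγ, hS, fun p => ?_⟩⟩
  · exact (biharmonicOp_eq_zero_iff f _ p).1 ((bitension_gauss_eq_zero_iff f hγ hU p).1 (h.2.2 p))
  · exact (bitension_gauss_eq_zero_iff f hγ hU p).2 ((biharmonicOp_eq_zero_iff f _ p).2 (h p))
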